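/- **Notation.** Let $L=E(5,10)$ be the Lie superalgebra with even part $S_5$ (divergence-free formal vector fields in $x_1,\dots,x_5$ over $\mathbb C$) and odd part the closed formal $2$-forms $\Omega^2_{cl}(5)$; $S_5$ acts on the odd part by the Lie derivative, and $[\omega,\omega']=\omega\wedge\omega'\in\Omega^4_{cl}(5)\simeq S_5$, where $D\in S_5$ corresponds to $\iota_D(dx_1\wedge\dots\wedge dx_5)$. Write $d_{ij}=dx_i\wedge dx_j$. Grade $L$ by $\deg x_i=-\deg\partial_i=2$, $\deg d_{ij}=-1$. The degree $0$ part is $p_0=\{\sum a_{ij}x_i\partial_j : \sum a_{ii}=0\}\simeq \mathfrak{sl}_5(\mathbb C)$, with Borel subalgebra spanned by those with $a_{ij}=0$ for $i>j$, and $F(\lambda)$ denotes the irreducible $p_0$-module with highest weight $\lambda$. For a $p_0$-module $V$ let $M(V)=U(L)\otimes_{U(L_{\ge 0})}V$, where $L_{>0}$ acts on $V$ by zero, and put $M(\lambda)=M(F(\lambda))$. Let $x_i$ and $x_{ij}=-x_{ji}$ be the standard bases of $\mathbb C^5$ (on which $x_a\partial_b$ acts by $x_k\mapsto\delta_{bk}x_a$)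 and $\Lambda^2\mathbb C^5$, let $x_i^*$ and $x_{ij}^*=-x_{ji}^*$ be the dual bases, and let $$S_A=S(\mathbb C^5\oplus\Lambda^2\mathbb C^5),\quad S_B=S(\mathbb C^{5*}\oplus\Lambda^2\mathbb C^{5*}),\quad S_C=S(\mathbb C^5\oplus\mathbb C^{5*}).$$ For $m,n\ge 0$ let $S_X^{m,n}$ be the part of bidegree $(m,n)$: degree $m$ in the $x_i$ and $n$ in the $x_{ij}$ for $X=A$; degree $m$ in the $x^*_{ij}$ and $n$ in the $x^*_i$ for $X=B$; degree $m$ in the $x_i$ and $n$ in the $x^*_i$ for $X=C$. Its highest irreducible component, the $p_0$-submodule generated by $x_1^mx_{12}^n$, $(x^*_{45})^m(x^*_5)^n$, $x_1^m(x_5^*)^n$ respectively, is isomorphic to $F(m,n,0,0)$, $F(0,0,m,n)$, $F(m,0,0,n)$ respectively. Let $S_{X,\mathrm{high}}$ be the sum over $m,n$ of these components and $S_{X,\mathrm{low}}$ the sum over $m,n$ of their $p_0$-invariant complements in $S_X^{m,n}$. Put $$V_A=S_{A,\mathrm{high}},\qquad V_B=S_B/S_{B,\mathrm{low}},\qquad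 V_C=S_C/S_{C,\mathrm{low}},$$ so that $M(V_X)$ is the direct sum over $m,n\ge0$ of the modules $M(m,n,0,0)$, $M(0,0,m,n)$, $M(m,0,0,n)$ for $X=A,B,C$ respectively. Let $$\theta^A_{ij}=\frac{d}{dx_{ij}},\qquad \theta^B_{ij}=x^*_{ij},\qquad \theta^C_{ij}=x_i^*\frac{d}{dx_j}-x_j^*\frac{d}{dx_i}.$$ **Proposition.** Let $X$ be $A$, $B$ or $C$. (a) The operators $\theta^X_{ij}$ induce operators on $V_X$ (by restriction for $X=A$, by passing to the quotient for $X=B,C$), and $\nabla_X=\sum_{i,j=1}^5 d_{ij}\otimes\theta^X_{ij}$ defines a morphism of $E(5,10)$-modules $$\nabla_X:M(V_X)\to M(V_X),\qquad \nabla_X(u\otimes v)=\sum_{i,j=1}^5 u\,d_{ij}\otimes\theta^X_{ij}v\quad(u\in U(L),\ v\in V_X).$$ (b) $\nabla_X^2=0$. (c) The restriction of $\nabla_X$ to the summand of $M(V_X)$ with indices $(m,n)$ is zero if and only if $X=A$ and $n=0$, or $X=C$ and $m=0$. In particular it is never zero for $X=B$. -/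

import Mathlib

namespace E510

open MvPowerSeries (pderiv)

section LieSuperalgebra

/-- A Lie superalgebra with even part `L₀` (a Lie algebra) and odd part `L₁` (an `L₀`-module), over
a field of characteristic zero: an invariant symmetric bilinear bracket `L₁ × L₁ → L₀` satisfying
the Jacobi identity for three odd elements. -/
structure LieSuperalgebra (𝕜 L₀ L₁ : Type*) [Field 𝕜] [CharZero 𝕜] [LieRing L₀] [LieAlgebra 𝕜 L₀]
    [AddCommGroup L₁] [Module 𝕜 L₁] [LieRingModule L₀ L₁] [LieModule 𝕜 L₀ L₁] where
  odd : L₁ →ₗ[𝕜] L₁ →ₗ[𝕜] L₀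
  symm : ∀ x y, odd x y = odd y x
  lie_odd : ∀ (a : L₀) x y, ⁅a, odd x y⁆ = odd ⁅a, x⁆ y + odd x ⁅a, y⁆
  jacobi : ∀ x y z, ⁅odd x y, z⁆ + ⁅odd y z, x⁆ + ⁅odd z x, y⁆ = 0

variable {𝕜 L₀ L₁ : Type*} [Field 𝕜] [CharZero 𝕜] [LieRing L₀] [LieAlgebra 𝕜 L₀]
  [AddCommGroup L₁] [Module 𝕜 L₁] [LieRingModule L₀ L₁] [LieModule 𝕜 L₀ L₁]

/-- The relations `a b - (-1)^{p(a) p(b)} b a = [a, b]` (`a`, `b` homogeneous) defining the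
universal enveloping algebra as a quotient of the tensor algebra of `L₀ ⊕ L₁`. -/
inductive EnvRel (S : LieSuperalgebra 𝕜 L₀ L₁) :
    TensorAlgebra 𝕜 (L₀ × L₁) → TensorAlgebra 𝕜 (L₀ × L₁) → Prop
  | even_even (a b : L₀) : EnvRel S
      (TensorAlgebra.ι 𝕜 (a, 0) * TensorAlgebra.ι 𝕜 (b, 0)
        - TensorAlgebra.ι 𝕜 (b, 0) * TensorAlgebra.ι 𝕜 (a, 0)) (TensorAlgebra.ι 𝕜 (⁅a, b⁆, 0))
  | even_odd (a : L₀) (x : L₁) : EnvRel S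
      (TensorAlgebra.ι 𝕜 (a, 0) * TensorAlgebra.ι 𝕜 (0, x)
        - TensorAlgebra.ι 𝕜 (0, x) * TensorAlgebra.ι 𝕜 (a, 0)) (TensorAlgebra.ι 𝕜 (0, ⁅a, x⁆))
  | odd_odd (x y : L₁) : EnvRel S
      (TensorAlgebra.ι 𝕜 (0, x) * TensorAlgebra.ι 𝕜 (0, y)
        + TensorAlgebra.ι 𝕜 (0, y) * TensorAlgebra.ι 𝕜 (0, x)) (TensorAlgebra.ι 𝕜 (S.odd x y, 0))

/-- The universal enveloping algebra of a Lie superalgebra. -/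
def Env (S : LieSuperalgebra 𝕜 L₀ L₁) : Type _ := RingQuot (EnvRel S)

noncomputable instance (S : LieSuperalgebra 𝕜 L₀ L₁) : Ring (Env S) :=
  inferInstanceAs (Ring (RingQuot (EnvRel S)))

noncomputable instance (S : LieSuperalgebra 𝕜 L₀ L₁) : Algebra 𝕜 (Env S) :=
  inferInstanceAs (Algebra 𝕜 (RingQuot (EnvRel S)))

/-- The canonical map of a Lie superalgebra to its universal enveloping algebra. -/
noncomputable def Env.ι (S : LieSuperalgebra 𝕜 L₀ L₁) : L₀ × L₁ →ₗ[𝕜] Env S :=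
  (RingQuot.mkAlgHom 𝕜 (EnvRel S)).toLinearMap ∘ₗ TensorAlgebra.ι 𝕜

end LieSuperalgebra

/-- Formal power series in five indeterminates over the complex numbers. -/
abbrev Ser : Type := MvPowerSeries (Fin 5) ℂ

lemma pderiv_comm (i j : Fin 5) (f : Ser) :
    pderiv ℂ i (pderiv ℂ j f) = pderiv ℂ j (pderiv ℂ i f) := by
  ext n
  simp only [MvPowerSeries.coeff_pderiv]
  by_cases h : i = j
  · subst h; rfl
  · rw [add_right_comm]
    simp [h, Ne.symm h]
    ring

lemma IsVF.comm {D : Derivation ℂ Ser Ser}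
    (hD : ∀ f, D f = ∑ j, D (MvPowerSeries.X j) * pderiv ℂ j f) (i : Fin 5) (f : Ser) :
    pderiv ℂ i (D f) =
      D (pderiv ℂ i f) + ∑ k, pderiv ℂ i (D (MvPowerSeries.X k)) * pderiv ℂ k f := by
  rw [hD f, hD (pderiv ℂ i f), map_sum, ← Finset.sum_add_distrib]
  refine Finset.sum_congr rfl fun k _ => ?_
  rw [Derivation.leibniz, smul_eq_mul, smul_eq_mul, pderiv_comm i k]
  ring

/-- The Lie algebra of divergence-free formal vector fields `D = ∑ Dⱼ ∂ⱼ`, `Dⱼ = D xⱼ`,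
with the commutator of derivations as bracket. -/
def S5 : LieSubalgebra ℂ (Derivation ℂ Ser Ser) where
  carrier := {D | (∀ f, D f = ∑ j, D (MvPowerSeries.X j) * pderiv ℂ j f) ∧
    ∑ j, pderiv ℂ j (D (MvPowerSeries.X j)) = 0}
  zero_mem' := by simp
  add_mem' := by
    rintro D E ⟨h1, h2⟩ ⟨h3, h4⟩
    refine ⟨fun f => ?_, ?_⟩
    · simp only [Derivation.add_apply, add_mul, Finset.sum_add_distrib]
      rw [h1 f, h3 f]
    · simp only [Derivation.add_apply, map_add, Finset.sum_add_distrib, h2, h4, add_zero]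
  smul_mem' := by
    rintro c D ⟨h1, h2⟩
    refine ⟨fun f => ?_, ?_⟩
    · simp only [Derivation.smul_apply, smul_mul_assoc, ← Finset.smul_sum]
      rw [h1 f]
    · simp only [Derivation.smul_apply, Derivation.map_smul, ← Finset.smul_sum, h2, smul_zero]
  lie_mem' := by
    rintro D E ⟨h1, h2⟩ ⟨h3, h4⟩
    refine ⟨fun f => ?_, ?_⟩
    · have e1 : D (E f) = ∑ k, (D (E (MvPowerSeries.X k)) * pderiv ℂ k f +
          E (MvPowerSeries.X k) * D (pderiv ℂ k f)) := by
        rw [h3 f, map_sum]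
        refine Finset.sum_congr rfl fun k _ => ?_
        rw [Derivation.leibniz, smul_eq_mul, smul_eq_mul]; ring
      have e2 : E (D f) = ∑ k, (E (D (MvPowerSeries.X k)) * pderiv ℂ k f +
          D (MvPowerSeries.X k) * E (pderiv ℂ k f)) := by
        rw [h1 f, map_sum]
        refine Finset.sum_congr rfl fun k _ => ?_
        rw [Derivation.leibniz, smul_eq_mul, smul_eq_mul]; ring
      have e3 : ∑ k, E (MvPowerSeries.X k) * D (pderiv ℂ k f) =
          ∑ k, D (MvPowerSeries.X k) * E (pderiv ℂ k f) := by
        simp_rw [fun k => h1 (pderiv ℂ k f), fun k => h3 (pderiv ℂ k f), Finset.mul_sum]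
        rw [Finset.sum_comm]
        refine Finset.sum_congr rfl fun k _ => Finset.sum_congr rfl fun l _ => ?_
        rw [pderiv_comm k l]; ring
      rw [Derivation.commutator_apply, e1, e2, Finset.sum_add_distrib, Finset.sum_add_distrib, e3]
      simp only [Derivation.commutator_apply, sub_mul, Finset.sum_sub_distrib]
      ring
    · simp only [Derivation.commutator_apply, map_sub]
      simp_rw [fun j => IsVF.comm h1 j (E (MvPowerSeries.X j)),
        fun j => IsVF.comm h3 j (D (MvPowerSeries.X j))]
      simp only [Finset.sum_sub_distrib, Finset.sum_add_distrib]
      rw [← map_sum, ← map_sum, h2, h4, map_zero, map_zero, zero_add, zero_add, Finset.sum_comm,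
        sub_eq_zero]
      exact Finset.sum_congr rfl fun k _ => Finset.sum_congr rfl fun l _ => mul_comm _ _

/-- The `j`-th component of a vector field. -/
noncomputable def vcomp (D : S5) (j : Fin 5) : Ser := D.1 (MvPowerSeries.X j)

lemma vf_apply (D : S5) (f : Ser) : D.1 f = ∑ j, vcomp D j * pderiv ℂ j f := D.2.1 f

lemma vf_div (D : S5) : ∑ j, pderiv ℂ j (vcomp D j) = 0 := D.2.2

lemma pderiv_vf (D : S5) (i : Fin 5) (f : Ser) :
    pderiv ℂ i (D.1 f) = D.1 (pderiv ℂ i f) + ∑ k, pderiv ℂ i (vcomp D k) * pderiv ℂ k f :=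
  IsVF.comm D.2.1 i f

lemma vcomp_lie (D E : S5) (j : Fin 5) :
    vcomp ⁅D, E⁆ j = D.1 (vcomp E j) - E.1 (vcomp D j) := by
  simp [vcomp, Derivation.commutator_apply]

lemma vf_lie_apply (D E : S5) (f : Ser) :
    (⁅D, E⁆ : S5).1 f = D.1 (E.1 f) - E.1 (D.1 f) := by
  simp [Derivation.commutator_apply]

lemma vf_ext {D E : S5} (h : ∀ j, vcomp D j = vcomp E j) : D = E := by
  apply Subtype.ext
  ext1 f
  rw [vf_apply D, vf_apply E]
  simp [h]

/-- Closed formal differential 2-forms `ω = ½ ∑ ω i j dxᵢ ∧ dxⱼ`, as skew-symmetric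
matrices of coefficients. -/
def Om2 : Submodule ℂ (Fin 5 → Fin 5 → Ser) where
  carrier := {w | (∀ i j, w i j = - w j i) ∧
    ∀ i j k, pderiv ℂ i (w j k) + pderiv ℂ j (w k i) + pderiv ℂ k (w i j) = 0}
  zero_mem' := by simp
  add_mem' := by
    rintro v w ⟨h1, h2⟩ ⟨h3, h4⟩
    refine ⟨fun i j => ?_, fun i j k => ?_⟩
    · simp only [Pi.add_apply]; linear_combination h1 i j + h3 i j
    · simp only [Pi.add_apply, map_add]; linear_combination h2 i j k + h4 i j k
  smul_mem' := by
    rintro c w ⟨h1, h2⟩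
    refine ⟨fun i j => ?_, fun i j k => ?_⟩
    · simp only [Pi.smul_apply]; rw [h1 i j, smul_neg]
    · simp only [Pi.smul_apply, Derivation.map_smul, ← smul_add, h2, smul_zero]

lemma Om2.diag (w : Om2) (i : Fin 5) : w.1 i i = 0 := by
  have h := w.2.1 i i
  have h2 : (2 : ℂ) • w.1 i i = 0 := by
    rw [two_smul]; linear_combination h
  exact (smul_eq_zero.mp h2).resolve_left two_ne_zero

/-- The Lie derivative of a 2-form along a vector field. -/
noncomputable def lieDer (D : S5) (w : Om2) : Om2 :=
  ⟨fun i j => D.1 (w.1 i j) +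
      ∑ k, (pderiv ℂ i (vcomp D k) * w.1 k j + pderiv ℂ j (vcomp D k) * w.1 i k), by
    refine ⟨fun i j => ?_, fun a i j => ?_⟩
    · beta_reduce
      rw [w.2.1 i j, map_neg, neg_add, ← Finset.sum_neg_distrib]
      congr 1
      refine Finset.sum_congr rfl fun k _ => ?_
      rw [w.2.1 k j, w.2.1 i k]; ring
    · have hD : D.1 (pderiv ℂ a (w.1 i j)) + D.1 (pderiv ℂ i (w.1 j a)) +
          D.1 (pderiv ℂ j (w.1 a i)) = 0 := by
        rw [← map_add, ← map_add, w.2.2 a i j, map_zero]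
      simp only [map_add, map_sum, pderiv_vf, Derivation.leibniz, smul_eq_mul]
      have key : ∀ k, pderiv ℂ a (vcomp D k) * pderiv ℂ k (w.1 i j) +
          pderiv ℂ i (vcomp D k) * pderiv ℂ k (w.1 j a) +
          pderiv ℂ j (vcomp D k) * pderiv ℂ k (w.1 a i) +
          (pderiv ℂ i (vcomp D k) * pderiv ℂ a (w.1 k j) +
            w.1 k j * pderiv ℂ a (pderiv ℂ i (vcomp D k)) +
            (pderiv ℂ j (vcomp D k) * pderiv ℂ a (w.1 i k) +
            w.1 i k * pderiv ℂ a (pderiv ℂ j (vcomp D k)))) +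
          (pderiv ℂ j (vcomp D k) * pderiv ℂ i (w.1 k a) +
            w.1 k a * pderiv ℂ i (pderiv ℂ j (vcomp D k)) +
            (pderiv ℂ a (vcomp D k) * pderiv ℂ i (w.1 j k) +
            w.1 j k * pderiv ℂ i (pderiv ℂ a (vcomp D k)))) +
          (pderiv ℂ a (vcomp D k) * pderiv ℂ j (w.1 k i) +
            w.1 k i * pderiv ℂ j (pderiv ℂ a (vcomp D k)) +
            (pderiv ℂ i (vcomp D k) * pderiv ℂ j (w.1 a k) +
            w.1 a k * pderiv ℂ j (pderiv ℂ i (vcomp D k)))) = 0 := by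
        intro k
        rw [pderiv_comm i a, pderiv_comm j a, pderiv_comm j i]
        linear_combination pderiv ℂ a (vcomp D k) * w.2.2 k i j +
          pderiv ℂ i (vcomp D k) * w.2.2 k j a + pderiv ℂ j (vcomp D k) * w.2.2 k a i
          + pderiv ℂ a (pderiv ℂ i (vcomp D k)) * w.2.1 k j
          + pderiv ℂ a (pderiv ℂ j (vcomp D k)) * w.2.1 k i
          + pderiv ℂ i (pderiv ℂ j (vcomp D k)) * w.2.1 k a
      have hs := Finset.sum_eq_zero (s := Finset.univ) fun k _ => key k
      simp only [Finset.sum_add_distrib] at hs ⊢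
      linear_combination hs + hD⟩

/-- Vector fields act on closed 2-forms by the Lie derivative. -/
noncomputable instance : LieRingModule S5 Om2 where
  bracket := lieDer
  add_lie D E w := by
    apply Subtype.ext; funext i j
    have h (f : Ser) : (D + E).1 f = D.1 f + E.1 f := rfl
    simp only [lieDer, vcomp, h, map_add, add_mul,
      Submodule.coe_add, Pi.add_apply, Finset.sum_add_distrib]
    ring
  lie_add D v w := by
    apply Subtype.ext; funext i j
    simp only [lieDer, map_add, mul_add,
      Submodule.coe_add, Pi.add_apply, Finset.sum_add_distrib]
    ring
  leibniz_lie D E w := by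
    apply Subtype.ext; funext i j
    simp only [lieDer, vcomp_lie, vf_lie_apply, Submodule.coe_add, Pi.add_apply, map_add,
      map_sub, pderiv_vf, Derivation.leibniz, smul_eq_mul, Fin.sum_univ_five]
    ring

lemma Om2.lie_apply (D : S5) (w : Om2) (i j : Fin 5) : (⁅D, w⁆ : Om2).1 i j = D.1 (w.1 i j) +
      ∑ k, (pderiv ℂ i (vcomp D k) * w.1 k j + pderiv ℂ j (vcomp D k) * w.1 i k) := rfl

noncomputable instance : LieModule ℂ S5 Om2 where
  smul_lie c D w := by
    apply Subtype.ext; funext i j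
    simp [Om2.lie_apply, vcomp, smul_add, Finset.smul_sum]
  lie_smul c D w := by
    apply Subtype.ext; funext i j
    simp [Om2.lie_apply, vcomp, smul_add, Finset.smul_sum]

lemma Om2.closed_skew (w : Om2) (i j k : Fin 5) :
    pderiv ℂ i (w.1 j k) - pderiv ℂ j (w.1 i k) + pderiv ℂ k (w.1 i j) = 0 := by
  have h := w.2.2 i j k
  rw [w.2.1 k i, map_neg] at h
  linear_combination h

/-- The vector field with given components. -/
noncomputable def vfOf (P : Fin 5 → Ser) : Derivation ℂ Ser Ser := ∑ i, P i • pderiv ℂ i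

lemma vfOf_apply (P : Fin 5 → Ser) (f : Ser) : vfOf P f = ∑ j, P j * pderiv ℂ j f := by
  simp [vfOf, Fin.sum_univ_five]

lemma vfOf_X (P : Fin 5 → Ser) (j : Fin 5) : vfOf P (MvPowerSeries.X j) = P j := by
  rw [vfOf_apply]
  simp [MvPowerSeries.pderiv_X, Pi.single_apply]

/-- Coefficients of the 4-form `v ∧ w`, read as components of a vector field: the `i`-th entry is
the coefficient of `dxᵢ₊₁ ∧ dxᵢ₊₂ ∧ dxᵢ₊₃ ∧ dxᵢ₊₄` (indices modulo 5), and this monomial is the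
contraction of `∂ᵢ` with `dx₀ ∧ dx₁ ∧ dx₂ ∧ dx₃ ∧ dx₄`, a cyclic shift of five letters being even. -/
noncomputable def wedgeComp (v w : Fin 5 → Fin 5 → Ser) (i : Fin 5) : Ser :=
  v (i + 1) (i + 2) * w (i + 3) (i + 4) - v (i + 1) (i + 3) * w (i + 2) (i + 4)
    + v (i + 1) (i + 4) * w (i + 2) (i + 3) + v (i + 2) (i + 3) * w (i + 1) (i + 4)
    - v (i + 2) (i + 4) * w (i + 1) (i + 3) + v (i + 3) (i + 4) * w (i + 1) (i + 2)

/-- The divergence-free vector field `D` with `ι_D (dx₀ ∧ ⋯ ∧ dx₄) = v ∧ w`. -/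
noncomputable def wedge (v w : Om2) : S5 :=
  ⟨vfOf (wedgeComp v.1 w.1), by
    refine ⟨fun f => by simp only [vfOf_X]; rw [vfOf_apply], ?_⟩
    have cv1 := Om2.closed_skew v
    have cw1 := Om2.closed_skew w
    simp only [vfOf_X]
    simp only [Fin.sum_univ_five, wedgeComp, Fin.reduceAdd, map_add, map_sub, Derivation.leibniz,
      smul_eq_mul]
    obtain ⟨v, hv, cv⟩ := v
    obtain ⟨w, hw, cw⟩ := w
    simp only at cv1 cw1 ⊢
    simp only [hv 2 0, hv 3 0, hv 4 0, hv 3 1, hv 4 1, hv 4 2,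
      hw 2 0, hw 3 0, hw 4 0, hw 3 1, hw 4 1, hw 4 2, map_neg]
    linear_combination w 3 4 * cv1 0 1 2 + v 3 4 * cw1 0 1 2
      - w 2 4 * cv1 0 1 3 - v 2 4 * cw1 0 1 3
      + w 2 3 * cv1 0 1 4 + v 2 3 * cw1 0 1 4
      + w 1 4 * cv1 0 2 3 + v 1 4 * cw1 0 2 3
      - w 1 3 * cv1 0 2 4 - v 1 3 * cw1 0 2 4
      + w 1 2 * cv1 0 3 4 + v 1 2 * cw1 0 3 4
      - w 0 4 * cv1 1 2 3 - v 0 4 * cw1 1 2 3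
      + w 0 3 * cv1 1 2 4 + v 0 3 * cw1 1 2 4
      - w 0 2 * cv1 1 3 4 - v 0 2 * cw1 1 3 4
      + w 0 1 * cv1 2 3 4 + v 0 1 * cw1 2 3 4⟩

lemma vcomp_wedge (v w : Om2) (i : Fin 5) : vcomp (wedge v w) i = wedgeComp v.1 w.1 i :=
  vfOf_X _ _

lemma vcomp_add (D E : S5) (i : Fin 5) : vcomp (D + E) i = vcomp D i + vcomp E i := rfl
lemma vcomp_smul (c : ℂ) (D : S5) (i : Fin 5) : vcomp (c • D) i = c • vcomp D i := rfl

/-- `wedge` as a bilinear map. -/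
noncomputable def wedgeL : Om2 →ₗ[ℂ] Om2 →ₗ[ℂ] S5 :=
  LinearMap.mk₂ ℂ wedge
    (fun a b c => vf_ext fun i => by
      simp only [vcomp_wedge, vcomp_add, wedgeComp, Submodule.coe_add, Pi.add_apply]; ring)
    (fun r a b => vf_ext fun i => by
      simp only [vcomp_wedge, vcomp_smul, wedgeComp, Submodule.coe_smul, Pi.smul_apply,
        MvPowerSeries.smul_eq_C_mul]; ring)
    (fun a b c => vf_ext fun i => by
      simp only [vcomp_wedge, vcomp_add, wedgeComp, Submodule.coe_add, Pi.add_apply]; ring)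
    (fun r a b => vf_ext fun i => by
      simp only [vcomp_wedge, vcomp_smul, wedgeComp, Submodule.coe_smul, Pi.smul_apply,
        MvPowerSeries.smul_eq_C_mul]; ring)

lemma wedge_symm (v w : Om2) : wedge v w = wedge w v :=
  vf_ext fun i => by simp only [vcomp_wedge, wedgeComp]; ring

lemma lie_wedge (D : S5) (v w : Om2) : ⁅D, wedge v w⁆ = wedge ⁅D, v⁆ w + wedge v ⁅D, w⁆ :=
  vf_ext fun i => by
    have hd := congrArg (wedgeComp v.1 w.1 i * ·) (vf_div D)
    rw [vcomp_lie, vcomp_add, vf_apply (wedge v w)]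
    simp only [vcomp_wedge, wedgeComp, Om2.lie_apply, Fin.sum_univ_five, Fin.reduceAdd, map_add, map_sub,
      Derivation.leibniz, smul_eq_mul, mul_zero] at hd ⊢
    obtain ⟨v, hv, cv⟩ := v
    obtain ⟨w, hw, cw⟩ := w
    have hv0 := Om2.diag ⟨v, hv, cv⟩
    have hw0 := Om2.diag ⟨w, hw, cw⟩
    simp only at hv0 hw0 hd ⊢
    fin_cases i <;>
    · simp only [Fin.reduceFinMk, Fin.isValue, Fin.mk_one, Fin.zero_eta, Fin.reduceAdd, zero_add,
        hv0, hw0, hv 1 0, hv 2 1, hv 3 2, hv 4 3, hv 2 0, hv 3 0, hv 4 0, hv 3 1, hv 4 1, hv 4 2,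
        hw 1 0, hw 2 1, hw 3 2, hw 4 3, hw 2 0, hw 3 0, hw 4 0, hw 3 1, hw 4 1, hw 4 2, map_neg] at hd ⊢
      linear_combination -hd

lemma lieDer_eq (D : S5) (w : Om2) (i j : Fin 5) : (⁅D, w⁆ : Om2).1 i j =
    pderiv ℂ i (∑ k, vcomp D k * w.1 k j) - pderiv ℂ j (∑ k, vcomp D k * w.1 k i) := by
  rw [Om2.lie_apply, vf_apply, map_sum, map_sum, ← Finset.sum_add_distrib,
    ← Finset.sum_sub_distrib]
  refine Finset.sum_congr rfl fun k _ => ?_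
  simp only [Derivation.leibniz, smul_eq_mul]
  have h := w.2.2 k i j
  rw [w.2.1 j k, map_neg] at h
  rw [w.2.1 k i, map_neg] at *
  linear_combination vcomp D k * h

lemma wedge_contract (u v w : Om2) (j : Fin 5) :
    ∑ k, vcomp (wedge u v) k * w.1 k j + ∑ k, vcomp (wedge v w) k * u.1 k j +
      ∑ k, vcomp (wedge w u) k * v.1 k j = 0 := by
  simp only [vcomp_wedge, wedgeComp, Fin.sum_univ_five, Fin.reduceAdd]
  have hu0 := Om2.diag u
  have hv0 := Om2.diag v
  have hw0 := Om2.diag w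
  obtain ⟨u, hu, cu⟩ := u
  obtain ⟨v, hv, cv⟩ := v
  obtain ⟨w, hw, cw⟩ := w
  simp only at hu0 hv0 hw0 ⊢
  fin_cases j <;>
  · simp only [Fin.reduceFinMk, Fin.isValue, Fin.mk_one, Fin.zero_eta,
        hu0, hv0, hw0, hv 1 0, hv 2 1, hv 3 2, hv 4 3, hv 2 0, hv 3 0, hv 4 0, hv 3 1, hv 4 1, hv 4 2,
        hw 1 0, hw 2 1, hw 3 2, hw 4 3, hw 2 0, hw 3 0, hw 4 0, hw 3 1, hw 4 1, hw 4 2,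
        hu 1 0, hu 2 1, hu 3 2, hu 4 3, hu 2 0, hu 3 0, hu 4 0, hu 3 1, hu 4 1, hu 4 2]
    ring

lemma wedge_jacobi (u v w : Om2) :
    ⁅wedge u v, w⁆ + ⁅wedge v w, u⁆ + ⁅wedge w u, v⁆ = 0 := by
  apply Subtype.ext; funext i j
  simp only [Submodule.coe_add, Pi.add_apply, lieDer_eq, Submodule.coe_zero, Pi.zero_apply]
  have h1 := congrArg (pderiv ℂ i) (wedge_contract u v w j)
  have h2 := congrArg (pderiv ℂ j) (wedge_contract u v w i)
  rw [map_add, map_add, map_zero] at h1 h2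
  linear_combination h1 - h2

/-- The Lie superalgebra `E(5,10)`. -/
noncomputable def E : LieSuperalgebra ℂ S5 Om2 where
  odd := wedgeL
  symm := wedge_symm
  lie_odd := lie_wedge
  jacobi := wedge_jacobi

/-- The universal enveloping algebra of `E(5,10)`. -/
abbrev U : Type := Env E

/-- The odd element `d_{ij} = dxᵢ ∧ dxⱼ`. -/
noncomputable def dd (i j : Fin 5) : Om2 :=
  ⟨fun k l => MvPowerSeries.C
      ((if k = i ∧ l = j then 1 else 0) - (if k = j ∧ l = i then 1 else 0) : ℂ), by
    refine ⟨fun k l => ?_, fun k l m => by simp only [MvPowerSeries.pderiv_C, add_zero]⟩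
    simp [and_comm]⟩

/-! ### Grading and induced modules

The grading is `deg xᵢ = 2 = - deg ∂ᵢ`, `deg d_{ij} = -1`. So an even (odd) element has only
components of degree `≥ 0` if and only if its coefficients have no constant term; all odd
elements of this kind have degree `≥ 1`. The degree zero part consists of the fields
`∑ aᵢⱼ xᵢ ∂ⱼ` with `∑ aᵢᵢ = 0`. -/

/-- The Lie algebra `sl₅(ℂ)`, identified with the degree zero part by `E_{ij} ↦ xᵢ ∂ⱼ`. -/
abbrev sl5 : Type := LieAlgebra.SpecialLinear.sl (Fin 5) ℂ

/-- Even elements with components of degree `≥ 0` only. -/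
def NonnegEven (D : S5) : Prop := ∀ j, MvPowerSeries.constantCoeff (vcomp D j) = 0

/-- Odd elements with components of degree `≥ 0` (equivalently `≥ 1`) only. -/
def NonnegOdd (w : Om2) : Prop := ∀ i j, MvPowerSeries.constantCoeff (w.1 i j) = 0

/-- The degree zero component `∑ aᵢⱼ xᵢ ∂ⱼ` of a vector field, as the matrix `(aᵢⱼ)`. -/
noncomputable def degZero (D : S5) : sl5 :=
  ⟨Matrix.of fun i j => MvPowerSeries.coeff (Finsupp.single i 1) (vcomp D j), by
    have h := congrArg MvPowerSeries.constantCoeff (vf_div D)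
    rw [map_sum, map_zero] at h
    change Matrix.trace (Matrix.of fun i j =>
      MvPowerSeries.coeff (Finsupp.single i 1) (vcomp D j)) = 0
    rw [Matrix.trace, ← h]
    refine Finset.sum_congr rfl fun i _ => ?_
    rw [← MvPowerSeries.coeff_zero_eq_constantCoeff_apply, MvPowerSeries.coeff_pderiv]
    simp⟩

section Verma

variable (V : Type*) [AddCommGroup V] [Module ℂ V] [LieRingModule sl5 V] [LieModule ℂ sl5 V]

open TensorProduct

/-- The relations `u x ⊗ v = u ⊗ x v` (`x` in the part of degree `≥ 0`), where the part of degree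
zero acts on `V` through `sl₅` and the part of positive degree acts by zero. -/
noncomputable def indRel : Submodule U (U ⊗[ℂ] V) :=
  Submodule.span U
    ({t | ∃ (D : S5) (v : V), NonnegEven D ∧
        t = Env.ι E (D, 0) ⊗ₜ[ℂ] v - (1 : U) ⊗ₜ[ℂ] ⁅degZero D, v⁆} ∪
      {t | ∃ (w : Om2) (v : V), NonnegOdd w ∧ t = Env.ι E (0, w) ⊗ₜ[ℂ] v})

/-- The induced module `M(V) = U(L) ⊗_{U(L_{≥ 0})} V` over `L = E(5,10)`. -/
abbrev M : Type _ := (U ⊗[ℂ] V) ⧸ indRel V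

variable {V}

/-- The element `u ⊗ v` of `M(V)`. -/
noncomputable def M.tmul (u : U) (v : V) : M V := (indRel V).mkQ (u ⊗ₜ[ℂ] v)

/-- For an `sl₅`-submodule `W` of `V`, the submodule `M(W)` of `M(V)`. -/
noncomputable def M.sub (W : LieSubmodule ℂ sl5 V) : Submodule U (M V) :=
  Submodule.span U {t | ∃ v ∈ W, t = M.tmul 1 v}

/-- `φ` is the map defined by `∑ d_{ij} ⊗ θ_{ij}`, that is
`φ (u ⊗ v) = ∑ u d_{ij} ⊗ θ_{ij} v`. -/
def IsNabla (θ : Fin 5 → Fin 5 → V →ₗ[ℂ] V) (φ : M V →ₗ[U] M V) : Prop :=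
  ∀ (u : U) (v : V),
    φ (M.tmul u v) = ∑ i, ∑ j, M.tmul (u * Env.ι E (0, dd i j)) (θ i j v)

end Verma

/-! ### The polynomial algebras -/

section PolyAction

variable {σ : Type} (f : Matrix (Fin 5) (Fin 5) ℂ →ₗ[ℂ] (σ → MvPolynomial σ ℂ))

/-- A linear action of `gl₅` on the span of the variables: the hypothesis for `polyLieRingModule`. -/
def IsLinAction : Prop := ∀ A B i, MvPolynomial.mkDerivation ℂ (f A) (f B i) -
  MvPolynomial.mkDerivation ℂ (f B) (f A i) = f ⁅A, B⁆ i

variable {f}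

lemma IsLinAction.lie (h : IsLinAction f) (A B : Matrix (Fin 5) (Fin 5) ℂ) :
    MvPolynomial.mkDerivation ℂ (f ⁅A, B⁆) =
      ⁅MvPolynomial.mkDerivation ℂ (f A), MvPolynomial.mkDerivation ℂ (f B)⁆ := by
  refine MvPolynomial.derivation_ext fun i => ?_
  rw [Derivation.commutator_apply]
  simp only [MvPolynomial.mkDerivation_X]
  exact (h A B i).symm

/-- The action of `sl₅` on polynomials by derivations that extends a given action on variables. -/
@[reducible] noncomputable def polyLieRingModule (h : IsLinAction f) :
    LieRingModule sl5 (MvPolynomial σ ℂ) where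
  bracket A p := MvPolynomial.mkDerivation ℂ (f A.1) p
  add_lie A B p := by
    change MvPolynomial.mkDerivation ℂ (f (A.1 + B.1)) p = _
    rw [map_add]
    exact DFunLike.congr_fun (MvPolynomial.derivation_ext
      (D₁ := MvPolynomial.mkDerivation ℂ (f A.1 + f B.1))
      (D₂ := MvPolynomial.mkDerivation ℂ (f A.1) + MvPolynomial.mkDerivation ℂ (f B.1))
      fun i => by simp [MvPolynomial.mkDerivation_X]) p
  lie_add A p q := map_add _ p q
  leibniz_lie A B p := by
    change _ = MvPolynomial.mkDerivation ℂ (f ⁅A.1, B.1⁆) p + _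
    rw [h.lie, Derivation.commutator_apply]
    abel

lemma polyLieModule (h : IsLinAction f) :
    letI := polyLieRingModule h
    LieModule ℂ sl5 (MvPolynomial σ ℂ) :=
  letI := polyLieRingModule h
  { smul_lie := fun c A p => by
      change MvPolynomial.mkDerivation ℂ (f (c • A.1)) p = _
      rw [map_smul]
      exact DFunLike.congr_fun (MvPolynomial.derivation_ext
        (D₁ := MvPolynomial.mkDerivation ℂ (c • f A.1))
        (D₂ := c • MvPolynomial.mkDerivation ℂ (f A.1))
        fun i => by simp [MvPolynomial.mkDerivation_X]) p
    lie_smul := fun c A p => Derivation.map_smul _ c p }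

end PolyAction

/-! ### The three cases -/

/-- Pairs `i < j`, indexing the basis of the exterior square. -/
abbrev Pair : Type := {p : Fin 5 × Fin 5 // p.1 < p.2}

/-- A skew-symmetric family from its values at pairs `i < j`. -/
def skew {T : Type*} [AddGroup T] (g : Pair → T) (i j : Fin 5) : T :=
  if h : i < j then g ⟨(i, j), h⟩ else if h : j < i then - g ⟨(j, i), h⟩ else 0

lemma skew_swap {T : Type*} [AddCommGroup T] (g : Pair → T) (i j : Fin 5) :
    skew g i j = - skew g j i := by
  rcases lt_trichotomy i j with h | h | h
  · simp [skew, h, h.not_gt]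
  · simp [skew, h]
  · simp [skew, h, h.not_gt]

lemma map_skew {T T' : Type*} [AddCommGroup T] [AddCommGroup T'] (φ : T →+ T') (g : Pair → T)
    (i j : Fin 5) : φ (skew g i j) = skew (fun p => φ (g p)) i j := by
  unfold skew; split_ifs <;> simp

/-- A formula `F i j` that is skew-symmetric agrees with `skew` of its values at pairs `i < j`. -/
lemma skew_eq {T : Type*} [AddCommGroup T] [IsAddTorsionFree T] (F : Fin 5 → Fin 5 → T)
    (hF : ∀ i j, F i j = - F j i) (i j : Fin 5) :
    skew (fun p => F p.1.1 p.1.2) i j = F i j := by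
  rcases lt_trichotomy i j with h | h | h
  · simp [skew, h]
  · subst h; simp only [skew, lt_irrefl, dite_false]; exact (self_eq_neg.mp (hF i i)).symm
  · simp [skew, h, h.not_gt, ← hF]

open MvPolynomial (mkDerivation)

/-- The indeterminates `xᵢ` and `x_{ij}` (`i < j`) of `S_A`. -/
inductive VarA : Type
  | x (i : Fin 5)
  | xx (p : Pair)

/-- The indeterminates `x*ᵢ` and `x*_{ij}` (`i < j`) of `S_B`. -/
inductive VarB : Type
  | xs (i : Fin 5)
  | xxs (p : Pair)

/-- The indeterminates `xᵢ` and `x*ᵢ` of `S_C`. -/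
inductive VarC : Type
  | x (i : Fin 5)
  | xs (i : Fin 5)

/-- `S_A = S(ℂ⁵ ⊕ Λ²ℂ⁵)`. -/
abbrev SA : Type := MvPolynomial VarA ℂ

/-- `S_B = S(ℂ⁵* ⊕ Λ²ℂ⁵*)`. -/
abbrev SB : Type := MvPolynomial VarB ℂ

/-- `S_C = S(ℂ⁵ ⊕ ℂ⁵*)`. -/
abbrev SC : Type := MvPolynomial VarC ℂ

/-- `x_{ij} = - x_{ji}` in `S_A`. -/
noncomputable def xA (i j : Fin 5) : SA := skew (fun p => MvPolynomial.X (VarA.xx p)) i j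

/-- `x*_{ij} = - x*_{ji}` in `S_B`. -/
noncomputable def xB (i j : Fin 5) : SB := skew (fun p => MvPolynomial.X (VarB.xxs p)) i j

/-- The action `xₐ∂_b : x_k ↦ δ_{bk} xₐ` on `ℂ⁵` and the induced one on `Λ²ℂ⁵`. -/
noncomputable def actA : Matrix (Fin 5) (Fin 5) ℂ →ₗ[ℂ] (VarA → SA) where
  toFun A
    | .x k => ∑ a, A a k • MvPolynomial.X (VarA.x a)
    | .xx p => ∑ a, (A a p.1.1 • xA a p.1.2 + A a p.1.2 • xA p.1.1 a)
  map_add' A B := by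
    funext v
    cases v <;> simp only [Pi.add_apply, Matrix.add_apply, add_smul, Finset.sum_add_distrib]
    abel
  map_smul' c A := by
    funext v
    cases v <;> simp [mul_smul, Finset.smul_sum]

/-- The dual action `xₐ∂_b : x*_k ↦ - δ_{ak} x*_b` on `ℂ⁵*` and the induced one on `Λ²ℂ⁵*`. -/
noncomputable def actB : Matrix (Fin 5) (Fin 5) ℂ →ₗ[ℂ] (VarB → SB) where
  toFun A
    | .xs k => - ∑ b, A k b • MvPolynomial.X (VarB.xs b)
    | .xxs p => - ∑ b, (A p.1.1 b • xB b p.1.2 + A p.1.2 b • xB p.1.1 b)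
  map_add' A B := by
    funext v
    cases v <;> simp only [Pi.add_apply, Matrix.add_apply, add_smul, Finset.sum_add_distrib] <;>
    abel
  map_smul' c A := by
    funext v
    cases v <;> simp [mul_smul, Finset.smul_sum]

/-- The standard action on `ℂ⁵` and the dual action on `ℂ⁵*`. -/
noncomputable def actC : Matrix (Fin 5) (Fin 5) ℂ →ₗ[ℂ] (VarC → SC) where
  toFun A
    | .x k => ∑ a, A a k • MvPolynomial.X (VarC.x a)
    | .xs k => - ∑ b, A k b • MvPolynomial.X (VarC.xs b)
  map_add' A B := by
    funext v
    cases v <;> simp only [Pi.add_apply, Matrix.add_apply, add_smul, Finset.sum_add_distrib]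
    abel
  map_smul' c A := by
    funext v
    cases v <;> simp [mul_smul, Finset.smul_sum]

lemma mkDerivation_actA_xA (A : Matrix (Fin 5) (Fin 5) ℂ) (k l : Fin 5) :
    mkDerivation ℂ (actA A) (xA k l) = ∑ a, (A a k • xA a l + A a l • xA k a) := by
  have h := map_skew ((mkDerivation ℂ (actA A)).toLinearMap.toAddMonoidHom)
    (fun p => MvPolynomial.X (VarA.xx p)) k l
  refine h.trans ?_
  refine Eq.trans ?_ (skew_eq (fun k l => ∑ a, (A a k • xA a l + A a l • xA k a)) ?_ k l)
  · congr 1; funext p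
    exact MvPolynomial.mkDerivation_X _ _ _
  · intro i j
    rw [← Finset.sum_neg_distrib]
    refine Finset.sum_congr rfl fun a _ => ?_
    rw [xA, skew_swap, ← xA, xA, xA, skew_swap _ i a, ← xA, smul_neg, smul_neg]; simp only [xA]; abel

lemma mkDerivation_actB_xB (A : Matrix (Fin 5) (Fin 5) ℂ) (k l : Fin 5) :
    mkDerivation ℂ (actB A) (xB k l) = - ∑ b, (A k b • xB b l + A l b • xB k b) := by
  have h := map_skew ((mkDerivation ℂ (actB A)).toLinearMap.toAddMonoidHom)
    (fun p => MvPolynomial.X (VarB.xxs p)) k l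
  refine h.trans ?_
  refine Eq.trans ?_ (skew_eq (fun k l => - ∑ b, (A k b • xB b l + A l b • xB k b)) ?_ k l)
  · congr 1; funext p
    exact MvPolynomial.mkDerivation_X _ _ _
  · intro i j
    rw [← Finset.sum_neg_distrib, ← Finset.sum_neg_distrib, ← Finset.sum_neg_distrib]
    refine Finset.sum_congr rfl fun a _ => ?_
    rw [xB, skew_swap, ← xB, xB, xB, skew_swap _ i a, ← xB, smul_neg, smul_neg]; simp only [xB]; abel

lemma isLinActionA : IsLinAction actA := by
  intro A B v
  cases v with
  | x k =>
    have h (A : Matrix (Fin 5) (Fin 5) ℂ) (k : Fin 5) :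
      actA A (.x k) = ∑ a, A a k • MvPolynomial.X (VarA.x a) := rfl
    simp only [h, map_add,  Derivation.map_smul,
      MvPolynomial.mkDerivation_X, Ring.lie_def, Matrix.sub_apply, Matrix.mul_apply,
      Fin.sum_univ_five]
    module
  | xx p =>
    have h (A : Matrix (Fin 5) (Fin 5) ℂ) :
      actA A (.xx p) = ∑ a, (A a p.1.1 • xA a p.1.2 + A a p.1.2 • xA p.1.1 a) := rfl
    simp only [h, map_add, Derivation.map_smul,
      mkDerivation_actA_xA, Ring.lie_def, Matrix.sub_apply, Matrix.mul_apply,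
      Fin.sum_univ_five]
    module

lemma isLinActionB : IsLinAction actB := by
  intro A B v
  cases v with
  | xs k =>
    have h (A : Matrix (Fin 5) (Fin 5) ℂ) (k : Fin 5) :
      actB A (.xs k) = - ∑ b, A k b • MvPolynomial.X (VarB.xs b) := rfl
    simp only [h, map_add,  map_neg, Derivation.map_smul,
      MvPolynomial.mkDerivation_X, Ring.lie_def, Matrix.sub_apply, Matrix.mul_apply,
      Fin.sum_univ_five]
    module
  | xxs p =>
    have h (A : Matrix (Fin 5) (Fin 5) ℂ) :
      actB A (.xxs p) = - ∑ b, (A p.1.1 b • xB b p.1.2 + A p.1.2 b • xB p.1.1 b) := rfl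
    simp only [h, map_add, map_neg, Derivation.map_smul,
      mkDerivation_actB_xB, Ring.lie_def, Matrix.sub_apply, Matrix.mul_apply,
      Fin.sum_univ_five]
    module

lemma isLinActionC : IsLinAction actC := by
  intro A B v
  have h (A : Matrix (Fin 5) (Fin 5) ℂ) (k : Fin 5) :
    actC A (.x k) = ∑ a, A a k • MvPolynomial.X (VarC.x a) := rfl
  have h1 (A : Matrix (Fin 5) (Fin 5) ℂ) (k : Fin 5) :
    actC A (.xs k) = - ∑ b, A k b • MvPolynomial.X (VarC.xs b) := rfl
  cases v <;>
  · simp only [h, h1, map_add, map_neg, Derivation.map_smul,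
      MvPolynomial.mkDerivation_X, Ring.lie_def, Matrix.sub_apply, Matrix.mul_apply,
      Fin.sum_univ_five]
    module

noncomputable instance : LieRingModule sl5 SA := polyLieRingModule isLinActionA
noncomputable instance : LieRingModule sl5 SB := polyLieRingModule isLinActionB
noncomputable instance : LieRingModule sl5 SC := polyLieRingModule isLinActionC
instance : LieModule ℂ sl5 SA := polyLieModule isLinActionA
instance : LieModule ℂ sl5 SB := polyLieModule isLinActionB
instance : LieModule ℂ sl5 SC := polyLieModule isLinActionC

/-- The bidegree on `S_A`: degree in the `xᵢ` and degree in the `x_{ij}`. -/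
def wtA : VarA → ℕ × ℕ
  | .x _ => (1, 0)
  | .xx _ => (0, 1)

/-- The bidegree on `S_B`: degree in the `x*_{ij}` and degree in the `x*ᵢ`. -/
def wtB : VarB → ℕ × ℕ
  | .xs _ => (0, 1)
  | .xxs _ => (1, 0)

/-- The bidegree on `S_C`: degree in the `xᵢ` and degree in the `x*ᵢ`. -/
def wtC : VarC → ℕ × ℕ
  | .x _ => (1, 0)
  | .xs _ => (0, 1)

/-- The highest component `F(m,n,0,0)` of the polynomials of bidegree `(m, n)` in `S_A`: the
`sl₅`-module generated by the product of the highest weight vectors (for the Borel subalgebra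
`⟨xᵢ∂ⱼ, i ≤ j⟩`) `x₀` of `ℂ⁵` and `x₀₁` of `Λ²ℂ⁵` to the powers `m` and `n`. -/
noncomputable def highA (m n : ℕ) : LieSubmodule ℂ sl5 SA :=
  LieSubmodule.lieSpan ℂ sl5 {MvPolynomial.X (VarA.x 0) ^ m * xA 0 1 ^ n}

/-- The highest component `F(0,0,m,n)` of bidegree `(m, n)` in `S_B`; the highest weight vectors
of `Λ²ℂ⁵*` and `ℂ⁵*` are `x*₃₄` and `x*₄`. -/
noncomputable def highB (m n : ℕ) : LieSubmodule ℂ sl5 SB :=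
  LieSubmodule.lieSpan ℂ sl5 {xB 3 4 ^ m * MvPolynomial.X (VarB.xs 4) ^ n}

/-- The highest component `F(m,0,0,n)` of bidegree `(m, n)` in `S_C`. -/
noncomputable def highC (m n : ℕ) : LieSubmodule ℂ sl5 SC :=
  LieSubmodule.lieSpan ℂ sl5 {MvPolynomial.X (VarC.x 0) ^ m * MvPolynomial.X (VarC.xs 4) ^ n}

/-- The invariant complement of the highest component in bidegree `(m, n)`. Since the polynomials
of bidegree `(m, n)` are completely reducible and contain the highest component with multiplicity
one, it is the largest submodule that meets the highest component trivially. -/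
noncomputable def lowB (m n : ℕ) : LieSubmodule ℂ sl5 SB :=
  sSup {N | (N : Submodule ℂ SB) ≤ MvPolynomial.weightedHomogeneousSubmodule ℂ wtB (m, n) ∧
    Disjoint N (highB m n)}

/-- The invariant complement of the highest component in bidegree `(m, n)`, as for `lowB`. -/
noncomputable def lowC (m n : ℕ) : LieSubmodule ℂ sl5 SC :=
  sSup {N | (N : Submodule ℂ SC) ≤ MvPolynomial.weightedHomogeneousSubmodule ℂ wtC (m, n) ∧
    Disjoint N (highC m n)}

/-- `S_{A,high}`. -/
noncomputable def SAhigh : LieSubmodule ℂ sl5 SA := ⨆ (m : ℕ) (n : ℕ), highA m n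

/-- `S_{B,low}`. -/
noncomputable def SBlow : LieSubmodule ℂ sl5 SB := ⨆ (m : ℕ) (n : ℕ), lowB m n

/-- `S_{C,low}`. -/
noncomputable def SClow : LieSubmodule ℂ sl5 SC := ⨆ (m : ℕ) (n : ℕ), lowC m n

/-- `V_A = S_{A,high}`. -/
abbrev VA : Type := SAhigh

/-- `V_B = S_B / S_{B,low}`. -/
abbrev VB : Type := SB ⧸ SBlow

/-- `V_C = S_C / S_{C,low}`. -/
abbrev VC : Type := SC ⧸ SClow

/-- The component `F(m,n,0,0)` of `V_A`. -/
noncomputable def VAc (m n : ℕ) : LieSubmodule ℂ sl5 VA := (highA m n).comap SAhigh.incl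

/-- The component `F(0,0,m,n)` of `V_B`. -/
noncomputable def VBc (m n : ℕ) : LieSubmodule ℂ sl5 VB :=
  (highB m n).map (LieSubmodule.Quotient.mk' SBlow)

/-- The component `F(m,0,0,n)` of `V_C`. -/
noncomputable def VCc (m n : ℕ) : LieSubmodule ℂ sl5 VC :=
  (highC m n).map (LieSubmodule.Quotient.mk' SClow)

/-- `θ^A_{ij} = d/dx_{ij}`, where `d/dx_{ji} = - d/dx_{ij}`. -/
noncomputable def thetaA (i j : Fin 5) : SA →ₗ[ℂ] SA :=
  skew (fun p => (MvPolynomial.pderiv (R := ℂ) (VarA.xx p)).toLinearMap) i j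

/-- `θ^B_{ij}`, the multiplication by `x*_{ij}`. -/
noncomputable def thetaB (i j : Fin 5) : SB →ₗ[ℂ] SB := LinearMap.mulLeft ℂ (xB i j)

/-- `θ^C_{ij} = x*ᵢ d/dxⱼ - x*ⱼ d/dxᵢ`. -/
noncomputable def thetaC (i j : Fin 5) : SC →ₗ[ℂ] SC :=
  LinearMap.mulLeft ℂ (MvPolynomial.X (VarC.xs i)) ∘ₗ
      (MvPolynomial.pderiv (R := ℂ) (VarC.x j)).toLinearMap -
    LinearMap.mulLeft ℂ (MvPolynomial.X (VarC.xs j)) ∘ₗ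
      (MvPolynomial.pderiv (R := ℂ) (VarC.x i)).toLinearMap

end E510

open E510

/-! A morphism out of `M V` is determined by its restriction to 1 ⊗ V, so `∇` exists as soon as v ↦
∑ d_{ij} ⊗ θ_{ij} v respects the relations coming from L_{≥0}. For fields of degree ≥ 0 it is enough
that the θ_{ij} transform dually to the d_{ij}. An odd form w vanishing at the origin satisfies w
d_{ij} ⊗ θ_{ij} v = 1 ⊗ (w ∧ d_{ij})₀ θ_{ij} v, where (·)₀ is the degree zero part, so the sum of
these terms must vanish. By `sum_degZero_wedge` only the cyclic sums over i, j, l of (x_k∂_l) θ_{ij}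
enter. These need not be zero: trace terms δ_{ki} h_{jl} + δ_{kj} h_{li} + δ_{kl} h_{ij} are
allowed, because they cancel when w is closed.

If the θ_{ij} commute, then ∇² is half of ∑ [d_{ij}, d_{kl}] ⊗ θ_{kl} θ_{ij}. The bracket d_{ij} ∧
d_{kl} is alternating in the four indices, so the Plücker relations between the θ_{ij} give ∇² = 0.
These requirements make up `IsNablaFamily`.

They hold for different reasons in the three cases. On S_{A,high} the vectors satisfying the Plücker
relations, or the incidence relations between d/dx_i and d/dx_{jk}, form an sl₅-submodule. It is
therefore enough to test x_0^m x_{01}^n, where the relations say that e_0 ∧ e_1 is decomposable and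
contains e_0. In case B the same relations hold modulo S_{B,low}. To see this, use the Fischer inner
product, for which x and d/dx are adjoint and the action is contravariant: S_{B,low} is the
orthogonal complement of the sum of the highest components (`iSup_low_eq_orthogonal`), so an
operator has image in S_{B,low} once its adjoint kills the highest components, and this is the
computation of case A again. In case C the relations are identities on all of S_C, with nonzero
trace terms, and the inner product serves to show that the θ_{ij} preserve S_{C,low} and that
highest monomials lie outside it.

For (c), `nabla_sub_eq_zero_iff` says that ∇ vanishes on M(W) exactly when all θ_{ij} vanish on W.
This rests on the independence of the d_{ij} over V in `M V`, which is proved on a model: with N the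
span of constant fields and constant forms, L acts on U(N) ⊗ V by a recursive formula, and U(N) maps
onto the exterior algebra of N₁, where the d_{ij} remain independent. Finally, a suitable θ_{ij}
sends a highest vector to a multiple of the highest vector of a neighbouring bidegree, with factor
n, 1, m in the cases A, B, C. -/

namespace E510

open TensorProduct

/-! ### Induced modules over a Lie superalgebra with a complemented subalgebra

Let `L = N ⊕ P`, where `N` is a two-step nilpotent Lie superalgebra with abelian central even part
and `P` is a subalgebra. Any `P`-module `V` extends to an action of `L` on `U(N) ⊗ V`. -/

section Induced

variable {𝕜 N₀ N₁ : Type*} [Field 𝕜] [AddCommGroup N₀] [Module 𝕜 N₀] [AddCommGroup N₁]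
  [Module 𝕜 N₁]

/-- The defining relations of the enveloping algebra of the Lie superalgebra `N₀ ⊕ N₁` in which
`N₀` is central and the bracket of odd elements is `β`. -/
inductive NilRel (β : N₁ →ₗ[𝕜] N₁ →ₗ[𝕜] N₀) :
    TensorAlgebra 𝕜 (N₀ × N₁) → TensorAlgebra 𝕜 (N₀ × N₁) → Prop
  | even_even (a b : N₀) : NilRel β
      (TensorAlgebra.ι 𝕜 (a, 0) * TensorAlgebra.ι 𝕜 (b, 0))
      (TensorAlgebra.ι 𝕜 (b, 0) * TensorAlgebra.ι 𝕜 (a, 0))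
  | even_odd (a : N₀) (x : N₁) : NilRel β
      (TensorAlgebra.ι 𝕜 (a, 0) * TensorAlgebra.ι 𝕜 (0, x))
      (TensorAlgebra.ι 𝕜 (0, x) * TensorAlgebra.ι 𝕜 (a, 0))
  | odd_odd (x y : N₁) : NilRel β
      (TensorAlgebra.ι 𝕜 (0, x) * TensorAlgebra.ι 𝕜 (0, y)
        + TensorAlgebra.ι 𝕜 (0, y) * TensorAlgebra.ι 𝕜 (0, x)) (TensorAlgebra.ι 𝕜 (β x y, 0))

/-- The enveloping algebra of the nilpotent Lie superalgebra `N₀ ⊕ N₁`. -/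
def NilEnv (β : N₁ →ₗ[𝕜] N₁ →ₗ[𝕜] N₀) : Type _ := RingQuot (NilRel β)

variable (β : N₁ →ₗ[𝕜] N₁ →ₗ[𝕜] N₀)

noncomputable instance : Ring (NilEnv β) := inferInstanceAs (Ring (RingQuot (NilRel β)))

noncomputable instance : Algebra 𝕜 (NilEnv β) :=
  inferInstanceAs (Algebra 𝕜 (RingQuot (NilRel β)))

/-- The projection from the tensor algebra. -/
noncomputable def NilEnv.mk : TensorAlgebra 𝕜 (N₀ × N₁) →ₐ[𝕜] NilEnv β :=
  RingQuot.mkAlgHom 𝕜 (NilRel β)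

/-- The even generators. -/
noncomputable def NilEnv.even : N₀ →ₗ[𝕜] NilEnv β :=
  (NilEnv.mk β).toLinearMap ∘ₗ TensorAlgebra.ι 𝕜 ∘ₗ LinearMap.inl 𝕜 N₀ N₁

/-- The odd generators. -/
noncomputable def NilEnv.odd : N₁ →ₗ[𝕜] NilEnv β :=
  (NilEnv.mk β).toLinearMap ∘ₗ TensorAlgebra.ι 𝕜 ∘ₗ LinearMap.inr 𝕜 N₀ N₁

lemma NilEnv.mk_ι (a : N₀) (x : N₁) :
    NilEnv.mk β (TensorAlgebra.ι 𝕜 (a, x)) = NilEnv.even β a + NilEnv.odd β x := by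
  simp [NilEnv.even, NilEnv.odd, ← map_add]

lemma NilEnv.even_even (a b : N₀) :
    NilEnv.even β a * NilEnv.even β b = NilEnv.even β b * NilEnv.even β a := by
  have h : NilEnv.mk β _ = NilEnv.mk β _ :=
    RingQuot.mkAlgHom_rel 𝕜 (NilRel.even_even (β := β) a b)
  simpa [NilEnv.even, NilEnv.odd] using h

lemma NilEnv.even_odd (a : N₀) (x : N₁) :
    NilEnv.even β a * NilEnv.odd β x = NilEnv.odd β x * NilEnv.even β a := by
  have h : NilEnv.mk β _ = NilEnv.mk β _ :=
    RingQuot.mkAlgHom_rel 𝕜 (NilRel.even_odd (β := β) a x)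
  simpa [NilEnv.even, NilEnv.odd] using h

lemma NilEnv.odd_odd (x y : N₁) :
    NilEnv.odd β x * NilEnv.odd β y + NilEnv.odd β y * NilEnv.odd β x =
      NilEnv.even β (β x y) := by
  have h : NilEnv.mk β _ = NilEnv.mk β _ :=
    RingQuot.mkAlgHom_rel 𝕜 (NilRel.odd_odd (β := β) x y)
  simpa [NilEnv.even, NilEnv.odd] using h

variable {β} in
/-- The universal property of the enveloping algebra. -/
noncomputable def NilEnv.lift {A : Type*} [Semiring A] [Algebra 𝕜 A] (f : N₀ →ₗ[𝕜] A) (g : N₁ →ₗ[𝕜] A)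
    (hff : ∀ a b, f a * f b = f b * f a) (hfg : ∀ a x, f a * g x = g x * f a)
    (hgg : ∀ x y, g x * g y + g y * g x = f (β x y)) : NilEnv β →ₐ[𝕜] A :=
  RingQuot.liftAlgHom 𝕜 ⟨TensorAlgebra.lift 𝕜 (f.coprod g), by
    rintro _ _ (⟨a, b⟩ | ⟨a, x⟩ | ⟨x, y⟩)
    · simpa using hff a b
    · simpa using hfg a x
    · simpa using hgg x y⟩

section lift

variable {β} {A : Type*} [Semiring A] [Algebra 𝕜 A] (f : N₀ →ₗ[𝕜] A) (g : N₁ →ₗ[𝕜] A)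
  (hff : ∀ a b, f a * f b = f b * f a) (hfg : ∀ a x, f a * g x = g x * f a)
  (hgg : ∀ x y, g x * g y + g y * g x = f (β x y))

lemma NilEnv.lift_even (a : N₀) : NilEnv.lift f g hff hfg hgg (NilEnv.even β a) = f a := by
  refine (RingQuot.liftAlgHom_mkAlgHom_apply 𝕜 _ _ _).trans ?_
  simp

lemma NilEnv.lift_odd (x : N₁) : NilEnv.lift f g hff hfg hgg (NilEnv.odd β x) = g x := by
  refine (RingQuot.liftAlgHom_mkAlgHom_apply 𝕜 _ _ _).trans ?_
  simp

end lift

/-- The projection of the enveloping algebra to the linear span of the odd generators. -/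
noncomputable def NilEnv.oddPart : NilEnv β →ₗ[𝕜] N₁ :=
  ExteriorAlgebra.ιInv ∘ₗ (NilEnv.lift (β := β) 0 (ExteriorAlgebra.ι 𝕜) (by simp) (by simp)
    (fun x y => by simp [ExteriorAlgebra.ι_add_mul_swap])).toLinearMap

/-- Killing N₀ turns U(N) into the exterior algebra of N₁, whose generators are independent. This is
the only fragment of the PBW theorem that is needed. -/
lemma NilEnv.oddPart_odd (x : N₁) : NilEnv.oddPart β (NilEnv.odd β x) = x := by
  rw [NilEnv.oddPart, LinearMap.comp_apply, AlgHom.toLinearMap_apply, NilEnv.lift_odd]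
  exact ExteriorAlgebra.ι_leftInverse x

variable {β} in
/-- Left multiplication by an element of `U(N)`. -/
noncomputable def NilEnv.lmul {V : Type*} [AddCommGroup V] [Module 𝕜 V] :
    NilEnv β →ₐ[𝕜] Module.End 𝕜 (NilEnv β ⊗[𝕜] V) :=
  Algebra.lsmul 𝕜 𝕜 (NilEnv β ⊗[𝕜] V)

variable {β} in
/-- Induction on `U(N) ⊗ V`: a property holds if it is linear, holds on `1 ⊗ V`, and is stable under
the generators of `U(N)`. -/
lemma NilEnv.tensor_induction {V : Type*} [AddCommGroup V] [Module 𝕜 V]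
    {p : NilEnv β ⊗[𝕜] V → Prop} (one : ∀ v, p (1 ⊗ₜ v))
    (add : ∀ w w', p w → p w' → p (w + w')) (smul : ∀ (c : 𝕜) w, p w → p (c • w))
    (even : ∀ a w, p w → p (NilEnv.even β a • w)) (odd : ∀ x w, p w → p (NilEnv.odd β x • w))
    (w : NilEnv β ⊗[𝕜] V) : p w := by
  -- Stability under the generators gives stability under left multiplication by every word, and
  -- U(N) ⊗ V is spanned by the u • (1 ⊗ v).
  have key : ∀ (t : TensorAlgebra 𝕜 (N₀ × N₁)) w, p w → p (NilEnv.mk β t • w) := by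
    intro t
    induction t using TensorAlgebra.induction with
    | algebraMap r => intro w hw; rw [AlgHom.commutes, algebraMap_smul]; exact smul r w hw
    | ι z =>
      intro w hw
      rw [NilEnv.mk_ι β z.1 z.2, add_smul]
      exact add _ _ (even _ _ hw) (odd _ _ hw)
    | mul s t hs ht => intro w hw; rw [map_mul, mul_smul]; exact hs _ (ht _ hw)
    | add s t hs ht => intro w hw; rw [map_add, add_smul]; exact add _ _ (hs _ hw) (ht _ hw)
  induction w using TensorProduct.induction_on with
  | zero => simpa using smul 0 _ (one 0)
  | tmul u v =>
    obtain ⟨t, rfl⟩ := RingQuot.mkAlgHom_surjective 𝕜 (NilRel β) u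
    have := key t _ (one v)
    rwa [TensorProduct.smul_tmul', smul_eq_mul, mul_one] at this
  | add w w' h h' => exact add _ _ h h'

end Induced

end E510

namespace E510

open TensorProduct

/-! ### The action of L on U(N) ⊗ V -/

section Induced

variable {𝕜 L₀ L₁ : Type*} [Field 𝕜] [CharZero 𝕜] [LieRing L₀] [LieAlgebra 𝕜 L₀]
  [AddCommGroup L₁] [Module 𝕜 L₁] [LieRingModule L₀ L₁] [LieModule 𝕜 L₀ L₁]

/-- A decomposition `L = N ⊕ P` of a Lie superalgebra, where `N = N₀ ⊕ N₁` is a two-step nilpotent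
subalgebra with bracket `β` (embedded by `inc`), and `P`, the kernel of the projection `proj` to
`N`, is a subalgebra, together with a module `V` over `P` on which the odd part of `P` acts by zero
(the action `act` is extended by zero to `N`). -/
structure InducingData (S : LieSuperalgebra 𝕜 L₀ L₁) {N₀ N₁ : Type*} [AddCommGroup N₀] [Module 𝕜 N₀]
    [AddCommGroup N₁] [Module 𝕜 N₁] (β : N₁ →ₗ[𝕜] N₁ →ₗ[𝕜] N₀) (V : Type*) [AddCommGroup V]
    [Module 𝕜 V] where
  inc₀ : N₀ →ₗ[𝕜] L₀
  inc₁ : N₁ →ₗ[𝕜] L₁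
  proj₀ : L₀ →ₗ[𝕜] N₀
  proj₁ : L₁ →ₗ[𝕜] N₁
  act : L₀ →ₗ[𝕜] Module.End 𝕜 V
  proj₀_inc₀ : ∀ a, proj₀ (inc₀ a) = a
  proj₁_inc₁ : ∀ x, proj₁ (inc₁ x) = x
  inc_even_even : ∀ a b, ⁅inc₀ a, inc₀ b⁆ = 0
  inc_even_odd : ∀ a x, ⁅inc₀ a, inc₁ x⁆ = 0
  inc_odd_odd : ∀ x y, S.odd (inc₁ x) (inc₁ y) = inc₀ (β x y)
  proj_even_even : ∀ a b, proj₀ a = 0 → proj₀ b = 0 → proj₀ ⁅a, b⁆ = 0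
  proj_even_odd : ∀ a x, proj₀ a = 0 → proj₁ x = 0 → proj₁ ⁅a, x⁆ = 0
  proj_odd_odd : ∀ x y, proj₁ x = 0 → proj₁ y = 0 → proj₀ (S.odd x y) = 0
  act_inc₀ : ∀ a, act (inc₀ a) = 0
  act_lie : ∀ a b, proj₀ a = 0 → proj₀ b = 0 → ∀ v, act ⁅a, b⁆ v = act a (act b v) - act b (act a v)
  act_odd_odd : ∀ x y, proj₁ x = 0 → proj₁ y = 0 → act (S.odd x y) = 0

namespace InducingData

variable {S : LieSuperalgebra 𝕜 L₀ L₁} {N₀ N₁ : Type*} [AddCommGroup N₀] [Module 𝕜 N₀]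
    [AddCommGroup N₁] [Module 𝕜 N₁] {β : N₁ →ₗ[𝕜] N₁ →ₗ[𝕜] N₀} {V : Type*} [AddCommGroup V]
    [Module 𝕜 V] (I : InducingData S β V)

/-- Linear maps from `L` to `U(N) ⊗ V`. -/
abbrev Maps (_ : InducingData S β V) : Type _ :=
  (L₀ →ₗ[𝕜] NilEnv β ⊗[𝕜] V) × (L₁ →ₗ[𝕜] NilEnv β ⊗[𝕜] V)

/-- The action of `N₀` on maps `L → U(N) ⊗ V`. -/
noncomputable def evenAct : N₀ →ₗ[𝕜] Module.End 𝕜 I.Maps :=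
  LinearMap.mk₂ 𝕜 (fun a F =>
      (NilEnv.lmul (NilEnv.even β a) ∘ₗ F.1 - F.1 ∘ₗ (LieModule.toEnd 𝕜 L₀ L₀ (I.inc₀ a)),
        NilEnv.lmul (NilEnv.even β a) ∘ₗ F.2 - F.2 ∘ₗ (LieModule.toEnd 𝕜 L₀ L₁ (I.inc₀ a))))
    (fun a b F => by ext z <;> simp <;> abel)
    (fun c a F => by ext z <;> simp [smul_sub])
    (fun a F G => by ext z <;> simp <;> abel)
    (fun c a F => by ext z <;> simp [smul_sub])

/-- The bracket of even elements with a given odd element, as a linear map. -/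
noncomputable def lieOdd : L₁ →ₗ[𝕜] L₀ →ₗ[𝕜] L₁ := (LieModule.toEnd 𝕜 L₀ L₁ : L₀ →ₗ[𝕜] _).flip

/-- The action of `N₁` on maps `L → U(N) ⊗ V`. -/
noncomputable def oddAct : N₁ →ₗ[𝕜] Module.End 𝕜 I.Maps :=
  LinearMap.mk₂ 𝕜 (fun x F =>
      (NilEnv.lmul (NilEnv.odd β x) ∘ₗ F.1 + F.2 ∘ₗ lieOdd (I.inc₁ x),
        F.1 ∘ₗ S.odd (I.inc₁ x) - NilEnv.lmul (NilEnv.odd β x) ∘ₗ F.2))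
    (fun a b F => by ext z <;> simp <;> abel)
    (fun c a F => by ext z <;> simp [smul_sub])
    (fun a F G => by ext z <;> simp <;> abel)
    (fun c a F => by ext z <;> simp [smul_sub])

/-- A vector w is encoded by its orbit map z ↦ z w. The formulas for the actions of N are then
forced by the commutation rules, such as D (a w) = a (D w) − [a, D] w for even elements and z (x w)
= [x, z] w − x (z w) for odd ones. -/
lemma evenAct_fst (a : N₀) (F : I.Maps) (D : L₀) :
    (I.evenAct a F).1 D = NilEnv.even β a • F.1 D - F.1 ⁅I.inc₀ a, D⁆ := rfl

lemma evenAct_snd (a : N₀) (F : I.Maps) (z : L₁) :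
    (I.evenAct a F).2 z = NilEnv.even β a • F.2 z - F.2 ⁅I.inc₀ a, z⁆ := rfl

lemma oddAct_fst (x : N₁) (F : I.Maps) (D : L₀) :
    (I.oddAct x F).1 D = NilEnv.odd β x • F.1 D + F.2 ⁅D, I.inc₁ x⁆ := rfl

lemma oddAct_snd (x : N₁) (F : I.Maps) (z : L₁) :
    (I.oddAct x F).2 z = F.1 (S.odd (I.inc₁ x) z) - NilEnv.odd β x • F.2 z := rfl

/-- The action of `U(N)` on maps `L → U(N) ⊗ V`. -/
noncomputable def mapsAct : NilEnv β →ₐ[𝕜] Module.End 𝕜 I.Maps :=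
  NilEnv.lift (β := β) (A := Module.End 𝕜 I.Maps) I.evenAct I.oddAct
    -- Each of the three relations of U(N) reduces to the Jacobi identity of L for two elements of N
    -- and one arbitrary element.
    (fun a b => by
      refine LinearMap.ext fun F => Prod.ext (LinearMap.ext fun D => ?_) (LinearMap.ext fun D => ?_)
      · simp only [Module.End.mul_apply, evenAct_fst, smul_sub, ← mul_smul, NilEnv.even_even β a b]
        rw [leibniz_lie (I.inc₀ b), I.inc_even_even]
        simp; abel
      · simp only [Module.End.mul_apply, evenAct_snd, smul_sub, ← mul_smul, NilEnv.even_even β a b]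
        rw [leibniz_lie (I.inc₀ b), I.inc_even_even]
        simp; abel)
    (fun a x => by
      refine LinearMap.ext fun F => Prod.ext (LinearMap.ext fun D => ?_) (LinearMap.ext fun z => ?_)
      · simp only [Module.End.mul_apply, evenAct_fst, evenAct_snd, oddAct_fst, smul_sub, smul_add,
          ← mul_smul, NilEnv.even_odd]
        have : ⁅⁅I.inc₀ a, D⁆, I.inc₁ x⁆ = ⁅I.inc₀ a, ⁅D, I.inc₁ x⁆⁆ := by
          rw [lie_lie, I.inc_even_odd, lie_zero, sub_zero]
        rw [this]; abel
      · simp only [Module.End.mul_apply, evenAct_fst, evenAct_snd, oddAct_snd, smul_sub,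
          ← mul_smul, NilEnv.even_odd]
        have : S.odd (I.inc₁ x) ⁅I.inc₀ a, z⁆ = ⁅I.inc₀ a, S.odd (I.inc₁ x) z⁆ := by
          rw [S.lie_odd, I.inc_even_odd, map_zero, LinearMap.zero_apply, zero_add]
        rw [this]; abel)
    (fun x y => by
      refine LinearMap.ext fun F => Prod.ext (LinearMap.ext fun D => ?_) (LinearMap.ext fun z => ?_)
      · simp only [Module.End.mul_apply, LinearMap.add_apply, Prod.fst_add, evenAct_fst, oddAct_fst,
          oddAct_snd, smul_add, ← mul_smul, ← NilEnv.odd_odd, ← I.inc_odd_odd, add_smul]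
        have : ⁅S.odd (I.inc₁ x) (I.inc₁ y), D⁆ =
            - (S.odd (I.inc₁ x) ⁅D, I.inc₁ y⁆ + S.odd (I.inc₁ y) ⁅D, I.inc₁ x⁆) := by
          rw [← lie_skew, S.lie_odd, S.symm _ (I.inc₁ y), add_comm]
        rw [this]; simp only [map_neg, map_add]; abel
      · simp only [Module.End.mul_apply, LinearMap.add_apply, Prod.snd_add, evenAct_snd, oddAct_fst,
          oddAct_snd, smul_sub, ← mul_smul, ← NilEnv.odd_odd, ← I.inc_odd_odd, add_smul]
        have h := S.jacobi (I.inc₁ x) (I.inc₁ y) z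
        rw [S.symm z] at h
        have : ⁅S.odd (I.inc₁ x) (I.inc₁ y), z⁆ =
            - (⁅S.odd (I.inc₁ y) z, I.inc₁ x⁆ + ⁅S.odd (I.inc₁ x) z, I.inc₁ y⁆) := by
          rw [eq_neg_iff_add_eq_zero, ← h]; abel
        rw [this]; simp only [map_neg, map_add]; abel)

/-- The action of `L` on `1 ⊗ V`. -/
noncomputable def base : V →ₗ[𝕜] I.Maps :=
  LinearMap.prod
    (LinearMap.mk₂ 𝕜 (fun v D => NilEnv.even β (I.proj₀ D) ⊗ₜ[𝕜] v + 1 ⊗ₜ[𝕜] I.act D v)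
      (fun v v' D => by simp only [map_add, tmul_add]; abel)
      (fun c v D => by simp only [map_smul, tmul_smul, smul_add])
      (fun v D E => by simp only [map_add, add_tmul, LinearMap.add_apply, tmul_add]; abel)
      (fun c v D => by
        simp only [map_smul, LinearMap.smul_apply, ← smul_tmul', tmul_smul, smul_add]))
    (LinearMap.mk₂ 𝕜 (fun v z => NilEnv.odd β (I.proj₁ z) ⊗ₜ[𝕜] v)
      (fun v v' z => tmul_add _ _ _)
      (fun c v z => tmul_smul _ _ _)
      (fun v z z' => by simp only [map_add, add_tmul])
      (fun c v z => by simp only [map_smul, smul_tmul']))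

lemma base_fst (v : V) (D : L₀) :
    (I.base v).1 D = NilEnv.even β (I.proj₀ D) ⊗ₜ[𝕜] v + 1 ⊗ₜ[𝕜] I.act D v := rfl

lemma base_snd (v : V) (z : L₁) : (I.base v).2 z = NilEnv.odd β (I.proj₁ z) ⊗ₜ[𝕜] v := rfl

/-- The action of `L` on `U(N) ⊗ V`, as a map that sends an element to its images under `L`. -/
noncomputable def orbit : NilEnv β ⊗[𝕜] V →ₗ[𝕜] I.Maps :=
  TensorProduct.lift
    ((LinearMap.lcomp 𝕜 I.Maps I.base).comp I.mapsAct.toLinearMap)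

lemma orbit_one (v : V) : I.orbit (1 ⊗ₜ v) = I.base v := by
  simp [orbit]

/-- U(N)-linearity of the orbit map is what turns the action of L on u ⊗ v into a recursion on u
that starts from 1 ⊗ v. -/
lemma orbit_smul (u : NilEnv β) (w : NilEnv β ⊗[𝕜] V) :
    I.orbit (u • w) = I.mapsAct u (I.orbit w) := by
  induction w using TensorProduct.induction_on with
  | zero => simp
  | tmul u' v => simp [orbit, smul_tmul']
  | add w w' h h' => rw [smul_add, map_add, map_add, map_add, h, h']

/-- The action of even elements on the induced module. -/
noncomputable def rho₀ : L₀ →ₗ[𝕜] Module.End 𝕜 (NilEnv β ⊗[𝕜] V) :=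
  (LinearMap.fst 𝕜 _ _ ∘ₗ I.orbit).flip

/-- The action of odd elements on the induced module. -/
noncomputable def rho₁ : L₁ →ₗ[𝕜] Module.End 𝕜 (NilEnv β ⊗[𝕜] V) :=
  (LinearMap.snd 𝕜 _ _ ∘ₗ I.orbit).flip

lemma rho₀_one (D : L₀) (v : V) :
    I.rho₀ D (1 ⊗ₜ v) = NilEnv.even β (I.proj₀ D) ⊗ₜ[𝕜] v + 1 ⊗ₜ[𝕜] I.act D v := by
  change (I.orbit (1 ⊗ₜ v)).1 D = _
  rw [orbit_one, base_fst]

lemma rho₁_one (z : L₁) (v : V) :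
    I.rho₁ z (1 ⊗ₜ v) = NilEnv.odd β (I.proj₁ z) ⊗ₜ[𝕜] v := by
  change (I.orbit (1 ⊗ₜ v)).2 z = _
  rw [orbit_one, base_snd]

lemma rho₀_even (D : L₀) (a : N₀) (w : NilEnv β ⊗[𝕜] V) :
    I.rho₀ D (NilEnv.even β a • w) = NilEnv.even β a • I.rho₀ D w - I.rho₀ ⁅I.inc₀ a, D⁆ w := by
  change (I.orbit (_ • w)).1 D = _
  rw [orbit_smul, mapsAct, NilEnv.lift_even, evenAct_fst]; rfl

lemma rho₁_even (z : L₁) (a : N₀) (w : NilEnv β ⊗[𝕜] V) :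
    I.rho₁ z (NilEnv.even β a • w) = NilEnv.even β a • I.rho₁ z w - I.rho₁ ⁅I.inc₀ a, z⁆ w := by
  change (I.orbit (_ • w)).2 z = _
  rw [orbit_smul, mapsAct, NilEnv.lift_even, evenAct_snd]; rfl

lemma rho₀_odd (D : L₀) (x : N₁) (w : NilEnv β ⊗[𝕜] V) :
    I.rho₀ D (NilEnv.odd β x • w) = NilEnv.odd β x • I.rho₀ D w + I.rho₁ ⁅D, I.inc₁ x⁆ w := by
  change (I.orbit (_ • w)).1 D = _
  rw [orbit_smul, mapsAct, NilEnv.lift_odd, oddAct_fst]; rfl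

lemma rho₁_odd (z : L₁) (x : N₁) (w : NilEnv β ⊗[𝕜] V) :
    I.rho₁ z (NilEnv.odd β x • w) =
      I.rho₀ (S.odd (I.inc₁ x) z) w - NilEnv.odd β x • I.rho₁ z w := by
  change (I.orbit (_ • w)).2 z = _
  rw [orbit_smul, mapsAct, NilEnv.lift_odd, oddAct_snd]; rfl

/-- `N` acts by left multiplication. -/
lemma rho_inc (w : NilEnv β ⊗[𝕜] V) :
    (∀ a, I.rho₀ (I.inc₀ a) w = NilEnv.even β a • w) ∧
      ∀ x, I.rho₁ (I.inc₁ x) w = NilEnv.odd β x • w := by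
  induction w using NilEnv.tensor_induction with
  | one v =>
    refine ⟨fun a => ?_, fun x => ?_⟩
    · simp [rho₀_one, I.proj₀_inc₀, I.act_inc₀, smul_tmul']
    · simp [rho₁_one, I.proj₁_inc₁, smul_tmul']
  | add w w' h h' => simp [h.1, h.2, h'.1, h'.2]
  | smul c w h => simp [h.1, h.2, smul_comm c]
  | even b w h =>
    refine ⟨fun a => ?_, fun x => ?_⟩
    · rw [rho₀_even, h.1, I.inc_even_even, ← mul_smul, NilEnv.even_even, mul_smul]; simp
    · rw [rho₁_even, h.2, I.inc_even_odd, ← mul_smul, NilEnv.even_odd, mul_smul]; simp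
  | odd y w h =>
    refine ⟨fun a => ?_, fun x => ?_⟩
    · rw [rho₀_odd, h.1, I.inc_even_odd, ← mul_smul, ← NilEnv.even_odd, mul_smul]; simp
    · rw [rho₁_odd, h.2, I.inc_odd_odd, h.1, ← NilEnv.odd_odd, add_smul, mul_smul, mul_smul]
      abel


lemma exists_even (D : L₀) : ∃ a D', I.proj₀ D' = 0 ∧ D = I.inc₀ a + D' :=
  ⟨I.proj₀ D, D - I.inc₀ (I.proj₀ D), by rw [map_sub, I.proj₀_inc₀, sub_self], by abel⟩

lemma exists_odd (z : L₁) : ∃ x z', I.proj₁ z' = 0 ∧ z = I.inc₁ x + z' :=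
  ⟨I.proj₁ z, z - I.inc₁ (I.proj₁ z), by rw [map_sub, I.proj₁_inc₁, sub_self], by abel⟩

/-- Split both elements along L = N ⊕ P. The components in P act on 1 ⊗ V as on V, those in N act by
left multiplication (`rho_inc`), and the mixed terms are the recursion formula `rho₀_even`. The two
lemmas with odd elements have the same proof. -/
lemma rho₀_rho₀_one (D E : L₀) (v : V) :
    I.rho₀ D (I.rho₀ E (1 ⊗ₜ v)) - I.rho₀ E (I.rho₀ D (1 ⊗ₜ v)) = I.rho₀ ⁅D, E⁆ (1 ⊗ₜ v) := by
  obtain ⟨a, D, hD, rfl⟩ := I.exists_even D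
  obtain ⟨b, E, hE, rfl⟩ := I.exists_even E
  have h : I.rho₀ D (I.rho₀ E (1 ⊗ₜ v)) - I.rho₀ E (I.rho₀ D (1 ⊗ₜ v)) =
      I.rho₀ ⁅D, E⁆ (1 ⊗ₜ v) := by
    simp [rho₀_one, hD, hE, I.proj_even_even D E hD hE, I.act_lie D E hD hE, tmul_sub]
  simp only [map_add, LinearMap.add_apply, (I.rho_inc _).1, rho₀_even, lie_add, add_lie, ← h,
    I.inc_even_even, ← lie_skew D (I.inc₀ b), map_neg, map_zero, LinearMap.neg_apply,
    LinearMap.zero_apply, ← mul_smul, NilEnv.even_even β a b]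
  abel

lemma rho₀_rho₁_one (D : L₀) (z : L₁) (v : V) :
    I.rho₀ D (I.rho₁ z (1 ⊗ₜ v)) - I.rho₁ z (I.rho₀ D (1 ⊗ₜ v)) = I.rho₁ ⁅D, z⁆ (1 ⊗ₜ v) := by
  obtain ⟨a, D, hD, rfl⟩ := I.exists_even D
  obtain ⟨x, z, hz, rfl⟩ := I.exists_odd z
  have h : I.rho₀ D (I.rho₁ z (1 ⊗ₜ v)) - I.rho₁ z (I.rho₀ D (1 ⊗ₜ v)) =
      I.rho₁ ⁅D, z⁆ (1 ⊗ₜ v) := by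
    simp [rho₀_one, rho₁_one, hD, hz, I.proj_even_odd D z hD hz]
  simp only [map_add, LinearMap.add_apply, (I.rho_inc _).1, (I.rho_inc _).2, rho₀_odd, rho₁_even,
    lie_add, add_lie, ← h, I.inc_even_odd, map_zero, LinearMap.zero_apply, ← mul_smul,
    NilEnv.even_odd]
  abel

lemma rho₁_rho₁_one (y z : L₁) (v : V) :
    I.rho₁ y (I.rho₁ z (1 ⊗ₜ v)) + I.rho₁ z (I.rho₁ y (1 ⊗ₜ v)) =
      I.rho₀ (S.odd y z) (1 ⊗ₜ v) := by
  obtain ⟨x, y, hy, rfl⟩ := I.exists_odd y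
  obtain ⟨x', z, hz, rfl⟩ := I.exists_odd z
  have h : I.rho₁ y (I.rho₁ z (1 ⊗ₜ v)) + I.rho₁ z (I.rho₁ y (1 ⊗ₜ v)) =
      I.rho₀ (S.odd y z) (1 ⊗ₜ v) := by
    simp [rho₀_one, rho₁_one, hy, hz, I.proj_odd_odd y z hy hz, I.act_odd_odd y z hy hz]
  simp only [map_add, LinearMap.add_apply, (I.rho_inc _).1, (I.rho_inc _).2, rho₁_odd,
    ← h, I.inc_odd_odd, ← mul_smul, S.symm y (I.inc₁ x'), ← NilEnv.odd_odd, add_smul]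
  abel

/-- The operators on `U(N) ⊗ V` satisfy the commutation relations of `L`. -/
lemma rho_lie (w : NilEnv β ⊗[𝕜] V) :
    (∀ D E, I.rho₀ D (I.rho₀ E w) - I.rho₀ E (I.rho₀ D w) = I.rho₀ ⁅D, E⁆ w) ∧
    (∀ D z, I.rho₀ D (I.rho₁ z w) - I.rho₁ z (I.rho₀ D w) = I.rho₁ ⁅D, z⁆ w) ∧
    ∀ y z, I.rho₁ y (I.rho₁ z w) + I.rho₁ z (I.rho₁ y w) = I.rho₀ (S.odd y z) w := by
  induction w using NilEnv.tensor_induction with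
  | one v => 
    exact ⟨fun D E => I.rho₀_rho₀_one D E v, fun D z => I.rho₀_rho₁_one D z v,
      fun y z => I.rho₁_rho₁_one y z v⟩
  | add w w' h h' =>
    refine ⟨fun D E => ?_, fun D z => ?_, fun y z => ?_⟩
    · simp only [map_add, ← h.1, ← h'.1]; abel
    · simp only [map_add, ← h.2.1, ← h'.2.1]; abel
    · simp only [map_add, ← h.2.2, ← h'.2.2]; abel
  | smul c w h =>
    refine ⟨fun D E => ?_, fun D z => ?_, fun y z => ?_⟩
    · simp only [map_smul, ← h.1, smul_sub]
    · simp only [map_smul, ← h.2.1, smul_sub]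
    · simp only [map_smul, ← h.2.2, smul_add]
  -- The relation passes from w to a • w by the recursion formulas and the Jacobi identity with a;
  -- likewise for odd generators below.
  | even a w h =>
    obtain ⟨h₀, h₁, h₂⟩ := h
    refine ⟨fun D E => ?_, fun D z => ?_, fun y z => ?_⟩
    · simp only [rho₀_even, map_sub, ← h₀, smul_sub, leibniz_lie (I.inc₀ a) D E, map_add,
        LinearMap.add_apply]
      abel
    · simp only [rho₀_even, rho₁_even, map_sub, ← h₁, smul_sub, leibniz_lie (I.inc₀ a) D z, map_add,
        LinearMap.add_apply]
      abel
    · simp only [rho₀_even, rho₁_even, map_sub, ← h₂, smul_add, S.lie_odd, map_add,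
        LinearMap.add_apply]
      abel
  | odd x w h =>
    obtain ⟨h₀, h₁, h₂⟩ := h
    refine ⟨fun D E => ?_, fun D z => ?_, fun y z => ?_⟩
    · have e : ⁅⁅D, E⁆, I.inc₁ x⁆ = ⁅D, ⁅E, I.inc₁ x⁆⁆ - ⁅E, ⁅D, I.inc₁ x⁆⁆ := lie_lie _ _ _
      simp only [rho₀_odd, map_add, ← h₀, ← h₁, smul_sub, e, map_sub, LinearMap.sub_apply]
      abel
    · have e : S.odd (I.inc₁ x) ⁅D, z⁆ = ⁅D, S.odd (I.inc₁ x) z⁆ - S.odd ⁅D, I.inc₁ x⁆ z := by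
        rw [S.lie_odd]; abel
      simp only [rho₀_odd, rho₁_odd, map_add, map_sub, ← h₀, ← h₁, ← h₂, smul_sub, e,
        LinearMap.sub_apply]
      abel
    · have e : ⁅S.odd y z, I.inc₁ x⁆ = - (⁅S.odd (I.inc₁ x) y, z⁆ + ⁅S.odd (I.inc₁ x) z, y⁆) := by
        have := S.jacobi y z (I.inc₁ x)
        rw [S.symm z] at this
        rw [eq_neg_iff_add_eq_zero, ← this]; abel
      simp only [rho₀_odd, rho₁_odd, map_sub, ← h₁, ← h₂, smul_add, e,
        LinearMap.neg_apply, map_neg, map_add, LinearMap.add_apply]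
      abel

/-- The representation of the enveloping algebra of `L` on `U(N) ⊗ V`. -/
noncomputable def rep : Env S →ₐ[𝕜] Module.End 𝕜 (NilEnv β ⊗[𝕜] V) :=
  RingQuot.liftAlgHom 𝕜 ⟨TensorAlgebra.lift 𝕜 (I.rho₀.coprod I.rho₁), by
    rintro _ _ (⟨a, b⟩ | ⟨a, x⟩ | ⟨x, y⟩) <;> refine LinearMap.ext fun w => ?_
    · simpa using (I.rho_lie w).1 a b
    · simpa using (I.rho_lie w).2.1 a x
    · simpa using (I.rho_lie w).2.2 x y⟩

lemma rep_ι (D : L₀) (z : L₁) : I.rep (Env.ι S (D, z)) = I.rho₀ D + I.rho₁ z := by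
  refine (RingQuot.liftAlgHom_mkAlgHom_apply 𝕜 _ _ _).trans ?_
  simp

end InducingData
end Induced
end E510

namespace E510

open TensorProduct
open MvPowerSeries (pderiv constantCoeff coeff)

/-! ### Constant vector fields and forms -/

/-- The constant vector field with given components. -/
noncomputable def constField : (Fin 5 → ℂ) →ₗ[ℂ] S5 where
  toFun a := ⟨vfOf fun j => MvPowerSeries.C (a j), by
    refine ⟨fun f => ?_, ?_⟩
    · simp only [vfOf_X]; rw [vfOf_apply]
    · simp only [vfOf_X, MvPowerSeries.pderiv_C, Finset.sum_const_zero]⟩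
  map_add' a b := vf_ext fun j => by
    rw [vcomp_add]; simp only [vcomp, vfOf_X, Pi.add_apply, map_add]
  map_smul' c a := vf_ext fun j => by
    rw [RingHom.id_apply, vcomp_smul]
    simp only [vcomp, vfOf_X, Pi.smul_apply, smul_eq_mul, map_mul, MvPowerSeries.smul_eq_C_mul]

lemma vcomp_constField (a : Fin 5 → ℂ) (j : Fin 5) :
    vcomp (constField a) j = MvPowerSeries.C (a j) :=
  vfOf_X (fun j => MvPowerSeries.C (a j)) j

/-- Skew-symmetric complex matrices. -/
def Skew5 : Submodule ℂ (Fin 5 → Fin 5 → ℂ) where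
  carrier := {w | ∀ i j, w i j = - w j i}
  zero_mem' := by simp
  add_mem' hv hw i j := by simp only [Pi.add_apply]; rw [hv i j, hw i j]; ring
  smul_mem' c w hw i j := by simp only [Pi.smul_apply]; rw [hw i j, smul_neg]

/-- The 2-form with given constant coefficients. -/
noncomputable def constForm : Skew5 →ₗ[ℂ] Om2 where
  toFun x := ⟨fun i j => MvPowerSeries.C (x.1 i j), fun i j => by
    beta_reduce; rw [x.2 i j, map_neg], fun i j k => by simp only [MvPowerSeries.pderiv_C, add_zero]⟩
  map_add' x y := by ext1; funext i j; simp
  map_smul' c x := by ext1; funext i j; simp [MvPowerSeries.smul_eq_C_mul]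

lemma constForm_apply (x : Skew5) (i j : Fin 5) :
    (constForm x).1 i j = MvPowerSeries.C (x.1 i j) := rfl

/-- The value of a vector field at the origin. -/
noncomputable def fieldValue : S5 →ₗ[ℂ] (Fin 5 → ℂ) where
  toFun D j := constantCoeff (vcomp D j)
  map_add' D E := by funext j; simp [vcomp_add]
  map_smul' c D := by funext j; simp [vcomp_smul, MvPowerSeries.smul_eq_C_mul]

lemma fieldValue_apply (D : S5) (j : Fin 5) : fieldValue D j = constantCoeff (vcomp D j) := rfl

lemma fieldValue_eq_zero_iff (D : S5) : fieldValue D = 0 ↔ NonnegEven D := funext_iff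

/-- The value of a 2-form at the origin. -/
noncomputable def formValue : Om2 →ₗ[ℂ] Skew5 where
  toFun w := ⟨fun i j => constantCoeff (w.1 i j), fun i j => by
    beta_reduce; rw [w.2.1 i j, map_neg]⟩
  map_add' v w := by ext1; funext i j; simp
  map_smul' c w := by ext1; funext i j; simp [MvPowerSeries.smul_eq_C_mul]

lemma formValue_apply (w : Om2) (i j : Fin 5) : (formValue w).1 i j = constantCoeff (w.1 i j) := rfl

lemma formValue_eq_zero_iff (w : Om2) : formValue w = 0 ↔ NonnegOdd w := by
  rw [Subtype.ext_iff]
  exact ⟨fun h i j => congrFun (congrFun h i) j, fun h => funext fun i => funext fun j => h i j⟩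

/-- The bracket of constant 2-forms. -/
noncomputable def constWedge : Skew5 →ₗ[ℂ] Skew5 →ₗ[ℂ] (Fin 5 → ℂ) :=
  (wedgeL.compl₁₂ constForm constForm).compr₂ fieldValue

lemma constantCoeff_vf_apply (D : S5) (f : Ser) :
    constantCoeff (D.1 f) = ∑ k, constantCoeff (vcomp D k) * coeff (Finsupp.single k 1) f := by
  rw [vf_apply, map_sum]
  refine Finset.sum_congr rfl fun k _ => ?_
  rw [map_mul, ← MvPowerSeries.coeff_zero_eq_constantCoeff_apply (pderiv ℂ k f),
    MvPowerSeries.coeff_pderiv]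
  simp

lemma constantCoeff_pderiv (k : Fin 5) (f : Ser) :
    constantCoeff (pderiv ℂ k f) = coeff (Finsupp.single k 1) f := by
  rw [← MvPowerSeries.coeff_zero_eq_constantCoeff_apply, MvPowerSeries.coeff_pderiv]
  simp

lemma coeff_single_mul (i : Fin 5) (f g : Ser) :
    coeff (Finsupp.single i 1) (f * g) = constantCoeff f * coeff (Finsupp.single i 1) g +
      coeff (Finsupp.single i 1) f * constantCoeff g := by
  rw [← constantCoeff_pderiv, Derivation.leibniz, map_add, smul_eq_mul, smul_eq_mul, map_mul,
    map_mul, constantCoeff_pderiv, constantCoeff_pderiv, mul_comm (constantCoeff g)]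

lemma degZero_apply (D : S5) (i j : Fin 5) :
    (degZero D).1 i j = coeff (Finsupp.single i 1) (vcomp D j) := rfl

/-- `degZero` as a linear map. -/
noncomputable def degZeroL : S5 →ₗ[ℂ] sl5 where
  toFun := degZero
  map_add' D E := by ext i j; simp [degZero, vcomp_add]
  map_smul' c D := by ext i j; simp [degZero, vcomp_smul]

lemma degZero_lie (D E : S5) (hD : NonnegEven D) (hE : NonnegEven E) :
    degZero ⁅D, E⁆ = ⁅degZero D, degZero E⁆ := by
  ext i j
  have h (D E : S5) (hD : NonnegEven D) (hE : NonnegEven E) :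
      coeff (Finsupp.single i 1) (D.1 (vcomp E j)) = ((degZero D).1 * (degZero E).1) i j := by
    rw [vf_apply, map_sum, Matrix.mul_apply]
    refine Finset.sum_congr rfl fun k _ => ?_
    rw [coeff_single_mul, hD k, constantCoeff_pderiv, zero_mul, zero_add]; rfl
  rw [degZero_apply, vcomp_lie, map_sub, h D E hD hE, h E D hE hD]
  rfl

lemma degZero_constField (a : Fin 5 → ℂ) : degZero (constField a) = 0 := by
  ext i j
  rw [degZero_apply, vcomp_constField, MvPowerSeries.coeff_C]
  simp

lemma vf_C (D : S5) (c : ℂ) : D.1 (MvPowerSeries.C c : Ser) = 0 := by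
  rw [vf_apply]; simp [MvPowerSeries.pderiv_C]

/-- The product of two forms vanishing at the origin vanishes to second order. Hence brackets of odd
elements of P act on V by zero, so the odd part of P can act by zero as well. -/
lemma degZero_wedge (v w : Om2) (hv : NonnegOdd v) (hw : NonnegOdd w) :
    degZero (wedge v w) = 0 := by
  ext i j
  rw [degZero_apply, vcomp_wedge, wedgeComp]
  simp only [map_add, map_sub, coeff_single_mul, hv _ _, hw _ _, zero_mul, mul_zero, add_zero,
    sub_zero]
  rfl

lemma nonnegEven_wedge (v w : Om2) (hv : NonnegOdd v) : NonnegEven (wedge v w) := by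
  intro j
  rw [vcomp_wedge, wedgeComp]
  simp only [map_add, map_sub, map_mul, hv _ _, zero_mul, add_zero, sub_zero]

/-- The decomposition of `E(5,10)` into constant elements and elements of degree `≥ 0`, and the
action of the latter on an `sl₅`-module. -/
noncomputable def inducingData (V : Type*) [AddCommGroup V] [Module ℂ V] [LieRingModule sl5 V]
    [LieModule ℂ sl5 V] : InducingData E constWedge V where
  inc₀ := constField
  inc₁ := constForm
  proj₀ := fieldValue
  proj₁ := formValue
  act := (LieModule.toEnd ℂ sl5 V : sl5 →ₗ[ℂ] Module.End ℂ V) ∘ₗ degZeroL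
  proj₀_inc₀ a := by funext j; rw [fieldValue_apply, vcomp_constField]; simp
  proj₁_inc₁ x := by ext1; funext i j; rw [formValue_apply, constForm_apply]; simp
  inc_even_even a b := vf_ext fun j => by
    rw [vcomp_lie, vcomp_constField, vcomp_constField, vf_C, vf_C, sub_zero]; rfl
  inc_even_odd a x := by
    ext1; funext i j
    rw [Om2.lie_apply]
    simp only [constForm_apply, vcomp_constField, vf_C, MvPowerSeries.pderiv_C, zero_mul, add_zero,
      Finset.sum_const_zero]
    rfl
  inc_odd_odd x y := vf_ext fun j => by
    rw [vcomp_constField]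
    change vcomp (wedge _ _) j = MvPowerSeries.C (constantCoeff (vcomp (wedge _ _) j))
    rw [vcomp_wedge]
    simp only [wedgeComp, constForm_apply, ← map_mul, ← map_add, ← map_sub,
      MvPowerSeries.constantCoeff_C]
  proj_even_even a b ha hb := by
    rw [fieldValue_eq_zero_iff] at *
    intro j
    rw [vcomp_lie, map_sub, constantCoeff_vf_apply, constantCoeff_vf_apply]
    simp [ha _, hb _]
  proj_even_odd a x ha hx := by
    rw [fieldValue_eq_zero_iff] at ha
    rw [formValue_eq_zero_iff] at *
    intro i j
    rw [Om2.lie_apply, map_add, constantCoeff_vf_apply]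
    simp [ha _, hx _ _]
  proj_odd_odd x y hx hy := by
    rw [fieldValue_eq_zero_iff]
    rw [formValue_eq_zero_iff] at *
    exact nonnegEven_wedge x y hx
  act_inc₀ a := by
    change LieModule.toEnd ℂ sl5 V (degZero (constField a)) = 0
    rw [degZero_constField, map_zero]
  act_lie a b ha hb v := by
    rw [fieldValue_eq_zero_iff] at *
    change ⁅degZero ⁅a, b⁆, v⁆ = ⁅degZero a, ⁅degZero b, v⁆⁆ - ⁅degZero b, ⁅degZero a, v⁆⁆
    rw [degZero_lie a b ha hb, lie_lie]
  act_odd_odd x y hx hy := by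
    rw [formValue_eq_zero_iff] at *
    change LieModule.toEnd ℂ sl5 V (degZero (wedge x y)) = 0
    rw [degZero_wedge x y hx hy, map_zero]

end E510

namespace E510

open TensorProduct
open MvPowerSeries (pderiv constantCoeff coeff)

section Nabla

variable {V : Type*} [AddCommGroup V] [Module ℂ V]

/-- The extension of a linear map to a map of `U`-modules. -/
noncomputable def extend {P : Type*} [AddCommGroup P] [Module ℂ P] [Module U P]
    [IsScalarTower ℂ U P] (l : V →ₗ[ℂ] P) : U ⊗[ℂ] V →ₗ[U] P :=
  let f : U ⊗[ℂ] V →ₗ[ℂ] P := TensorProduct.lift (LinearMap.mk₂ ℂ (fun u v => u • l v)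
      (fun u u' v => add_smul u u' _) (fun c u v => smul_assoc c u _)
      (fun u v v' => by rw [map_add, smul_add])
      (fun c u v => by rw [map_smul, smul_algebra_smul_comm]))
  { f with
    map_smul' := fun u t => by
      change f (u • t) = u • f t
      induction t using TensorProduct.induction_on with
      | zero => simp
      | tmul u' v => simp [f, smul_tmul', mul_smul]
      | add t t' h h' => rw [smul_add, map_add, map_add, h, h', smul_add] }

lemma extend_tmul {P : Type*} [AddCommGroup P] [Module ℂ P] [Module U P]
    [IsScalarTower ℂ U P] (l : V →ₗ[ℂ] P) (u : U) (v : V) : extend l (u ⊗ₜ v) = u • l v := rfl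

variable [LieRingModule sl5 V]

/-! ### Computing in induced modules -/

/-- `u ⊗ v` as a bilinear map. -/
noncomputable def M.tmulL : U →ₗ[ℂ] V →ₗ[ℂ] M V :=
  (TensorProduct.mk ℂ U V).compr₂ ((indRel V).mkQ.restrictScalars ℂ)

lemma M.tmulL_apply (u : U) (v : V) : M.tmulL u v = M.tmul u v := rfl

lemma M.smul_tmulL (u u' : U) (v : V) : u • M.tmulL u' v = M.tmulL (u * u') v := rfl

/-- The canonical maps of the even and odd parts to the enveloping algebra. -/
noncomputable def U.even : S5 →ₗ[ℂ] U := Env.ι E ∘ₗ LinearMap.inl ℂ S5 Om2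

/-- The canonical map of the odd part to the enveloping algebra. -/
noncomputable def U.odd : Om2 →ₗ[ℂ] U := Env.ι E ∘ₗ LinearMap.inr ℂ S5 Om2

lemma U.even_mul_odd (D : S5) (w : Om2) :
    U.even D * U.odd w = U.odd w * U.even D + U.odd ⁅D, w⁆ := by
  have h : RingQuot.mkAlgHom ℂ (EnvRel E) _ = RingQuot.mkAlgHom ℂ (EnvRel E) _ :=
    RingQuot.mkAlgHom_rel ℂ (EnvRel.even_odd (S := E) D w)
  rw [map_sub, map_mul, map_mul, sub_eq_iff_eq_add'] at h
  exact h

lemma U.odd_mul_odd (w w' : Om2) :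
    U.odd w * U.odd w' + U.odd w' * U.odd w = U.even (wedge w w') := by
  have h : RingQuot.mkAlgHom ℂ (EnvRel E) _ = RingQuot.mkAlgHom ℂ (EnvRel E) _ :=
    RingQuot.mkAlgHom_rel ℂ (EnvRel.odd_odd (S := E) w w')
  rw [map_add, map_mul, map_mul] at h
  exact h

lemma M.tmulL_mul_even (u : U) (D : S5) (hD : NonnegEven D) (v : V) :
    M.tmulL (u * U.even D) v = M.tmulL u ⁅degZero D, v⁆ := by
  have h : M.tmulL (U.even D) v = M.tmulL 1 ⁅degZero D, v⁆ :=
    (Submodule.Quotient.eq _).mpr (Submodule.subset_span (Or.inl ⟨D, v, hD, rfl⟩))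
  rw [← M.smul_tmulL, h, M.smul_tmulL, mul_one]

lemma M.tmulL_mul_odd (u : U) (w : Om2) (hw : NonnegOdd w) (v : V) :
    M.tmulL (u * U.odd w) v = 0 := by
  have h : M.tmulL (U.odd w) v = 0 :=
    (Submodule.Quotient.mk_eq_zero _).mpr (Submodule.subset_span (Or.inr ⟨w, v, hw, rfl⟩))
  rw [← M.smul_tmulL, h, smul_zero]

lemma M.induction {p : M V → Prop} (zero : p 0) (add : ∀ t t', p t → p t' → p (t + t'))
    (tmul : ∀ u v, p (M.tmulL u v)) (t : M V) : p t := by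
  obtain ⟨t, rfl⟩ := (indRel V).mkQ_surjective t
  induction t using TensorProduct.induction_on with
  | zero => exact zero
  | tmul u v => exact tmul u v
  | add t t' h h' => rw [map_add]; exact add _ _ h h'

/-! ### The degree `-1` part of an induced module -/

variable [LieModule ℂ sl5 V]

/-- The representation of `U` on the model of the induced module. -/
noncomputable def modelMap : U ⊗[ℂ] V →ₗ[ℂ] NilEnv constWedge ⊗[ℂ] V :=
  TensorProduct.lift ((inducingData V).rep.toLinearMap.compl₂ (TensorProduct.mk ℂ _ V 1))

lemma modelMap_smul (u : U) (t : U ⊗[ℂ] V) :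
    modelMap (u • t) = (inducingData V).rep u (modelMap t) := by
  induction t using TensorProduct.induction_on with
  | zero => simp
  | tmul u' v => simp [modelMap, smul_tmul']
  | add t t' h h' => rw [smul_add, map_add, map_add, map_add, h, h']

lemma modelMap_even (D : S5) (v : V) : modelMap (U.even D ⊗ₜ v) =
    NilEnv.even constWedge (fieldValue D) ⊗ₜ[ℂ] v + 1 ⊗ₜ[ℂ] ⁅degZero D, v⁆ := by
  change (inducingData V).rep (Env.ι E (D, 0)) (1 ⊗ₜ v) = _
  rw [InducingData.rep_ι, map_zero, add_zero, InducingData.rho₀_one]; rfl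

lemma modelMap_odd (w : Om2) (v : V) : modelMap (U.odd w ⊗ₜ v) =
    NilEnv.odd constWedge (formValue w) ⊗ₜ[ℂ] v := by
  change (inducingData V).rep (Env.ι E (0, w)) (1 ⊗ₜ v) = _
  rw [InducingData.rep_ι, map_zero, zero_add, InducingData.rho₁_one]; rfl

lemma modelMap_one (v : V) : modelMap ((1 : U) ⊗ₜ v) = 1 ⊗ₜ[ℂ] v := by
  simp [modelMap]

/-- On 1 ⊗ V an element of L_{≥0} has no component in N and acts through its degree zero part, so
the model satisfies the defining relations of `M V`. Identities in `M V` can therefore be read off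
in U(N) ⊗ V. -/
lemma modelMap_eq_zero {t : U ⊗[ℂ] V} (ht : t ∈ indRel V) : modelMap t = 0 := by
  induction ht using Submodule.span_induction with
  | zero => exact map_zero _
  | add t t' _ _ h h' => rw [map_add, h, h', add_zero]
  | smul u t _ h => rw [modelMap_smul, h, map_zero]
  | mem t ht =>
    obtain ⟨D, v, hD, rfl⟩ | ⟨w, v, hw, rfl⟩ := ht
    · have h : modelMap (U.even D ⊗ₜ v - (1 : U) ⊗ₜ ⁅degZero D, v⁆) = 0 := by
        rw [map_sub, modelMap_even, modelMap_one, (fieldValue_eq_zero_iff D).mpr hD]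
        simp
      exact h
    · have h : modelMap (U.odd w ⊗ₜ v) = 0 := by
        rw [modelMap_odd, (formValue_eq_zero_iff w).mpr hw]
        simp
      exact h

lemma formValue_dd (i j a b : Fin 5) : (formValue (dd i j)).1 a b =
    (if a = i ∧ b = j then 1 else 0) - (if a = j ∧ b = i then 1 else 0) := by
  rw [formValue_apply]
  exact MvPowerSeries.constantCoeff_C _

/-- The factor 2 comes from d_{ab} and d_{ba}, which contribute equally because f is skew. -/
lemma sum_dd_smul {Z : Type*} [AddCommGroup Z] [Module ℂ Z] (f : Fin 5 → Fin 5 → Z)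
    (hf : ∀ i j, f i j = - f j i) (a b : Fin 5) :
    ∑ i, ∑ j, (((if a = i ∧ b = j then 1 else 0) - (if a = j ∧ b = i then 1 else 0) : ℂ)) • f i j =
      (2 : ℂ) • f a b := by
  simp only [sub_smul, Finset.sum_sub_distrib, ite_and, ite_smul, one_smul, zero_smul]
  simp only [Finset.sum_ite_eq, Finset.mem_univ, if_true]
  rw [two_smul, sub_eq_add_neg, Finset.sum_eq_single a] 
  · rw [hf b a]; simp
  all_goals simp +contextual [eq_comm]

/-- The elements `d_{ij}` are linearly independent over `V` in `M(V)`. -/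
lemma eq_zero_of_sum_tmul_eq_zero (f : Fin 5 → Fin 5 → V) (hf : ∀ i j, f i j = - f j i)
    (h : ∑ i, ∑ j, M.tmulL (U.odd (dd i j)) (f i j) = 0) (a b : Fin 5) : f a b = 0 := by
  have h1 : (indRel V).mkQ (∑ i, ∑ j, U.odd (dd i j) ⊗ₜ f i j) = 0 := by
    simp only [map_sum]; exact h
  have h2 := modelMap_eq_zero ((Submodule.Quotient.mk_eq_zero _).mp h1)
  simp only [map_sum, modelMap_odd] at h2
  -- Project U(N) to N₁ and take the matrix entry (a, b). What remains is 2 f_{ab}.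
  have h3 := congrArg (TensorProduct.lid ℂ V ∘ LinearMap.rTensor V
    ((LinearMap.proj b ∘ₗ LinearMap.proj a) ∘ₗ Skew5.subtype ∘ₗ NilEnv.oddPart constWedge)) h2
  simp only [Function.comp_apply, map_sum, map_zero, LinearMap.rTensor_tmul, LinearMap.comp_apply,
    NilEnv.oddPart_odd, TensorProduct.lid_tmul, LinearMap.proj_apply, Submodule.subtype_apply,
    formValue_dd] at h3
  rw [sum_dd_smul f hf] at h3
  exact (smul_eq_zero.mp h3).resolve_left two_ne_zero

end Nabla

end E510

namespace E510

open TensorProduct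
open MvPowerSeries (pderiv constantCoeff coeff)

/-! ### A criterion for ∑ d_{ij} ⊗ θ_{ij} to be a morphism of square zero -/

section Nabla

variable {V : Type*} [AddCommGroup V] [Module ℂ V] [LieRingModule sl5 V]

/-- Conditions on a family of operators `θ_{ij}` on an `sl₅`-module under which
`∑ d_{ij} ⊗ θ_{ij}` is a morphism of square zero. -/
structure IsNablaFamily (θ : Fin 5 → Fin 5 → V →ₗ[ℂ] V) : Prop where
  skew : ∀ i j v, θ i j v = - θ j i v
  lie : ∀ (A : sl5) i j v,
    ⁅A, θ i j v⁆ = θ i j ⁅A, v⁆ - ∑ b, (A.1 i b • θ b j v + A.1 j b • θ i b v)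
  singular : ∀ w, NonnegOdd w → ∀ v, ∑ i, ∑ j, ⁅degZero (wedge w (dd i j)), θ i j v⁆ = 0
  comm : ∀ i j k l v, θ i j (θ k l v) = θ k l (θ i j v)
  pluecker : ∀ i j k l v, θ i j (θ k l v) - θ i k (θ j l v) + θ i l (θ j k v) = 0

variable {θ : Fin 5 → Fin 5 → V →ₗ[ℂ] V}

/-- The restriction of `∇` to `1 ⊗ V`. -/
noncomputable def nablaOne (θ : Fin 5 → Fin 5 → V →ₗ[ℂ] V) : V →ₗ[ℂ] M V :=
  ∑ i, ∑ j, M.tmulL (U.odd (dd i j)) ∘ₗ θ i j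

lemma nablaOne_apply (v : V) :
    nablaOne θ v = ∑ i, ∑ j, M.tmulL (U.odd (dd i j)) (θ i j v) := by
  simp [nablaOne]

/-- At the origin the Lie derivative of a constant form sees only the linear part of D. The
difference lies in L_{>0}, hence acts by zero on V. -/
lemma nonnegOdd_lie_dd (D : S5) (i j : Fin 5) :
    NonnegOdd (⁅D, dd i j⁆ -
      ∑ a, ((degZero D).1 a i • dd a j + (degZero D).1 a j • dd i a)) := by
  intro k l
  have h (x y : Om2) : (x - y).1 k l = x.1 k l - y.1 k l := rfl
  rw [← formValue_apply, map_sub, map_sum]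
  change (formValue _).1 k l - (∑ a, _ : Skew5).1 k l = 0
  rw [Submodule.coe_sum, Finset.sum_apply, Finset.sum_apply, sub_eq_zero, formValue_apply,
    Om2.lie_apply]
  have e (a b : Fin 5) : (dd i j).1 a b = MvPowerSeries.C
      ((if a = i ∧ b = j then 1 else 0) - (if a = j ∧ b = i then 1 else 0) : ℂ) := rfl
  simp only [e, vf_C, zero_add, map_sum, map_add, map_mul, constantCoeff_pderiv,
    MvPowerSeries.constantCoeff_C, map_smul, Submodule.coe_add, Submodule.coe_smul, Pi.add_apply,
    Pi.smul_apply, formValue_dd, degZero_apply, smul_eq_mul]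
  simp only [mul_sub, mul_ite, mul_one, mul_zero, ite_and, Finset.sum_add_distrib,
    Finset.sum_sub_distrib, Finset.sum_ite_eq, Finset.sum_ite_eq', Finset.mem_univ, if_true]
  have hs (p : Prop) [Decidable p] (f : Fin 5 → ℂ) :
      ∑ x, (if p then f x else 0) = if p then ∑ x, f x else 0 := by split_ifs <;> simp
  simp only [hs, Finset.sum_ite_eq, Finset.sum_ite_eq', Finset.mem_univ, if_true]
  ring

lemma sum_rev {ι Z : Type*} [Fintype ι] [AddCommMonoid Z] (F : ι → ι → ι → Z) :
    ∑ i, ∑ j, ∑ k, F i j k = ∑ i, ∑ j, ∑ k, F k j i := by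
  rw [Finset.sum_comm]
  exact (Finset.sum_congr rfl fun j _ => Finset.sum_comm).trans Finset.sum_comm

/-- Invariance of ∑ d_{ij} ⊗ θ_{ij}: the d_{ij} and the θ_{ij} transform by dual representations, so
the extra terms agree after renaming a summation index. `T` stands for any bilinear pairing of forms
with V. -/
lemma IsNablaFamily.sum_lie (hθ : IsNablaFamily θ) {Z : Type*} [AddCommGroup Z] [Module ℂ Z]
    (T : Om2 →ₗ[ℂ] V →ₗ[ℂ] Z) (A : sl5) (v : V) :
    ∑ i, ∑ j, (T (dd i j) ⁅A, θ i j v⁆ +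
      T (∑ a, (A.1 a i • dd a j + A.1 a j • dd i a)) (θ i j v)) =
    ∑ i, ∑ j, T (dd i j) (θ i j ⁅A, v⁆) := by
  simp only [hθ.lie, map_sub, map_sum, map_add, map_smul, LinearMap.sum_apply, LinearMap.add_apply,
    LinearMap.smul_apply, Finset.sum_add_distrib, Finset.sum_sub_distrib]
  have e1 : ∑ i, ∑ j, ∑ b, A.1 i b • T (dd i j) (θ b j v) =
      ∑ i, ∑ j, ∑ a, A.1 a i • T (dd a j) (θ i j v) :=
    sum_rev fun i j b => A.1 i b • T (dd i j) (θ b j v)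
  have e2 : ∑ i, ∑ j, ∑ b, A.1 j b • T (dd i j) (θ i b v) =
      ∑ i, ∑ j, ∑ a, A.1 a j • T (dd i a) (θ i j v) :=
    Finset.sum_congr rfl fun i _ => Finset.sum_comm
  rw [e1, e2]
  abel

lemma even_smul_nablaOne (hθ : IsNablaFamily θ) (D : S5) (hD : NonnegEven D) (v : V) :
    U.even D • nablaOne θ v = nablaOne θ ⁅degZero D, v⁆ := by
  have h1 (i j : Fin 5) : U.even D • M.tmulL (U.odd (dd i j)) (θ i j v) =
      (M.tmulL ∘ₗ U.odd) (dd i j) ⁅degZero D, θ i j v⁆ + (M.tmulL ∘ₗ U.odd)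
        (∑ a, ((degZero D).1 a i • dd a j + (degZero D).1 a j • dd i a)) (θ i j v) := by
    have h := M.tmulL_mul_odd 1 _ (nonnegOdd_lie_dd D i j) (θ i j v)
    rw [one_mul, (U.odd).map_sub, LinearMap.map_sub₂, sub_eq_zero] at h
    rw [M.smul_tmulL, U.even_mul_odd, LinearMap.map_add₂]
    exact congrArg₂ (· + ·) (M.tmulL_mul_even _ D hD _) h
  rw [nablaOne_apply, nablaOne_apply, Finset.smul_sum]
  simp only [Finset.smul_sum, h1]
  exact hθ.sum_lie _ _ _

/-- Moving w past d_{ij} costs the even element w ∧ d_{ij}, and w itself then kills V. The remainder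
is the sum that `singular` requires to vanish. -/
lemma odd_smul_nablaOne (hθ : IsNablaFamily θ) (w : Om2) (hw : NonnegOdd w) (v : V) :
    U.odd w • nablaOne θ v = 0 := by
  have h1 (i j : Fin 5) : U.odd w • M.tmulL (U.odd (dd i j)) (θ i j v) =
      M.tmulL 1 ⁅degZero (wedge w (dd i j)), θ i j v⁆ := by
    rw [M.smul_tmulL, eq_sub_of_add_eq (U.odd_mul_odd w (dd i j)), map_sub, LinearMap.sub_apply,
      M.tmulL_mul_odd _ w hw, sub_zero, ← one_mul (U.even _),
      M.tmulL_mul_even _ _ (nonnegEven_wedge w (dd i j) hw)]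
  rw [nablaOne_apply, Finset.smul_sum]
  simp only [Finset.smul_sum, h1, ← map_sum]
  rw [hθ.singular w hw, map_zero]

lemma indRel_le_ker (hθ : IsNablaFamily θ) : indRel V ≤ LinearMap.ker (extend (nablaOne θ)) := by
  refine Submodule.span_le.mpr ?_
  rintro _ (⟨D, v, hD, rfl⟩ | ⟨w, v, hw, rfl⟩)
  · refine LinearMap.mem_ker.mpr ?_
    rw [map_sub, extend_tmul, extend_tmul, one_smul, sub_eq_zero]
    exact even_smul_nablaOne hθ D hD v
  · exact odd_smul_nablaOne hθ w hw v

/-- The morphism `∇ = ∑ d_{ij} ⊗ θ_{ij}`. -/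
noncomputable def nabla (hθ : IsNablaFamily θ) : M V →ₗ[U] M V :=
  (indRel V).liftQ (extend (nablaOne θ)) (indRel_le_ker hθ)

lemma nabla_tmulL (hθ : IsNablaFamily θ) (u : U) (v : V) :
    nabla hθ (M.tmulL u v) = ∑ i, ∑ j, M.tmulL (u * U.odd (dd i j)) (θ i j v) := by
  change u • nablaOne θ v = _
  rw [nablaOne_apply, Finset.smul_sum]
  simp only [Finset.smul_sum, M.smul_tmulL]

lemma isNabla_nabla (hθ : IsNablaFamily θ) : IsNabla θ (nabla hθ) := nabla_tmulL hθ

lemma dd_apply (i j a b : Fin 5) :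
    (dd i j).1 a b = MvPowerSeries.C ((formValue (dd i j)).1 a b) := by
  rw [formValue_dd]; rfl

lemma sum_formValue_dd_smul {Z : Type*} [AddCommGroup Z] [Module ℂ Z] (f : Fin 5 → Fin 5 → Z)
    (hf : ∀ i j, f i j = - f j i) (a b : Fin 5) :
    ∑ i, ∑ j, (formValue (dd i j)).1 a b • f i j = (2 : ℂ) • f a b := by
  simp only [formValue_dd, sum_dd_smul f hf]

/-- The coefficients of the product of two forms with constant coefficients. -/
def wedgeConst (v w : Fin 5 → Fin 5 → ℂ) (i : Fin 5) : ℂ :=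
  v (i + 1) (i + 2) * w (i + 3) (i + 4) - v (i + 1) (i + 3) * w (i + 2) (i + 4)
    + v (i + 1) (i + 4) * w (i + 2) (i + 3) + v (i + 2) (i + 3) * w (i + 1) (i + 4)
    - v (i + 2) (i + 4) * w (i + 1) (i + 3) + v (i + 3) (i + 4) * w (i + 1) (i + 2)

lemma wedge_dd (i j k l : Fin 5) : wedge (dd i j) (dd k l) =
    constField (wedgeConst (formValue (dd i j)).1 (formValue (dd k l)).1) := by
  refine vf_ext fun m => ?_
  rw [vcomp_constField, vcomp_wedge]
  simp only [wedgeComp, wedgeConst, dd_apply, map_add, map_sub, map_mul]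

lemma sum_wedgeConst_smul {Z : Type*} [AddCommGroup Z] [Module ℂ Z] (W : Fin 5 → Fin 5 → ℂ)
    (f : Fin 5 → Fin 5 → Z) (hf : ∀ i j, f i j = - f j i) (m : Fin 5) :
    ∑ i, ∑ j, wedgeConst W (formValue (dd i j)).1 m • f i j =
      (2 : ℂ) • (W (m + 1) (m + 2) • f (m + 3) (m + 4) - W (m + 1) (m + 3) • f (m + 2) (m + 4)
        + W (m + 1) (m + 4) • f (m + 2) (m + 3) + W (m + 2) (m + 3) • f (m + 1) (m + 4)
        - W (m + 2) (m + 4) • f (m + 1) (m + 3) + W (m + 3) (m + 4) • f (m + 1) (m + 2)) := by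
  simp only [wedgeConst, add_smul, sub_smul, mul_smul, Finset.sum_add_distrib,
    Finset.sum_sub_distrib, ← Finset.smul_sum, sum_formValue_dd_smul f hf]
  module

lemma sum_rotate {ι κ Z : Type*} [Fintype ι] [Fintype κ] [AddCommMonoid Z] (F : ι → ι → κ → Z) :
    ∑ i, ∑ j, ∑ k, F i j k = ∑ k, ∑ i, ∑ j, F i j k :=
  (Finset.sum_congr rfl fun _ _ => Finset.sum_comm).trans Finset.sum_comm

/-- The coefficient of ∂_m in d_{ij} ∧ d_{kl} is alternating on the four indices different from m.
Contracting it with θ_{kl} θ_{ij} leaves the Plücker expression in those four indices. -/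
lemma IsNablaFamily.sum_wedge (hθ : IsNablaFamily θ) {Z : Type*} [AddCommGroup Z] [Module ℂ Z]
    (T : S5 →ₗ[ℂ] V →ₗ[ℂ] Z) (v : V) :
    ∑ i, ∑ j, ∑ k, ∑ l, T (wedge (dd i j) (dd k l)) (θ k l (θ i j v)) = 0 := by
  have h1 (i j : Fin 5) : ∑ k, ∑ l, T (wedge (dd i j) (dd k l)) (θ k l (θ i j v)) =
      ∑ m, T (constField (Pi.single m 1))
        (∑ k, ∑ l, wedgeConst (formValue (dd i j)).1 (formValue (dd k l)).1 m •
          θ k l (θ i j v)) := by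
    simp only [map_sum, map_smul]
    rw [← sum_rotate]
    refine Finset.sum_congr rfl fun k _ => Finset.sum_congr rfl fun l _ => ?_
    rw [wedge_dd, LinearMap.pi_apply_eq_sum_univ constField]
    simp only [map_sum, map_smul, LinearMap.sum_apply, LinearMap.smul_apply]
    refine Finset.sum_congr rfl fun m _ => ?_
    congr 3
    refine congrArg constField (funext fun j => ?_)
    rw [Pi.single_apply]
    simp only [eq_comm]
  have h2 (a b c d : Fin 5) : ∑ i, ∑ j, (formValue (dd i j)).1 a b • θ c d (θ i j v) =
      (2 : ℂ) • θ c d (θ a b v) :=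
    sum_formValue_dd_smul (fun i j => θ c d (θ i j v)) (fun i j => by rw [hθ.skew i j, map_neg]) a b
  simp only [h1]
  rw [sum_rotate]
  refine Finset.sum_eq_zero fun m _ => ?_
  simp only [← map_sum]
  rw [← map_zero (T (constField (Pi.single m 1)))]
  congr 1
  simp only [fun i j => sum_wedgeConst_smul (formValue (dd i j)).1 (fun k l => θ k l (θ i j v))
    (fun k l => hθ.skew k l _), ← Finset.smul_sum, Finset.sum_add_distrib, Finset.sum_sub_distrib,
    h2]
  -- Commutation makes the six products three equal pairs, that is, twice the Plücker expression.
  -- The two double sums contribute a factor 2 each, whence 8.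
  have hp := hθ.pluecker (m + 1) (m + 2) (m + 3) (m + 4) v
  rw [hθ.comm (m + 3) (m + 4), hθ.comm (m + 2) (m + 4) (m + 1), hθ.comm (m + 2) (m + 3)]
  linear_combination (norm := module) (8 : ℂ) • hp

lemma sum_pairs_comm {ι Z : Type*} [Fintype ι] [AddCommMonoid Z] (F : ι → ι → ι → ι → Z) :
    ∑ i, ∑ j, ∑ k, ∑ l, F i j k l = ∑ i, ∑ j, ∑ k, ∑ l, F k l i j := by
  rw [sum_rotate (fun i j k => ∑ l, F i j k l)]
  exact Finset.sum_congr rfl fun k _ => sum_rotate (fun i j l => F i j k l)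

/-- Since the θ's commute, exchanging the two pairs of indices exchanges d_{ij} and d_{kl}. Thus 2∇²
involves only the anticommutators of the d's, which are the even elements d_{ij} ∧ d_{kl}. -/
theorem nabla_comp_nabla (hθ : IsNablaFamily θ) : nabla hθ ∘ₗ nabla hθ = 0 := by
  refine LinearMap.ext fun t => ?_
  rw [LinearMap.comp_apply, LinearMap.zero_apply]
  induction t using M.induction with
  | zero => rw [map_zero, map_zero]
  | add t t' h h' => rw [map_add, map_add, h, h', add_zero]
  | tmul u v =>
    have e : nabla hθ (nabla hθ (M.tmulL u v)) = ∑ i, ∑ j, ∑ k, ∑ l,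
        M.tmulL (u * U.odd (dd i j) * U.odd (dd k l)) (θ k l (θ i j v)) := by
      simp only [nabla_tmulL, map_sum]
    have e' : nabla hθ (nabla hθ (M.tmulL u v)) = ∑ i, ∑ j, ∑ k, ∑ l,
        M.tmulL (u * U.odd (dd k l) * U.odd (dd i j)) (θ k l (θ i j v)) := by
      rw [e, sum_pairs_comm]
      refine Finset.sum_congr rfl fun i _ => Finset.sum_congr rfl fun j _ =>
        Finset.sum_congr rfl fun k _ => Finset.sum_congr rfl fun l _ => ?_
      rw [hθ.comm]
    have h : nabla hθ (nabla hθ (M.tmulL u v)) + nabla hθ (nabla hθ (M.tmulL u v)) = 0 := by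
      nth_rw 1 [e]
      rw [e']
      simp only [← Finset.sum_add_distrib, ← LinearMap.map_add₂, mul_assoc, ← mul_add,
        U.odd_mul_odd]
      exact hθ.sum_wedge (M.tmulL ∘ₗ LinearMap.mulLeft ℂ u ∘ₗ U.even) v
    rw [← two_smul ℂ] at h
    exact (smul_eq_zero.mp h).resolve_left two_ne_zero

/-- Vanishing of the singular vector condition, from its cyclic symmetrization. -/
lemma sum_degZero_wedge {Z : Type*} [AddCommGroup Z] [Module ℂ Z]
    (g : Fin 5 → Fin 5 → Matrix (Fin 5) (Fin 5) ℂ →ₗ[ℂ] Z) (hg : ∀ i j A, g i j A = - g j i A)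
    (h : Fin 5 → Fin 5 → Z) (hh : ∀ i j, h i j = - h j i)
    (hc : ∀ i j l k, g i j (Matrix.single k l 1) + g j l (Matrix.single k i 1) +
      g l i (Matrix.single k j 1) = (if k = i then h j l else 0) + (if k = j then h l i else 0) +
        (if k = l then h i j else 0))
    (w : Om2) (hw : NonnegOdd w) : ∑ i, ∑ j, g i j (degZero (wedge w (dd i j))).1 = 0 := by
  have hW (k a b : Fin 5) : coeff (Finsupp.single k 1) (w.1 a b) =
      - coeff (Finsupp.single k 1) (w.1 b a) := by rw [w.2.1 a b, map_neg]
  have hcl (i j k : Fin 5) : coeff (Finsupp.single i 1) (w.1 j k) +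
      coeff (Finsupp.single j 1) (w.1 k i) + coeff (Finsupp.single k 1) (w.1 i j) = 0 := by
    simpa only [map_add, constantCoeff_pderiv, map_zero] using congrArg constantCoeff (w.2.2 i j k)
  generalize hWd : (fun k a b : Fin 5 => coeff (Finsupp.single k 1) (w.1 a b)) = W
  have hWd' (k a b : Fin 5) : coeff (Finsupp.single k 1) (w.1 a b) = W k a b := by rw [← hWd]
  simp only [hWd'] at hW hcl
  -- As w vanishes at the origin, the linear part of w ∧ d_{ij} depends only on the linear part of
  -- w, whose coefficients are `W`.
  have h1 (i j : Fin 5) : g i j (degZero (wedge w (dd i j))).1 = ∑ k, ∑ l,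
      wedgeConst (W k) (formValue (dd i j)).1 l • g i j (Matrix.single k l 1) := by
    conv_lhs => rw [Matrix.matrix_eq_sum_single (degZero (wedge w (dd i j))).1]
    simp only [map_sum]
    refine Finset.sum_congr rfl fun k _ => Finset.sum_congr rfl fun l _ => ?_
    rw [← mul_one ((degZero (wedge w (dd i j))).1 k l), ← smul_eq_mul, ← Matrix.smul_single,
      map_smul, degZero_apply, vcomp_wedge]
    congr 1
    simp only [wedgeComp, wedgeConst, map_add, map_sub, coeff_single_mul, hw _ _, zero_mul,
      zero_add, dd_apply, MvPowerSeries.constantCoeff_C, hWd']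
  simp only [h1]
  rw [sum_rotate]
  simp_rw [sum_rotate (fun i j l => _ • g i j (Matrix.single _ l 1))]
  simp only [sum_wedgeConst_smul _ (fun i j => g i j _) (fun i j => hg i j _), ← Finset.smul_sum]
  -- The indices of W k a b and of g i j (E_{kl}) together exhaust the five values. So each W k a b
  -- multiplies, up to sign, a cyclic sum of g over the three remaining indices, and `hc` allows g i
  -- j (E_{kl}) to be replaced by δ_{kl} h i j.
  have h2 (k : Fin 5) : ∑ l : Fin 5, (
      W k (l + 1) (l + 2) • g (l + 3) (l + 4) (Matrix.single k l 1)
      - W k (l + 1) (l + 3) • g (l + 2) (l + 4) (Matrix.single k l 1)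
      + W k (l + 1) (l + 4) • g (l + 2) (l + 3) (Matrix.single k l 1)
      + W k (l + 2) (l + 3) • g (l + 1) (l + 4) (Matrix.single k l 1)
      - W k (l + 2) (l + 4) • g (l + 1) (l + 3) (Matrix.single k l 1)
      + W k (l + 3) (l + 4) • g (l + 1) (l + 2) (Matrix.single k l 1)) =
      ∑ l : Fin 5, (
      (if k = l then 1 else 0 : ℂ) • W k (l + 1) (l + 2) • h (l + 3) (l + 4)
      - (if k = l then 1 else 0 : ℂ) • W k (l + 1) (l + 3) • h (l + 2) (l + 4)
      + (if k = l then 1 else 0 : ℂ) • W k (l + 1) (l + 4) • h (l + 2) (l + 3)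
      + (if k = l then 1 else 0 : ℂ) • W k (l + 2) (l + 3) • h (l + 1) (l + 4)
      - (if k = l then 1 else 0 : ℂ) • W k (l + 2) (l + 4) • h (l + 1) (l + 3)
      + (if k = l then 1 else 0 : ℂ) • W k (l + 3) (l + 4) • h (l + 1) (l + 2)) := by
    have hc' (i j l : Fin 5) : g i j (Matrix.single k l 1) + g j l (Matrix.single k i 1) +
        g l i (Matrix.single k j 1) = (if k = i then 1 else 0 : ℂ) • h j l +
          (if k = j then 1 else 0 : ℂ) • h l i + (if k = l then 1 else 0 : ℂ) • h i j := by
      rw [hc]; simp only [ite_smul, one_smul, zero_smul]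
    simp only [Fin.sum_univ_five, Fin.reduceAdd, zero_add]
    simp only [hW k 2 0, hW k 3 0, hW k 4 0, hW k 3 1, hW k 4 1, hW k 4 2]
    have k1 := hc' 0 1 2
    have k2 := hc' 0 1 3
    have k3 := hc' 0 1 4
    have k4 := hc' 0 2 3
    have k5 := hc' 0 2 4
    have k6 := hc' 0 3 4
    have k7 := hc' 1 2 3
    have k8 := hc' 1 2 4
    have k9 := hc' 1 3 4
    have k10 := hc' 2 3 4
    simp only [hg 2 0, hg 3 0, hg 4 0, hg 3 1, hg 4 1, hg 4 2] at *
    simp only [hh 2 0, hh 3 0, hh 4 0, hh 3 1, hh 4 1, hh 4 2] at *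
    linear_combination (norm := module) W k 3 4 • k1 - W k 2 4 • k2 + W k 2 3 • k3 + W k 1 4 • k4 - W k 1 3 • k5
      + W k 1 2 • k6 - W k 0 4 • k7 + W k 0 3 • k8 - W k 0 2 • k9 + W k 0 1 • k10
  simp only [h2, ite_smul, one_smul, zero_smul, Finset.sum_add_distrib,
    Finset.sum_sub_distrib, Finset.sum_ite_eq, Finset.mem_univ, if_true]
  simp only [Fin.sum_univ_five, Fin.reduceAdd, zero_add]
  -- Only k = l is left, and h c d is multiplied by the cyclic sum of W over the other three
  -- indices, which is zero because w is closed. The rewriting form eliminates W i j k for i < j <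
  -- k.
  have hcl' (i j k : Fin 5) : W i j k = W j i k - W k i j := by
    linear_combination hcl i j k - hW j k i
  simp only [hh 2 0, hh 3 0, hh 4 0, hh 3 1, hh 4 1, hh 4 2]
  simp only [hW _ 2 0, hW _ 3 0, hW _ 4 0, hW _ 3 1, hW _ 4 1, hW _ 4 2]
  simp only [hcl' 0 1 2, hcl' 0 1 3, hcl' 0 1 4, hcl' 0 2 3, hcl' 0 2 4, hcl' 0 3 4, hcl' 1 2 3,
    hcl' 1 2 4, hcl' 1 3 4, hcl' 2 3 4]
  module

end Nabla

end E510

namespace E510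

open MvPolynomial

/-! ### The Fischer inner product -/

section Fischer

variable {σ : Type*}

/-- The Fischer inner product on polynomials: monomials are orthogonal, and the squared norm of
`x ^ α` is `α!`. It is linear in the second argument here. -/
noncomputable def fischer (g : MvPolynomial σ ℂ) : MvPolynomial σ ℂ →ₗ[ℂ] ℂ :=
  (basisMonomials σ ℂ).constr ℂ
    fun α => (α.prod fun _ k => (k.factorial : ℂ)) * starRingEnd ℂ (coeff α g)

lemma fischer_monomial (g : MvPolynomial σ ℂ) (α : σ →₀ ℕ) (c : ℂ) :
    fischer g (monomial α c) =
      c * ((α.prod fun _ k => (k.factorial : ℂ)) * starRingEnd ℂ (coeff α g)) := by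
  have h := (basisMonomials σ ℂ).constr_basis ℂ
    (fun α => (α.prod fun _ k => (k.factorial : ℂ)) * starRingEnd ℂ (coeff α g)) α
  rw [coe_basisMonomials] at h
  rw [← mul_one c, ← smul_eq_mul, ← smul_monomial, map_smul, fischer, h]
  simp

lemma fischer_add_left (g g' f : MvPolynomial σ ℂ) :
    fischer (g + g') f = fischer g f + fischer g' f := by
  induction f using MvPolynomial.induction_on' with
  | monomial α c => simp only [fischer_monomial, coeff_add, map_add]; ring
  | add p q hp hq => simp only [map_add, hp, hq]; ring

lemma fischer_smul_left (c : ℂ) (g f : MvPolynomial σ ℂ) :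
    fischer (c • g) f = starRingEnd ℂ c * fischer g f := by
  induction f using MvPolynomial.induction_on' with
  | monomial α a => simp only [fischer_monomial, coeff_smul, smul_eq_mul, map_mul]; ring
  | add p q hp hq => simp only [map_add, hp, hq]; ring

lemma fischer_zero_left (f : MvPolynomial σ ℂ) : fischer 0 f = 0 := by
  have := fischer_smul_left 0 0 f
  simpa using this

lemma fischer_sum_left {ι : Type*} (s : Finset ι) (g : ι → MvPolynomial σ ℂ)
    (f : MvPolynomial σ ℂ) : fischer (∑ i ∈ s, g i) f = ∑ i ∈ s, fischer (g i) f := by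
  classical
  induction s using Finset.induction_on with
  | empty => exact fischer_zero_left f
  | insert a s ha ih => rw [Finset.sum_insert ha, Finset.sum_insert ha, fischer_add_left, ih]

lemma fischer_conj (f g : MvPolynomial σ ℂ) : starRingEnd ℂ (fischer f g) = fischer g f := by
  induction g using MvPolynomial.induction_on' with
  | monomial α a =>
    induction f using MvPolynomial.induction_on' with
    | monomial β b =>
      classical
      simp only [fischer_monomial, coeff_monomial]
      by_cases h : α = β
      · subst h
        simp only [Finsupp.prod, if_true, map_mul, map_prod, Complex.conj_natCast, Complex.conj_conj]
        ring
      · simp [h, Ne.symm h]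
    | add p q hp hq => rw [fischer_add_left, map_add, map_add, hp, hq]
  | add p q hp hq => rw [map_add, map_add, fischer_add_left, hp, hq]

lemma fischer_eq_sum (g f : MvPolynomial σ ℂ) : fischer g f = ∑ α ∈ f.support,
    coeff α f * ((α.prod fun _ k => (k.factorial : ℂ)) * starRingEnd ℂ (coeff α g)) := by
  conv_lhs => rw [f.as_sum, map_sum]
  simp only [fischer_monomial]

lemma fischer_eq_zero_of_forall {f g : MvPolynomial σ ℂ}
    (h : ∀ α, coeff α f ≠ 0 → coeff α g = 0) : fischer g f = 0 := by
  rw [fischer_eq_sum]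
  refine Finset.sum_eq_zero fun α hα => ?_
  rw [h α (mem_support_iff.mp hα)]; simp

/-- The value is ∑ α! |f_α|², a sum of nonnegative terms with positive weights. -/
lemma fischer_self_eq_zero {f : MvPolynomial σ ℂ} (h : fischer f f = 0) : f = 0 := by
  have hs : ∑ α ∈ f.support, ((α.prod fun _ k => (k.factorial : ℝ)) * Complex.normSq (coeff α f))
      = 0 := by
    have : ((∑ α ∈ f.support, ((α.prod fun _ k => (k.factorial : ℝ)) *
        Complex.normSq (coeff α f)) : ℝ) : ℂ) = 0 := by
      rw [← h, fischer_eq_sum]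
      push_cast
      refine Finset.sum_congr rfl fun α _ => ?_
      rw [← Complex.mul_conj]
      simp only [Finsupp.prod]
      push_cast
      ring
    exact_mod_cast this
  have hpos (α : σ →₀ ℕ) : 0 < α.prod fun _ k => (k.factorial : ℝ) :=
    Finset.prod_pos fun i _ => by positivity
  rw [Finset.sum_eq_zero_iff_of_nonneg fun α _ =>
    mul_nonneg (hpos α).le (Complex.normSq_nonneg _)] at hs
  by_contra hf
  obtain ⟨α, hα⟩ := Finset.nonempty_iff_ne_empty.mpr (mt support_eq_empty.mp hf)
  have := (mul_eq_zero.mp (hs α hα)).resolve_left (hpos α).ne'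
  exact (mem_support_iff.mp hα) (Complex.normSq_eq_zero.mp this)

/-- Operators that are adjoint for the Fischer inner product. -/
def IsFischerAdj (S T : MvPolynomial σ ℂ →ₗ[ℂ] MvPolynomial σ ℂ) : Prop :=
  ∀ f g, fischer g (S f) = fischer (T g) f

lemma ext_fischer {f g : MvPolynomial σ ℂ} (h : ∀ p, fischer f p = fischer g p) : f = g := by
  rw [← sub_eq_zero]
  refine fischer_self_eq_zero ?_
  rw [sub_eq_add_neg, ← neg_one_smul ℂ g, fischer_add_left, fischer_smul_left, h]
  simp

namespace IsFischerAdj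

variable {S S' T T' : MvPolynomial σ ℂ →ₗ[ℂ] MvPolynomial σ ℂ}

lemma symm (h : IsFischerAdj S T) : IsFischerAdj T S := fun f g => by
  rw [← fischer_conj, ← h, fischer_conj]

lemma add (h : IsFischerAdj S T) (h' : IsFischerAdj S' T') : IsFischerAdj (S + S') (T + T') :=
  fun f g => by
    rw [LinearMap.add_apply, LinearMap.add_apply, map_add, fischer_add_left, h, h']

lemma smul (c : ℂ) (h : IsFischerAdj S T) : IsFischerAdj (c • S) (starRingEnd ℂ c • T) :=
  fun f g => by
    rw [LinearMap.smul_apply, LinearMap.smul_apply, map_smul, fischer_smul_left, h]; simp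

lemma neg (h : IsFischerAdj S T) : IsFischerAdj (-S) (-T) := fun f g => by
  rw [LinearMap.neg_apply, LinearMap.neg_apply, map_neg, h, ← neg_one_smul ℂ (T g),
    fischer_smul_left]
  simp

lemma sub (h : IsFischerAdj S T) (h' : IsFischerAdj S' T') : IsFischerAdj (S - S') (T - T') := by
  simpa only [sub_eq_add_neg] using h.add h'.neg

lemma zero : IsFischerAdj (0 : MvPolynomial σ ℂ →ₗ[ℂ] MvPolynomial σ ℂ) 0 := fun f g => by
  simp [fischer_zero_left]

lemma sum {ι : Type*} (s : Finset ι) {S T : ι → MvPolynomial σ ℂ →ₗ[ℂ] MvPolynomial σ ℂ}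
    (h : ∀ i, IsFischerAdj (S i) (T i)) : IsFischerAdj (∑ i ∈ s, S i) (∑ i ∈ s, T i) := by
  classical
  induction s using Finset.induction_on with
  | empty => exact zero
  | insert a s ha ih => rw [Finset.sum_insert ha, Finset.sum_insert ha]; exact (h a).add ih

lemma comp (h : IsFischerAdj S T) (h' : IsFischerAdj S' T') :
    IsFischerAdj (S ∘ₗ S') (T' ∘ₗ T) := fun f g => by
  rw [LinearMap.comp_apply, h, h', LinearMap.comp_apply]

lemma unique (h : IsFischerAdj S T) (h' : IsFischerAdj S T') : T = T' :=
  LinearMap.ext fun g => ext_fischer fun f => by rw [← h, h']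

end IsFischerAdj

/-- On monomials this is (α + e_i)! = (α_i + 1) α!, the factor also produced by differentiation. It
is the reason for the factorials in the inner product. -/
lemma isFischerAdj_X (i : σ) :
    IsFischerAdj (LinearMap.mulLeft ℂ (X i)) (pderiv (R := ℂ) i).toLinearMap := fun f g => by
  induction f using MvPolynomial.induction_on' with
  | monomial α c =>
    classical
    have e₁ : LinearMap.mulLeft ℂ (X i) (monomial α c) = monomial (α + Finsupp.single i 1) c := by
      rw [LinearMap.mulLeft_apply, mul_comm, X, monomial_mul, mul_one]
    have e₂ : (pderiv (R := ℂ) i).toLinearMap g = pderiv i g := rfl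
    rw [e₁, e₂, fischer_monomial,
      fischer_monomial, coeff_pderiv]
    have h : ((α + Finsupp.single i 1).prod fun _ k => (k.factorial : ℂ)) =
        (α i + 1) * α.prod fun _ k => (k.factorial : ℂ) := by
      have e (β : σ →₀ ℕ) : (β.prod fun _ k => (k.factorial : ℂ)) =
          (β i).factorial * (β.erase i).prod fun _ k => (k.factorial : ℂ) := by
        by_cases hi : i ∈ β.support
        · rw [Finsupp.mul_prod_erase β i (fun _ k => (k.factorial : ℂ)) hi]
        · rw [Finsupp.notMem_support_iff.mp hi, Finsupp.erase_of_notMem_support hi]; simp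
      rw [e, e α]
      simp [Finsupp.erase_add, Finsupp.erase_single, Nat.factorial_succ, mul_assoc]
    rw [h]
    simp only [map_mul, map_add, Complex.conj_natCast, map_one]
    ring
  | add p q hp hq => rw [map_add, map_add, map_add, hp, hq]

end Fischer

end E510

namespace E510

open MvPolynomial

/-! ### The invariant complement of the highest component -/

/-- The conjugate transpose on `sl₅`. -/
noncomputable def sl5.conj (A : sl5) : sl5 :=
  ⟨A.1.conjTranspose, by
    have h : Matrix.trace A.1 = 0 := A.2
    change Matrix.trace A.1.conjTranspose = 0
    rw [Matrix.trace_conjTranspose, h, star_zero]⟩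

lemma sl5.conj_apply (A : sl5) (i j : Fin 5) : (sl5.conj A).1 i j = starRingEnd ℂ (A.1 j i) := rfl

lemma sl5.conj_conj (A : sl5) : sl5.conj (sl5.conj A) = A :=
  Subtype.ext (Matrix.conjTranspose_conjTranspose A.1)

section Low

variable {σ : Type*} [LieRingModule sl5 (MvPolynomial σ ℂ)]

/-- The Fischer inner product is contravariant. -/
def IsUnitaryAction (σ : Type*) [LieRingModule sl5 (MvPolynomial σ ℂ)] : Prop :=
  ∀ (A : sl5) (f g : MvPolynomial σ ℂ), fischer g ⁅A, f⁆ = fischer ⁅sl5.conj A, g⁆ f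

/-- A bigraded unitary action of `sl₅` on polynomials, and monomials that are separated in each
bidegree by the eigenvalues of a diagonal element of `sl₅`. -/
structure IsHighestFamily (wt : σ → ℕ × ℕ) (α : ℕ → ℕ → σ →₀ ℕ) : Prop where
  unitary : IsUnitaryAction σ
  homogeneous : ∀ (A : sl5) p (f : MvPolynomial σ ℂ),
    IsWeightedHomogeneous wt f p → IsWeightedHomogeneous wt ⁅A, f⁆ p
  weight : ∀ m n, Finsupp.weight wt (α m n) = (m, n)
  separated : ∃ (H : sl5) (χ : (σ →₀ ℕ) → ℂ),
    (∀ β, ⁅H, (monomial β 1 : MvPolynomial σ ℂ)⁆ = χ β • monomial β 1) ∧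
    ∀ m n β, Finsupp.weight wt β = (m, n) → χ β = χ (α m n) → β = α m n

variable {wt : σ → ℕ × ℕ} {α : ℕ → ℕ → σ →₀ ℕ}

/-- The submodule orthogonal to a submodule. -/
noncomputable def orthogonal (h : IsUnitaryAction σ) (N : LieSubmodule ℂ sl5 (MvPolynomial σ ℂ)) :
    LieSubmodule ℂ sl5 (MvPolynomial σ ℂ) where
  carrier := {f | ∀ g ∈ N, fischer g f = 0}
  zero_mem' g _ := map_zero _
  add_mem' hf hf' g hg := by rw [map_add, hf g hg, hf' g hg, add_zero]
  smul_mem' c f hf g hg := by rw [map_smul, hf g hg, smul_zero]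
  lie_mem {A f} hf g hg := by rw [h]; exact hf _ (N.lie_mem hg)

/-- The homogeneous polynomials as a submodule. -/
noncomputable def homogeneousPart (h : IsHighestFamily wt α) (p : ℕ × ℕ) :
    LieSubmodule ℂ sl5 (MvPolynomial σ ℂ) where
  toSubmodule := weightedHomogeneousSubmodule ℂ wt p
  lie_mem {A f} hf := h.homogeneous A p f hf

lemma lieSpan_le_homogeneousPart (h : IsHighestFamily wt α) (m n : ℕ) :
    LieSubmodule.lieSpan ℂ sl5 {(monomial (α m n) 1 : MvPolynomial σ ℂ)} ≤
      homogeneousPart h (m, n) := by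
  rw [LieSubmodule.lieSpan_le, Set.singleton_subset_iff]
  exact isWeightedHomogeneous_monomial _ _ _ (h.weight m n)

variable [LieModule ℂ sl5 (MvPolynomial σ ℂ)]

/-- A submodule of a homogeneous component that contains a polynomial in which the highest monomial
occurs contains this monomial. -/
lemma IsHighestFamily.monomial_mem (h : IsHighestFamily wt α) {m n : ℕ}
    {N : LieSubmodule ℂ sl5 (MvPolynomial σ ℂ)}
    (hN : (N : Submodule ℂ (MvPolynomial σ ℂ)) ≤ weightedHomogeneousSubmodule ℂ wt (m, n))
    {f : MvPolynomial σ ℂ} (hf : f ∈ N) (hc : coeff (α m n) f ≠ 0) : monomial (α m n) 1 ∈ N := by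
  classical
  obtain ⟨H, χ, hH, hχ⟩ := h.separated
  have hH' (f : MvPolynomial σ ℂ) (β) : coeff β ⁅H, f⁆ = χ β * coeff β f := by
    induction f using MvPolynomial.induction_on' with
    | monomial γ a =>
      rw [← mul_one a, ← smul_eq_mul, ← smul_monomial, lie_smul, hH]
      simp only [coeff_smul, coeff_monomial, smul_eq_mul]
      split_ifs with h
      · rw [h]; ring
      · simp
    | add p q hp hq => rw [lie_add, coeff_add, coeff_add, hp, hq, mul_add]
  -- If another monomial β occurs in f, then H − χ(β) removes it and adds no new one. It multiplies
  -- the coefficient of the highest monomial by a nonzero number, since H separates the two. So the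
  -- support shrinks until only the highest monomial is left.
  induction hk : f.support.card using Nat.strong_induction_on generalizing f with
  | _ k ih =>
    by_cases hs : ∃ β ∈ f.support, β ≠ α m n
    · obtain ⟨β, hβ, hne⟩ := hs
      have hco (γ) : coeff γ (⁅H, f⁆ - χ β • f) = (χ γ - χ β) * coeff γ f := by
        rw [coeff_sub, hH', coeff_smul, smul_eq_mul]; ring
      refine ih _ ?_ (f := ⁅H, f⁆ - χ β • f) (N.sub_mem (N.lie_mem hf) (N.smul_mem _ hf)) ?_ rfl
      · rw [← hk]
        refine Finset.card_lt_card (Finset.ssubset_iff_subset_ne.mpr ⟨fun γ hγ => ?_, fun he => ?_⟩)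
        · rw [mem_support_iff, hco] at hγ
          exact mem_support_iff.mpr (right_ne_zero_of_mul hγ)
        · rw [← he, mem_support_iff, hco, sub_self, zero_mul] at hβ
          exact hβ rfl
      · rw [hco]
        refine mul_ne_zero (sub_ne_zero.mpr fun he => hne ?_) hc
        exact hχ m n β (hN hf (mem_support_iff.mp hβ)) he.symm
    · push Not at hs
      have hfe : f = coeff (α m n) f • monomial (α m n) 1 := by
        ext γ
        rw [coeff_smul, coeff_monomial, smul_eq_mul]
        split_ifs with he
        · rw [he, mul_one]
        · rw [mul_zero]
          by_contra hne
          exact he (hs γ (mem_support_iff.mpr hne)).symm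
      rw [hfe] at hf
      have := N.smul_mem (coeff (α m n) f)⁻¹ hf
      rwa [smul_smul, inv_mul_cancel₀ hc, one_smul] at this

/-- The sum of the invariant complements is the orthogonal complement of the sum of the highest
components. -/
theorem iSup_low_eq_orthogonal (h : IsHighestFamily wt α)
    (high low : ℕ → ℕ → LieSubmodule ℂ sl5 (MvPolynomial σ ℂ))
    (hhigh : ∀ m n, high m n = LieSubmodule.lieSpan ℂ sl5 {monomial (α m n) 1})
    (hlow : ∀ m n, low m n = sSup {N : LieSubmodule ℂ sl5 (MvPolynomial σ ℂ) |
      (N : Submodule ℂ (MvPolynomial σ ℂ)) ≤ weightedHomogeneousSubmodule ℂ wt (m, n) ∧ Disjoint N (high m n)}) :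
    ⨆ (m : ℕ) (n : ℕ), low m n = orthogonal h.unitary (⨆ (m : ℕ) (n : ℕ), high m n) := by
  classical
  have horth {f : MvPolynomial σ ℂ} : f ∈ orthogonal h.unitary (⨆ (m : ℕ) (n : ℕ), high m n) ↔
      ∀ m n, ∀ g ∈ high m n, fischer g f = 0 := by
    refine ⟨fun hf m n g hg => hf g (le_iSup₂ (f := high) m n hg), fun hf => ?_⟩
    -- By symmetry of orthogonality, the condition on the supremum becomes an inclusion into one
    -- submodule, which can be tested on each `high m n`.
    have : (⨆ (m : ℕ) (n : ℕ), high m n) ≤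
        orthogonal h.unitary (LieSubmodule.lieSpan ℂ sl5 {f}) := by
      refine iSup₂_le fun m n g hg => ?_
      have hle : LieSubmodule.lieSpan ℂ sl5 {f} ≤ orthogonal h.unitary (high m n) := by
        rw [LieSubmodule.lieSpan_le, Set.singleton_subset_iff]
        exact hf m n
      intro p hp
      rw [← fischer_conj, hle hp g hg, map_zero]
    intro g hg
    rw [← fischer_conj, this hg f (LieSubmodule.subset_lieSpan rfl), map_zero]
  have hhom (m n : ℕ) {g : MvPolynomial σ ℂ} (hg : g ∈ high m n) :
      IsWeightedHomogeneous wt g (m, n) := by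
    rw [hhigh] at hg
    exact lieSpan_le_homogeneousPart h m n hg
  refine le_antisymm (iSup₂_le fun m n => ?_) fun f hf => ?_
  · rw [hlow]
    refine sSup_le fun N ⟨hN, hd⟩ f hf => horth.mpr fun m' n' g hg => ?_
    by_cases hmn : (m, n) = (m', n')
    · obtain ⟨rfl, rfl⟩ := Prod.mk.inj hmn
      -- A polynomial of N containing the highest monomial would put the generator of `high m n`
      -- into N, against disjointness. So the generator is orthogonal to N, and by contravariance
      -- the submodule it generates is as well.
      have hle : high m n ≤ orthogonal h.unitary N := by
        rw [hhigh, LieSubmodule.lieSpan_le, Set.singleton_subset_iff]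
        intro p hp
        rw [fischer_monomial]
        by_cases hc : coeff (α m n) p = 0
        · rw [hc]; simp
        · have hmem : (monomial (α m n) 1 : MvPolynomial σ ℂ) ∈ N ⊓ high m n :=
            ⟨h.monomial_mem hN hp hc, by rw [hhigh]; exact LieSubmodule.subset_lieSpan rfl⟩
          rw [hd.eq_bot, LieSubmodule.mem_bot, monomial_eq_zero] at hmem
          exact absurd hmem one_ne_zero
      rw [← fischer_conj, hle hg f hf, map_zero]
    -- Different bidegrees have no monomial in common.
    · refine fischer_eq_zero_of_forall fun β hβ => ?_
      exact (hhom m' n' hg).coeff_eq_zero β fun he => hmn ((hN hf hβ).symm.trans he)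
  -- Conversely, each bihomogeneous component of f is orthogonal to `high m n`. The homogeneous
  -- polynomials with this property form a submodule that meets `high m n` trivially by
  -- definiteness, so it is one of those whose supremum is `low m n`. Complete reducibility is not
  -- needed.
  · have hcomp (p : ℕ × ℕ) : weightedHomogeneousComponent wt p f ∈
        ⨆ (m : ℕ) (n : ℕ), low m n := by
      obtain ⟨m, n⟩ := p
      refine le_iSup₂ (f := low) m n ?_
      rw [hlow]
      have hle : homogeneousPart h (m, n) ⊓ orthogonal h.unitary (high m n) ≤
          sSup {N : LieSubmodule ℂ sl5 (MvPolynomial σ ℂ) |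
            (N : Submodule ℂ (MvPolynomial σ ℂ)) ≤ weightedHomogeneousSubmodule ℂ wt (m, n) ∧
              Disjoint N (high m n)} := by
        refine le_sSup ⟨fun p hp => hp.1, ?_⟩
        rw [disjoint_iff, LieSubmodule.eq_bot_iff]
        rintro p ⟨⟨-, hp⟩, hp'⟩
        exact fischer_self_eq_zero (hp p hp')
      refine hle ⟨weightedHomogeneousComponent_isWeightedHomogeneous _ _, ?_⟩
      intro g hg
      have e : fischer g f = fischer g (weightedHomogeneousComponent wt (m, n) f) := by
        rw [← sub_eq_zero, ← map_sub]
        refine fischer_eq_zero_of_forall fun β hβ => ?_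
        refine (hhom m n hg).coeff_eq_zero β fun he => hβ ?_
        rw [coeff_sub, coeff_weightedHomogeneousComponent, if_pos he, sub_self]
      rw [← e]
      exact horth.mp hf m n g hg
    rw [← sum_weightedHomogeneousComponent wt f]
    exact finsum_induction (· ∈ ⨆ (m : ℕ) (n : ℕ), low m n) (zero_mem _)
      (fun _ _ => add_mem) hcomp

end Low

end E510

namespace E510

open MvPolynomial

/-! ### Equivariant families of operators -/

section Families

variable {V : Type*} [AddCommGroup V] [Module ℂ V] [LieRingModule sl5 V]

/-- The operators `ξᵢ` span a representation of `sl₅` with matrix coefficients `c`. -/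
def IsVectorFamily (c : sl5 → Fin 5 → Fin 5 → ℂ) (ξ : Fin 5 → V →ₗ[ℂ] V) : Prop :=
  ∀ A i v, ⁅A, ξ i v⁆ = ξ i ⁅A, v⁆ + ∑ b, c A i b • ξ b v

/-- The operators `θᵢⱼ` transform as the square of the representation with matrix coefficients
`c`. -/
def IsTensorFamily (c : sl5 → Fin 5 → Fin 5 → ℂ) (θ : Fin 5 → Fin 5 → V →ₗ[ℂ] V) : Prop :=
  ∀ A i j v, ⁅A, θ i j v⁆ = θ i j ⁅A, v⁆ + ∑ b, (c A i b • θ b j v + c A j b • θ i b v)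

/-- The matrix coefficients of the standard representation. -/
def stdCoeff (A : sl5) (i b : Fin 5) : ℂ := A.1 b i

/-- The matrix coefficients of the dual of the standard representation. -/
def dualCoeff (A : sl5) (i b : Fin 5) : ℂ := - A.1 i b

variable {c : sl5 → Fin 5 → Fin 5 → ℂ} {θ : Fin 5 → Fin 5 → V →ₗ[ℂ] V} {ξ ζ : Fin 5 → V →ₗ[ℂ] V}

lemma IsVectorFamily.wedge (hζ : IsVectorFamily c ζ) (hξ : IsVectorFamily c ξ) :
    IsTensorFamily c fun i j => ζ i ∘ₗ ξ j - ζ j ∘ₗ ξ i := by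
  intro A i j v
  simp only [LinearMap.sub_apply, LinearMap.comp_apply, lie_sub, hζ A, hξ A, map_add, map_sum,
    map_smul, smul_sub, Finset.sum_add_distrib, Finset.sum_sub_distrib]
  abel

/-- The vectors that are mapped to a given submodule by all operators of a family. -/
def IsTensorFamily.comap (hθ : IsTensorFamily c θ) (W : LieSubmodule ℂ sl5 V) :
    LieSubmodule ℂ sl5 V where
  carrier := {v | ∀ i j, θ i j v ∈ W}
  zero_mem' i j := by rw [map_zero]; exact W.zero_mem
  add_mem' hv hw i j := by rw [map_add]; exact W.add_mem (hv i j) (hw i j)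
  smul_mem' a v hv i j := by rw [map_smul]; exact W.smul_mem a (hv i j)
  lie_mem {A v} hv i j := by
    rw [← sub_eq_of_eq_add (hθ A i j v)]
    exact W.sub_mem (W.lie_mem (hv i j)) (W.sum_mem fun b _ =>
      W.add_mem (W.smul_mem _ (hv b j)) (W.smul_mem _ (hv i b)))

/-- The Plücker relations between the operators of a family. -/
def pluecker (θ : Fin 5 → Fin 5 → V →ₗ[ℂ] V) (i j k l : Fin 5) : V →ₗ[ℂ] V :=
  θ i j ∘ₗ θ k l - θ i k ∘ₗ θ j l + θ i l ∘ₗ θ j k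

lemma IsTensorFamily.lie_pluecker (hθ : IsTensorFamily c θ) (A : sl5) (i j k l : Fin 5) (v : V) :
    ⁅A, pluecker θ i j k l v⁆ = pluecker θ i j k l ⁅A, v⁆ +
      ∑ b, (c A i b • pluecker θ b j k l v + c A j b • pluecker θ i b k l v +
        c A k b • pluecker θ i j b l v + c A l b • pluecker θ i j k b v) := by
  simp only [pluecker, LinearMap.sub_apply, LinearMap.add_apply, LinearMap.comp_apply, lie_sub,
    lie_add, hθ A, map_add, map_sum, map_smul, smul_sub, smul_add, Finset.sum_add_distrib,
    Finset.sum_sub_distrib]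
  abel

/-- The vectors on which the Plücker relations hold. -/
def IsTensorFamily.plueckerKer (hθ : IsTensorFamily c θ) : LieSubmodule ℂ sl5 V where
  carrier := {v | ∀ i j k l, pluecker θ i j k l v = 0}
  zero_mem' i j k l := map_zero _
  add_mem' hv hw i j k l := by rw [map_add, hv i j k l, hw i j k l, add_zero]
  smul_mem' a v hv i j k l := by rw [map_smul, hv i j k l, smul_zero]
  lie_mem {A v} hv i j k l := by
    rw [← sub_eq_of_eq_add (hθ.lie_pluecker A i j k l v), hv i j k l, lie_zero, zero_sub,
      neg_eq_zero]
    refine Finset.sum_eq_zero fun b _ => ?_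
    rw [hv b, hv i, hv i, hv i]; simp

/-- The incidence relations between two families. -/
def incidence (ξ : Fin 5 → V →ₗ[ℂ] V) (θ : Fin 5 → Fin 5 → V →ₗ[ℂ] V) (i j k : Fin 5) :
    V →ₗ[ℂ] V :=
  ξ i ∘ₗ θ j k + ξ j ∘ₗ θ k i + ξ k ∘ₗ θ i j

lemma IsTensorFamily.lie_incidence (hθ : IsTensorFamily c θ) (hξ : IsVectorFamily c ξ) (A : sl5)
    (i j k : Fin 5) (v : V) :
    ⁅A, incidence ξ θ i j k v⁆ = incidence ξ θ i j k ⁅A, v⁆ +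
      ∑ b, (c A i b • incidence ξ θ b j k v + c A j b • incidence ξ θ i b k v +
        c A k b • incidence ξ θ i j b v) := by
  simp only [incidence, LinearMap.add_apply, LinearMap.comp_apply,
    lie_add, hθ A, hξ A, map_add, map_sum, map_smul, smul_add, Finset.sum_add_distrib]
  abel

/-- The vectors on which the incidence relations hold. -/
def IsTensorFamily.incidenceKer (hθ : IsTensorFamily c θ) (hξ : IsVectorFamily c ξ) :
    LieSubmodule ℂ sl5 V where
  carrier := {v | ∀ i j k, incidence ξ θ i j k v = 0}
  zero_mem' i j k := map_zero _
  add_mem' hv hw i j k := by rw [map_add, hv i j k, hw i j k, add_zero]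
  smul_mem' a v hv i j k := by rw [map_smul, hv i j k, smul_zero]
  lie_mem {A v} hv i j k := by
    rw [← sub_eq_of_eq_add (hθ.lie_incidence hξ A i j k v), hv i j k, lie_zero, zero_sub,
      neg_eq_zero]
    refine Finset.sum_eq_zero fun b _ => ?_
    rw [hv b, hv i, hv i]; simp

end Families

/-! ### Adjoint families and orthogonal complements -/

section Adjoint

variable {σ : Type*} [LieRingModule sl5 (MvPolynomial σ ℂ)]
  {c : sl5 → Fin 5 → Fin 5 → ℂ}

/-- The matrix coefficients of the dual representation. -/
noncomputable def adjCoeff (c : sl5 → Fin 5 → Fin 5 → ℂ) (A : sl5) (i b : Fin 5) : ℂ :=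
  - starRingEnd ℂ (c (sl5.conj A) i b)

lemma adjCoeff_stdCoeff : adjCoeff stdCoeff = dualCoeff := by
  funext A i b; simp [adjCoeff, stdCoeff, dualCoeff, sl5.conj_apply]

lemma adjCoeff_dualCoeff : adjCoeff dualCoeff = stdCoeff := by
  funext A i b; simp [adjCoeff, stdCoeff, dualCoeff, sl5.conj_apply]

/-- Taking adjoints of the commutation rule for the conjugate transpose of A reverses the commutator
and conjugates the coefficients, which gives the dual representation. The rule for derivatives thus
follows from the one for multiplications. -/
lemma IsVectorFamily.adj (h : IsUnitaryAction σ)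
    {ξ ξ' : Fin 5 → MvPolynomial σ ℂ →ₗ[ℂ] MvPolynomial σ ℂ}
    (hξ : IsVectorFamily c ξ) (ha : ∀ i, IsFischerAdj (ξ i) (ξ' i)) :
    IsVectorFamily (adjCoeff c) ξ' := by
  intro A i f
  refine ext_fischer fun p => ?_
  have h1 := congrArg (fischer f) (hξ (sl5.conj A) i p)
  rw [h, sl5.conj_conj, ha i, map_add, ha i, h, sl5.conj_conj, map_sum] at h1
  simp only [map_smul, ha _ p, smul_eq_mul] at h1
  rw [fischer_add_left, h1, fischer_sum_left, add_assoc, ← Finset.sum_add_distrib,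
    Finset.sum_eq_zero, add_zero]
  intro b _
  rw [fischer_smul_left, adjCoeff, map_neg, Complex.conj_conj]
  ring

lemma IsTensorFamily.adj (h : IsUnitaryAction σ)
    {θ θ' : Fin 5 → Fin 5 → MvPolynomial σ ℂ →ₗ[ℂ] MvPolynomial σ ℂ}
    (hθ : IsTensorFamily c θ) (ha : ∀ i j, IsFischerAdj (θ i j) (θ' i j)) :
    IsTensorFamily (adjCoeff c) θ' := by
  intro A i j f
  refine ext_fischer fun p => ?_
  have h1 := congrArg (fischer f) (hθ (sl5.conj A) i j p)
  rw [h, sl5.conj_conj, ha i j, map_add, ha i j, h, sl5.conj_conj, map_sum] at h1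
  simp only [map_add, map_smul, ha _ _ p, smul_eq_mul] at h1
  rw [fischer_add_left, h1, fischer_sum_left, add_assoc, ← Finset.sum_add_distrib,
    Finset.sum_eq_zero, add_zero]
  intro b _
  rw [fischer_add_left, fischer_smul_left, fischer_smul_left, adjCoeff, adjCoeff, map_neg, map_neg,
    Complex.conj_conj, Complex.conj_conj]
  ring

/-- Operators whose adjoints preserve a submodule preserve its orthogonal complement. -/
lemma mem_orthogonal_of_isFischerAdj {h : IsUnitaryAction σ}
    {N : LieSubmodule ℂ sl5 (MvPolynomial σ ℂ)} {S T : MvPolynomial σ ℂ →ₗ[ℂ] MvPolynomial σ ℂ}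
    (ha : IsFischerAdj S T) (hT : ∀ g ∈ N, T g ∈ N) {f : MvPolynomial σ ℂ}
    (hf : f ∈ orthogonal h N) : S f ∈ orthogonal h N := fun g hg => by
  rw [ha]; exact hf _ (hT g hg)

/-- Operators whose adjoints vanish on a submodule map to its orthogonal complement. -/
lemma apply_mem_orthogonal_of_isFischerAdj {h : IsUnitaryAction σ}
    {N : LieSubmodule ℂ sl5 (MvPolynomial σ ℂ)} {S T : MvPolynomial σ ℂ →ₗ[ℂ] MvPolynomial σ ℂ}
    (ha : IsFischerAdj S T) (hT : ∀ g ∈ N, T g = 0) (f : MvPolynomial σ ℂ) :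
    S f ∈ orthogonal h N := fun g hg => by
  rw [ha, hT g hg, fischer_zero_left]

end Adjoint

section PairVariables

/-! ### Variables indexed by pairs -/

variable {σ : Type*} (e : Pair → σ)

/-- The indeterminates `x_{ij} = - x_{ji}`. -/
noncomputable def pairX (i j : Fin 5) : MvPolynomial σ ℂ := skew (fun p => X (e p)) i j

/-- The derivations `d/dx_{ij}`. -/
noncomputable def pairD (i j : Fin 5) : Derivation ℂ (MvPolynomial σ ℂ) (MvPolynomial σ ℂ) :=
  skew (fun p => pderiv (e p)) i j

lemma pairX_swap (i j : Fin 5) : pairX e i j = - pairX e j i := skew_swap _ i j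

lemma pairD_swap (i j : Fin 5) : pairD e i j = - pairD e j i := skew_swap _ i j

lemma pairD_linear (i j : Fin 5) : (pairD e i j).toLinearMap =
    skew (fun p => (pderiv (R := ℂ) (e p)).toLinearMap) i j := by
  unfold pairD skew; split_ifs <;> rfl

lemma isFischerAdj_pairX (i j : Fin 5) :
    IsFischerAdj (LinearMap.mulLeft ℂ (pairX e i j)) (pairD e i j).toLinearMap := by
  rw [pairD_linear]
  unfold pairX skew
  split_ifs
  · exact isFischerAdj_X _
  · have h := (isFischerAdj_X (e ⟨(j, i), by assumption⟩)).neg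
    convert h using 1
    ext; simp
  · convert IsFischerAdj.zero using 1
    ext; simp

variable {e}

lemma pairD_X_of_notMem {i j : Fin 5} {s : σ} (hs : ∀ p, e p ≠ s) : pairD e i j (X s) = 0 := by
  unfold pairD skew
  split_ifs
  · exact pderiv_X_of_ne (hs _).symm
  · rw [Derivation.neg_apply, pderiv_X_of_ne (hs _).symm, neg_zero]
  · rfl

lemma pairD_pairX (he : Function.Injective e) (i j k l : Fin 5) : pairD e i j (pairX e k l) =
    (if i = k ∧ j = l then 1 else 0) - (if i = l ∧ j = k then 1 else 0) := by
  classical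
  rcases lt_trichotomy i j with h | h | h <;> rcases lt_trichotomy k l with h' | h' | h' <;>
    simp only [pairD, pairX, skew, h, h', h.not_gt, h'.not_gt, lt_irrefl, dite_true, dite_false,
      map_neg, Derivation.neg_apply, pderiv_X, Pi.single_apply, he.eq_iff, Subtype.mk.injEq,
      Prod.mk.injEq, map_zero, Derivation.zero_apply, neg_neg] <;>
    grind

end PairVariables

end E510

namespace E510

open MvPolynomial

lemma derivation_sum_apply {ι σ : Type*} (s : Finset ι)
    (D : ι → Derivation ℂ (MvPolynomial σ ℂ) (MvPolynomial σ ℂ)) (f : MvPolynomial σ ℂ) :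
    (∑ i ∈ s, D i) f = ∑ i ∈ s, D i f := by
  classical
  induction s using Finset.induction_on with
  | empty => rfl
  | insert a s ha ih => rw [Finset.sum_insert ha, Finset.sum_insert ha, Derivation.add_apply, ih]

section VectorPair

/-! ### Polynomials on the sum of a five-dimensional space and its exterior square -/

variable {σ : Type*} (v : Fin 5 → σ) (e : Pair → σ)

/-- The operator `xₐ∂_b` on the sum of a five-dimensional space and its exterior square. -/
noncomputable def glOp (a b : Fin 5) : Derivation ℂ (MvPolynomial σ ℂ) (MvPolynomial σ ℂ) :=
  (X (v a) : MvPolynomial σ ℂ) • pderiv (v b) + ∑ c, pairX e a c • pairD e b c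

variable {v e}

lemma glOp_apply (a b : Fin 5) (f : MvPolynomial σ ℂ) :
    glOp v e a b f = X (v a) * pderiv (v b) f + ∑ c, pairX e a c * pairD e b c f := by
  simp [glOp, derivation_sum_apply]

/-- Term by term, the adjoint of x_a d/dx_b is x_b d/dx_a. The contravariance of the inner product
rests on this. -/
lemma isFischerAdj_glOp (a b : Fin 5) :
    IsFischerAdj (glOp v e a b).toLinearMap (glOp v e b a).toLinearMap := by
  have h := ((isFischerAdj_X (v a)).comp (isFischerAdj_X (v b)).symm).add
    (IsFischerAdj.sum Finset.univ fun c =>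
      (isFischerAdj_pairX e a c).comp (isFischerAdj_pairX e b c).symm)
  convert h using 1 <;>
  · refine LinearMap.ext fun f => (glOp_apply _ _ _).trans ?_
    simp

lemma glOp_X (hv : Function.Injective v) (hd : ∀ i p, v i ≠ e p) (a b k : Fin 5) :
    glOp v e a b (X (v k)) = if b = k then X (v a) else 0 := by
  classical
  rw [glOp_apply]
  simp [pairD_X_of_notMem (fun p => (hd k p).symm), pderiv_X, Pi.single_apply, hv.eq_iff, eq_comm]

lemma pderiv_pairX (hd : ∀ i p, v i ≠ e p) (i k l : Fin 5) : pderiv (v i) (pairX e k l) = 0 := by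
  unfold pairX skew
  split_ifs
  · exact pderiv_X_of_ne (hd _ _).symm
  · rw [map_neg, pderiv_X_of_ne (hd _ _).symm, neg_zero]
  · exact map_zero _

lemma glOp_pairX (he : Function.Injective e) (hd : ∀ i p, v i ≠ e p) (a b k l : Fin 5) :
    glOp v e a b (pairX e k l) =
      (if b = k then pairX e a l else 0) + (if b = l then pairX e k a else 0) := by
  rw [glOp_apply, pderiv_pairX hd]
  simp only [pairD_pairX he, mul_zero, zero_add, mul_sub, Finset.sum_sub_distrib, ite_and, mul_ite,
    mul_one]
  have hs (p : Prop) [Decidable p] (f : Fin 5 → MvPolynomial σ ℂ) :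
      ∑ x, (if p then f x else 0) = if p then ∑ x, f x else 0 := by split_ifs <;> simp
  simp only [hs, Finset.sum_ite_eq', Finset.mem_univ, if_true]
  rw [pairX_swap e k a]
  split_ifs <;> ring

/-- The derivatives of the highest vectors. -/
lemma pairD_highest (P Q : MvPolynomial σ ℂ) (ε : Fin 5 → Fin 5 → ℂ)
    (hP : ∀ i j, pairD e i j P = 0) (hQ : ∀ i j, pairD e i j Q = C (ε i j)) (m n : ℕ) (i j : Fin 5) :
    pairD e i j (P ^ m * Q ^ n) = (n * ε i j) • (P ^ m * Q ^ (n - 1)) := by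
  rw [Derivation.leibniz, Derivation.leibniz_pow, Derivation.leibniz_pow, hP, hQ]
  simp only [smul_eq_mul, mul_zero, smul_zero, add_zero, smul_eq_C_mul, nsmul_eq_mul, map_mul,
    map_natCast]
  ring

lemma pderiv_highest (P Q : MvPolynomial σ ℂ) (η : Fin 5 → ℂ)
    (hP : ∀ i, pderiv (v i) P = C (η i)) (hQ : ∀ i, pderiv (v i) Q = 0) (m n : ℕ) (i : Fin 5) :
    pderiv (v i) (P ^ m * Q ^ n) = (m * η i) • (P ^ (m - 1) * Q ^ n) := by
  rw [Derivation.leibniz, Derivation.leibniz_pow, Derivation.leibniz_pow, hP, hQ]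
  simp only [smul_eq_mul, mul_zero, smul_zero, zero_add, smul_eq_C_mul, nsmul_eq_mul, map_mul,
    map_natCast]
  ring

/-- Both derivatives fall on powers of Q, so a product of two of them is ε_{ij} ε_{kl} times a
factor independent of the indices. The relation reduces to the Plücker relation for the bivector ε.
-/
lemma pluecker_highest (P Q : MvPolynomial σ ℂ) (ε : Fin 5 → Fin 5 → ℂ)
    (hP : ∀ i j, pairD e i j P = 0) (hQ : ∀ i j, pairD e i j Q = C (ε i j))
    (hε : ∀ i j k l, ε i j * ε k l - ε i k * ε j l + ε i l * ε j k = 0) (m n : ℕ)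
    (i j k l : Fin 5) :
    pluecker (fun i j => (pairD e i j).toLinearMap) i j k l (P ^ m * Q ^ n) = 0 := by
  have h (i j k l : Fin 5) : pairD e i j (pairD e k l (P ^ m * Q ^ n)) =
      (n * (n - 1 : ℕ) * (ε i j * ε k l)) • (P ^ m * Q ^ (n - 1 - 1)) := by
    rw [pairD_highest P Q ε hP hQ, Derivation.map_smul, pairD_highest P Q ε hP hQ, smul_smul]
    congr 1; ring
  change pairD e i j (pairD e k l (P ^ m * Q ^ n)) - pairD e i k (pairD e j l (P ^ m * Q ^ n)) +
    pairD e i l (pairD e j k (P ^ m * Q ^ n)) = 0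
  rw [h, h, h, ← sub_smul, ← add_smul, ← mul_sub, ← mul_add, hε, mul_zero, zero_smul]

/-- Here one derivative falls on P and one on Q, and the relation reduces to η ∧ ε = 0. -/
lemma incidence_highest (P Q : MvPolynomial σ ℂ) (ε : Fin 5 → Fin 5 → ℂ) (η : Fin 5 → ℂ)
    (hP : ∀ i j, pairD e i j P = 0) (hQ : ∀ i j, pairD e i j Q = C (ε i j))
    (hP' : ∀ i, pderiv (v i) P = C (η i)) (hQ' : ∀ i, pderiv (v i) Q = 0)
    (hε : ∀ i j k, η i * ε j k + η j * ε k i + η k * ε i j = 0) (m n : ℕ) (i j k : Fin 5) :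
    incidence (fun i => (pderiv (v i)).toLinearMap) (fun i j => (pairD e i j).toLinearMap) i j k
      (P ^ m * Q ^ n) = 0 := by
  have h (i j k : Fin 5) : pderiv (v i) (pairD e j k (P ^ m * Q ^ n)) =
      (m * n * (η i * ε j k)) • (P ^ (m - 1) * Q ^ (n - 1)) := by
    rw [pairD_highest P Q ε hP hQ, Derivation.map_smul, pderiv_highest P Q η hP' hQ', smul_smul]
    congr 1; ring
  change pderiv (v i) (pairD e j k (P ^ m * Q ^ n)) + pderiv (v j) (pairD e k i (P ^ m * Q ^ n)) +
    pderiv (v k) (pairD e i j (P ^ m * Q ^ n)) = 0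
  rw [h, h, h, ← add_smul, ← add_smul, ← mul_add, ← mul_add, hε, mul_zero, zero_smul]

end VectorPair

/-! ### Bidegrees and weights of monomials -/

lemma mkDerivation_isWeightedHomogeneous {σ : Type*} {wt : σ → ℕ × ℕ}
    {f : σ → MvPolynomial σ ℂ} (hf : ∀ i, IsWeightedHomogeneous wt (f i) (wt i)) {p : ℕ × ℕ}
    {g : MvPolynomial σ ℂ} (hg : IsWeightedHomogeneous wt g p) :
    IsWeightedHomogeneous wt (mkDerivation ℂ f g) p := by
  rw [← mem_weightedHomogeneousSubmodule, g.as_sum, map_sum]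
  refine Submodule.sum_mem _ fun β hβ => ?_
  rw [mkDerivation_monomial]
  refine Submodule.smul_mem _ _ (Submodule.sum_mem _ fun i hi => ?_)
  have hw : Finsupp.weight wt (β - Finsupp.single i 1) + wt i = p := by
    rw [← hg (mem_support_iff.mp hβ)]
    have : β - Finsupp.single i 1 + Finsupp.single i 1 = β :=
      tsub_add_cancel_of_le (by
        rw [Finsupp.single_le_iff]; exact Nat.one_le_iff_ne_zero.mpr (Finsupp.mem_support_iff.mp hi))
    conv_rhs => rw [← this]
    simp [Finsupp.weight_single]
  rw [mem_weightedHomogeneousSubmodule, ← hw]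
  exact (isWeightedHomogeneous_monomial wt _ _ rfl).mul (hf i)

lemma mkDerivation_monomial_of_eigen {σ : Type*} {f : σ → MvPolynomial σ ℂ} {w : σ → ℤ}
    (hf : ∀ i, f i = (w i : ℂ) • X i) (β : σ →₀ ℕ) :
    mkDerivation ℂ f (monomial β 1) = ((Finsupp.weight w β : ℤ) : ℂ) • monomial β 1 := by
  rw [mkDerivation_monomial, one_smul, Finsupp.weight_apply]
  simp only [Finsupp.sum, Int.cast_sum, Finset.sum_smul]
  refine Finset.sum_congr rfl fun i hi => ?_
  have : β - Finsupp.single i 1 + Finsupp.single i 1 = β :=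
    tsub_add_cancel_of_le (by
      rw [Finsupp.single_le_iff]; exact Nat.one_le_iff_ne_zero.mpr (Finsupp.mem_support_iff.mp hi))
  rw [hf, smul_eq_mul, mul_smul_comm, X, monomial_mul, this, smul_monomial, smul_monomial]
  simp [mul_comm]

/-- Separation of an extreme monomial by a one-parameter subgroup. -/
lemma eq_of_weight_eq {σ : Type*} {wt : σ → ℕ × ℕ} {w : σ → ℤ} {M₁ M₂ : ℤ} {s₁ s₂ : σ}
    (h₁ : wt s₁ = (1, 0)) (h₂ : wt s₂ = (0, 1))
    (hle : ∀ k, w k ≤ M₁ * (wt k).1 + M₂ * (wt k).2) (hw₁ : w s₁ = M₁) (hw₂ : w s₂ = M₂)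
    (heq : ∀ k, w k = M₁ * (wt k).1 + M₂ * (wt k).2 → k = s₁ ∨ k = s₂) {m n : ℕ} {β : σ →₀ ℕ}
    (hβ : Finsupp.weight wt β = (m, n))
    (hw : Finsupp.weight w β = M₁ * m + M₂ * n) :
    β = Finsupp.single s₁ m + Finsupp.single s₂ n := by
  classical
  have hne : s₁ ≠ s₂ := fun h => by rw [h, h₂] at h₁; simp at h₁
  rw [Finsupp.weight_apply] at hβ hw
  have hm : ∑ k ∈ β.support, (β k : ℤ) * (wt k).1 = m := by
    have := congrArg (fun x => ((x.1 : ℕ) : ℤ)) hβ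
    simpa [Finsupp.sum, Prod.fst_sum] using this
  have hn : ∑ k ∈ β.support, (β k : ℤ) * (wt k).2 = n := by
    have := congrArg (fun x => ((x.2 : ℕ) : ℤ)) hβ
    simpa [Finsupp.sum, Prod.snd_sum] using this
  -- The weight of β attains the bound `hle` in total, so the nonnegative defects of its variables
  -- all vanish. Hence only s₁ and s₂ occur, with exponents given by the bidegree.
  have h0 : ∑ k ∈ β.support, (β k : ℤ) * (M₁ * (wt k).1 + M₂ * (wt k).2 - w k) = 0 := by
    have e : ∑ k ∈ β.support, (β k : ℤ) * w k = M₁ * m + M₂ * n := by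
      rw [← hw]; simp [Finsupp.sum]
    rw [← sub_eq_zero.mpr e.symm, ← hm, ← hn, Finset.mul_sum, Finset.mul_sum,
      ← Finset.sum_add_distrib, ← Finset.sum_sub_distrib]
    exact Finset.sum_congr rfl fun k _ => by ring
  rw [Finset.sum_eq_zero_iff_of_nonneg fun k _ =>
    mul_nonneg (Int.natCast_nonneg _) (sub_nonneg.mpr (hle k))] at h0
  have hsupp : β.support ⊆ {s₁, s₂} := fun k hk => by
    have hk0 := Finsupp.mem_support_iff.mp hk
    have := (mul_eq_zero.mp (h0 k hk)).resolve_left (by exact_mod_cast hk0)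
    simpa using heq k (by linarith)
  have hs (u : σ → ℤ) : ∑ k ∈ β.support, (β k : ℤ) * u k = β s₁ * u s₁ + β s₂ * u s₂ := by
    rw [← Finset.sum_pair (f := fun k => (β k : ℤ) * u k) hne]
    exact Finset.sum_subset hsupp fun k _ hk => by rw [Finsupp.notMem_support_iff.mp hk]; simp
  rw [hs, h₁, h₂] at hm hn
  ext k
  by_cases hk₁ : k = s₁
  · subst hk₁; simp [hne] at hm ⊢; exact hm
  by_cases hk₂ : k = s₂
  · subst hk₂; simp [hne] at hn ⊢; simp [hn]
  · have : k ∉ β.support := fun hk => by simpa [hk₁, hk₂] using hsupp hk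
    rw [Finsupp.notMem_support_iff.mp this]
    simp [Ne.symm hk₁, Ne.symm hk₂]

end E510

namespace E510

open MvPolynomial

/-! ### The case `A` -/

lemma mkDerivation_actA (B : Matrix (Fin 5) (Fin 5) ℂ) (f : SA) :
    mkDerivation ℂ (actA B) f = ∑ a, ∑ b, B a b • glOp VarA.x VarA.xx a b f := by
  have h : mkDerivation ℂ (actA B) = ∑ a, ∑ b, B a b • glOp VarA.x VarA.xx a b := by
    refine derivation_ext fun s => ?_
    simp only [derivation_sum_apply, Derivation.smul_apply, mkDerivation_X]
    cases s with
    | x k =>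
      simp only [glOp_X (v := VarA.x) (e := VarA.xx) (fun _ _ h => by cases h; rfl)
        (fun _ _ h => by cases h), smul_ite, smul_zero, Finset.sum_ite_eq', Finset.mem_univ, if_true]
      rfl
    | xx p =>
      have hp : (X (VarA.xx p) : SA) = pairX VarA.xx p.1.1 p.1.2 := by
        simp [pairX, skew, p.2]
      rw [hp]
      simp only [glOp_pairX (v := VarA.x) (e := VarA.xx) (fun _ _ h => by cases h; rfl)
        (fun _ _ h => by cases h), smul_add, smul_ite, smul_zero, Finset.sum_add_distrib,
        Finset.sum_ite_eq', Finset.mem_univ, if_true]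
      rw [← Finset.sum_add_distrib]
      rfl
  rw [h]
  simp only [derivation_sum_apply, Derivation.smul_apply]

lemma lie_SA (A : sl5) (f : SA) : ⁅A, f⁆ = mkDerivation ℂ (actA A.1) f := rfl

lemma isFischerAdj_sum_glOp {σ : Type*} {v : Fin 5 → σ} {e : Pair → σ}
    (B : Matrix (Fin 5) (Fin 5) ℂ) :
    IsFischerAdj (∑ a, ∑ b, B a b • (glOp v e a b).toLinearMap)
      (∑ a, ∑ b, B.conjTranspose a b • (glOp v e a b).toLinearMap) := by
  rw [Finset.sum_comm (f := fun a b => B.conjTranspose a b • (glOp v e a b).toLinearMap)]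
  exact IsFischerAdj.sum _ fun a => IsFischerAdj.sum _ fun b => (isFischerAdj_glOp a b).smul _

lemma isUnitaryAction_SA : IsUnitaryAction VarA := by
  intro A f g
  have h (A : sl5) (f : SA) : ⁅A, f⁆ =
      (∑ a, ∑ b, A.1 a b • (glOp VarA.x VarA.xx a b).toLinearMap) f := by
    rw [lie_SA, mkDerivation_actA]
    simp
  rw [h, h]
  exact isFischerAdj_sum_glOp A.1 f g

/-- The operators `d/dx_{ij}` on `S_A`. -/
noncomputable abbrev dA (i j : Fin 5) : SA →ₗ[ℂ] SA := (pairD VarA.xx i j).toLinearMap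

lemma thetaA_eq (i j : Fin 5) : thetaA i j = dA i j := (pairD_linear _ i j).symm

lemma isTensorFamily_dA : IsTensorFamily dualCoeff dA := by
  rw [← adjCoeff_stdCoeff]
  refine IsTensorFamily.adj isUnitaryAction_SA (θ := fun i j => LinearMap.mulLeft ℂ (xA i j)) ?_
    fun i j => isFischerAdj_pairX _ i j
  intro A i j f
  simp only [LinearMap.mulLeft_apply, lie_SA, Derivation.leibniz, mkDerivation_actA_xA,
    smul_eq_mul, mul_comm f, Finset.sum_mul, stdCoeff, add_mul, smul_mul_assoc]

lemma isVectorFamily_pderivA :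
    IsVectorFamily dualCoeff fun i => (pderiv (R := ℂ) (VarA.x i)).toLinearMap := by
  rw [← adjCoeff_stdCoeff]
  refine IsVectorFamily.adj isUnitaryAction_SA (ξ := fun i => LinearMap.mulLeft ℂ (X (VarA.x i))) ?_
    fun i => isFischerAdj_X _
  intro A i f
  have h : actA A.1 (.x i) = ∑ a, A.1 a i • X (VarA.x a) := rfl
  simp only [LinearMap.mulLeft_apply, lie_SA, Derivation.leibniz, mkDerivation_X, h,
    smul_eq_mul, mul_comm f, Finset.sum_mul, stdCoeff, smul_mul_assoc]

/-- Every property of S_{A,high} that defines an sl₅-submodule is tested on the highest monomials by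
means of this inclusion. -/
lemma SAhigh_le {W : LieSubmodule ℂ sl5 SA}
    (h : ∀ m n, X (VarA.x 0) ^ m * xA 0 1 ^ n ∈ W) : SAhigh ≤ W :=
  iSup₂_le fun m n => by
    rw [highA, LieSubmodule.lieSpan_le, Set.singleton_subset_iff]; exact h m n

lemma highest_mem_highA (m n : ℕ) : X (VarA.x 0) ^ m * xA 0 1 ^ n ∈ highA m n :=
  LieSubmodule.subset_lieSpan rfl

lemma highA_le (m n : ℕ) : highA m n ≤ SAhigh := le_iSup₂ (f := highA) m n

lemma pairD_X_zeroA (i j : Fin 5) : pairD VarA.xx i j (X (VarA.x 0)) = 0 :=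
  pairD_X_of_notMem fun _ h => by cases h

/-- The values of `d/dx_{ij}` at `x_{ab}`. -/
def delta (a b i j : Fin 5) : ℂ := (if i = a ∧ j = b then 1 else 0) - (if i = b ∧ j = a then 1 else 0)

lemma delta_eq (a b i j : Fin 5) : delta a b i j = (if i = a then 1 else 0) * (if j = b then 1 else 0)
    - (if i = b then 1 else 0) * (if j = a then 1 else 0) := by
  unfold delta; congr 1 <;> split_ifs <;> simp_all

/-- `delta a b` is the coefficient matrix of the decomposable bivector e_a ∧ e_b. -/
lemma delta_pluecker (a b i j k l : Fin 5) : delta a b i j * delta a b k l -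
    delta a b i k * delta a b j l + delta a b i l * delta a b j k = 0 := by
  simp only [delta_eq]; ring

lemma pairD_pairX_delta {σ : Type*} {e : Pair → σ} (he : Function.Injective e) (a b i j : Fin 5) :
    pairD e i j (pairX e a b) = C (delta a b i j) := by
  rw [pairD_pairX he, delta]
  simp only [map_sub, apply_ite C, map_one, map_zero]

lemma xxA_injective : Function.Injective VarA.xx := fun _ _ h => by cases h; rfl

lemma dA_highest (m n : ℕ) (i j : Fin 5) : dA i j (X (VarA.x 0) ^ m * xA 0 1 ^ n) =
    (n * delta 0 1 i j) • (X (VarA.x 0) ^ m * xA 0 1 ^ (n - 1)) :=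
  pairD_highest _ _ _ pairD_X_zeroA (pairD_pairX_delta xxA_injective 0 1) m n i j

lemma dA_mem_SAhigh {f : SA} (hf : f ∈ SAhigh) (i j : Fin 5) : dA i j f ∈ SAhigh := by
  have h : SAhigh ≤ isTensorFamily_dA.comap SAhigh := SAhigh_le fun m n i j => by
    -- For n = 0 the truncated exponent n − 1 is harmless, because the coefficient n is zero.
    rw [dA_highest]
    exact SAhigh.smul_mem _ (highA_le _ _ (highest_mem_highA _ _))
  exact h hf i j

lemma pluecker_SAhigh {f : SA} (hf : f ∈ SAhigh) (i j k l : Fin 5) : pluecker dA i j k l f = 0 := by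
  have h : SAhigh ≤ isTensorFamily_dA.plueckerKer := SAhigh_le fun m n i j k l =>
    pluecker_highest _ _ _ pairD_X_zeroA (pairD_pairX_delta xxA_injective 0 1)
      (delta_pluecker 0 1) m n i j k l
  exact h hf i j k l

lemma incidence_SAhigh {f : SA} (hf : f ∈ SAhigh) (i j k : Fin 5) :
    incidence (fun i => (pderiv (R := ℂ) (VarA.x i)).toLinearMap) dA i j k f = 0 := by
  have h : SAhigh ≤ isTensorFamily_dA.incidenceKer isVectorFamily_pderivA :=
    SAhigh_le fun m n i j k =>
      incidence_highest _ _ _ (fun i => if i = 0 then 1 else 0) pairD_X_zeroA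
        (pairD_pairX_delta xxA_injective 0 1)
        (fun i => by
          classical
          rw [pderiv_X, Pi.single_apply]; simp [eq_comm, apply_ite C])
        (fun i => pderiv_pairX (fun _ _ h => by cases h) _ _ _)
        (fun i j k => by simp only [delta_eq]; ring) m n i j k
  exact h hf i j k

/-- The action on a given polynomial as a linear map. -/
noncomputable def actOn {σ : Type} (h : Matrix (Fin 5) (Fin 5) ℂ →ₗ[ℂ] (σ → MvPolynomial σ ℂ))
    (f : MvPolynomial σ ℂ) : Matrix (Fin 5) (Fin 5) ℂ →ₗ[ℂ] MvPolynomial σ ℂ where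
  toFun B := mkDerivation ℂ (h B) f
  map_add' B B' := DFunLike.congr_fun (derivation_ext (D₁ := mkDerivation ℂ (h (B + B')))
    (D₂ := mkDerivation ℂ (h B) + mkDerivation ℂ (h B')) fun i => by simp [mkDerivation_X]) f
  map_smul' c B := DFunLike.congr_fun (derivation_ext (D₁ := mkDerivation ℂ (h (c • B)))
    (D₂ := c • mkDerivation ℂ (h B)) fun i => by simp [mkDerivation_X]) f

lemma actOn_apply {σ : Type} (h : Matrix (Fin 5) (Fin 5) ℂ →ₗ[ℂ] (σ → MvPolynomial σ ℂ))
    (f : MvPolynomial σ ℂ) (B : Matrix (Fin 5) (Fin 5) ℂ) :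
    actOn h f B = mkDerivation ℂ (h B) f := rfl

lemma sum_single_smul {Z : Type*} [AddCommGroup Z] [Module ℂ Z] (F : Fin 5 → Fin 5 → Z)
    (k l : Fin 5) :
    ∑ a, ∑ b, (Matrix.single k l 1 : Matrix (Fin 5) (Fin 5) ℂ) a b • F a b = F k l := by
  simp [Matrix.single_apply, ite_and, ite_smul]

lemma mkDerivation_actA_single (k l : Fin 5) (f : SA) :
    mkDerivation ℂ (actA (Matrix.single k l 1)) f = glOp VarA.x VarA.xx k l f := by
  rw [mkDerivation_actA]
  exact sum_single_smul (fun a b => glOp VarA.x VarA.xx a b f) k l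

/-- `θ^A_{ij}` on `V_A`. -/
noncomputable def thetaVA (i j : Fin 5) : VA →ₗ[ℂ] VA where
  toFun f := ⟨dA i j f, dA_mem_SAhigh f.2 i j⟩
  map_add' _ _ := Subtype.ext (map_add (dA i j) _ _)
  map_smul' c _ := Subtype.ext (map_smul (dA i j) c _)

/-- Adjoints of commuting multiplication operators commute. -/
lemma pairD_comm {σ : Type*} (e : Pair → σ) (i j k l : Fin 5) (f : MvPolynomial σ ℂ) :
    pairD e i j (pairD e k l f) = pairD e k l (pairD e i j f) := by
  have h := ((isFischerAdj_pairX e k l).comp (isFischerAdj_pairX e i j)).unique (T' :=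
    (pairD e k l).toLinearMap ∘ₗ (pairD e i j).toLinearMap) (by
      convert (isFischerAdj_pairX e i j).comp (isFischerAdj_pairX e k l) using 1
      ext f; simp [mul_left_comm])
  exact LinearMap.congr_fun h f

lemma pairD_cyclic {σ : Type*} (e : Pair → σ) (i j l m : Fin 5) (f : MvPolynomial σ ℂ)
    (h : pluecker (fun i j => (pairD e i j).toLinearMap) l m i j f = 0) :
    pairD e l m (pairD e i j f) + pairD e i m (pairD e j l f) +
      pairD e j m (pairD e l i f) = 0 := by
  change pairD e l m (pairD e i j f) - pairD e l i (pairD e m j f) +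
    pairD e l j (pairD e m i f) = 0 at h
  rw [pairD_comm e i m, pairD_comm e j m, pairD_swap e j l, pairD_swap e i m, pairD_swap e j m]
  simp only [Derivation.neg_apply, map_neg]
  linear_combination h

lemma isNablaFamily_thetaVA : IsNablaFamily thetaVA where
  skew i j f := Subtype.ext (by
    change pairD _ i j f.1 = - pairD _ j i f.1
    rw [pairD_swap]; rfl)
  lie A i j f := Subtype.ext (by
    have h := isTensorFamily_dA A i j f.1
    simp only [dualCoeff, neg_smul, ← neg_add, Finset.sum_neg_distrib] at h
    rw [← sub_eq_add_neg] at h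
    have hs : ((∑ b, (A.1 i b • thetaVA b j f + A.1 j b • thetaVA i b f) : VA) : SA) =
        ∑ b, (A.1 i b • dA b j f.1 + A.1 j b • dA i b f.1) := by
      exact map_sum SAhigh.incl (fun b => A.1 i b • thetaVA b j f + A.1 j b • thetaVA i b f)
        Finset.univ
    exact h.trans (congrArg _ hs.symm))
  singular w hw f := Subtype.ext (by
    have hs : ((∑ i, ∑ j, ⁅degZero (wedge w (dd i j)), thetaVA i j f⁆ : VA) : SA) =
        ∑ i, ∑ j, actOn actA (dA i j f.1) (degZero (wedge w (dd i j))).1 := by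
      refine (map_sum SAhigh.incl (fun i => ∑ j, ⁅degZero (wedge w (dd i j)), thetaVA i j f⁆)
        Finset.univ).trans (Finset.sum_congr rfl fun i _ => ?_)
      exact map_sum SAhigh.incl (fun j => ⁅degZero (wedge w (dd i j)), thetaVA i j f⁆) Finset.univ
    -- The trace term h is 0 here: on S_{A,high} the cyclic sums themselves vanish. Their part with
    -- coefficient x_k is an incidence relation, and the part with coefficient x_{km} is a Plücker
    -- relation.
    refine hs.trans (sum_degZero_wedge (fun i j => actOn actA (dA i j f.1)) ?_ 0 (by simp) ?_ w hw)
    · intro i j B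
      have h : dA i j f.1 = - dA j i f.1 := by
        change pairD _ i j f.1 = - pairD _ j i f.1
        rw [pairD_swap]; rfl
      rw [h, actOn_apply, actOn_apply, map_neg]
    · intro i j l k
      simp only [actOn_apply, mkDerivation_actA_single, glOp_apply]
      have h1 : pderiv (VarA.x l) (dA i j f.1) + pderiv (VarA.x i) (dA j l f.1) +
        pderiv (VarA.x j) (dA l i f.1) = 0 := incidence_SAhigh f.2 l i j
      have h2 (m : Fin 5) : pairD VarA.xx l m (dA i j f.1) + pairD VarA.xx i m (dA j l f.1) +
          pairD VarA.xx j m (dA l i f.1) = 0 :=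
        pairD_cyclic _ i j l m f.1 (pluecker_SAhigh f.2 l m i j)
      have h3 := Finset.sum_eq_zero (s := Finset.univ) fun m _ =>
        mul_eq_zero_of_right (pairX VarA.xx k m) (h2 m)
      simp only [mul_add, Finset.sum_add_distrib] at h3
      simp only [Pi.zero_apply, ite_self]
      linear_combination (X (VarA.x k) : SA) * h1 + h3)
  comm i j k l f := Subtype.ext (pairD_comm _ i j k l f.1)
  pluecker i j k l f := Subtype.ext (pluecker_SAhigh f.2 i j k l)

lemma tmulL_one_mem_sub {V : Type*} [AddCommGroup V] [Module ℂ V] [LieRingModule sl5 V]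
    {W : LieSubmodule ℂ sl5 V} {v : V} (hv : v ∈ W) : M.tmulL 1 v ∈ M.sub W :=
  Submodule.subset_span ⟨v, hv, rfl⟩

/-- `∇` vanishes on `M(W)` if and only if the operators `θ_{ij}` vanish on `W`. -/
lemma nabla_sub_eq_zero_iff {V : Type*} [AddCommGroup V] [Module ℂ V] [LieRingModule sl5 V]
    [LieModule ℂ sl5 V] {θ : Fin 5 → Fin 5 → V →ₗ[ℂ] V} (hθ : IsNablaFamily θ)
    (W : LieSubmodule ℂ sl5 V) :
    (∀ w ∈ M.sub W, nabla hθ w = 0) ↔ ∀ v ∈ W, ∀ i j, θ i j v = 0 := by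
  refine ⟨fun h v hv i j => ?_, fun h w hw => ?_⟩
  · have h1 := h _ (tmulL_one_mem_sub hv)
    rw [nabla_tmulL] at h1
    simp only [one_mul] at h1
    exact eq_zero_of_sum_tmul_eq_zero (fun i j => θ i j v) (fun i j => hθ.skew i j v) h1 i j
  · induction hw using Submodule.span_induction with
    | zero => exact map_zero _
    | add t t' _ _ h h' => rw [map_add, h, h', add_zero]
    | smul u t _ h => rw [map_smul, h, smul_zero]
    | mem t ht =>
      obtain ⟨v, hv, rfl⟩ := ht
      rw [← M.tmulL_apply, nabla_tmulL]
      exact Finset.sum_eq_zero fun i _ => Finset.sum_eq_zero fun j _ => by rw [h v hv, map_zero]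

lemma highest_ne_zeroA (m n : ℕ) : (X (VarA.x 0) ^ m * xA 0 1 ^ n : SA) ≠ 0 := by
  refine mul_ne_zero (pow_ne_zero _ (X_ne_zero _)) (pow_ne_zero _ ?_)
  have : xA 0 1 = X (VarA.xx ⟨(0, 1), by decide⟩) := by simp [xA, skew]
  rw [this]; exact X_ne_zero _

theorem exists_nablaA :
    ∃ (θ : Fin 5 → Fin 5 → VA →ₗ[ℂ] VA) (nabla : M VA →ₗ[U] M VA),
      (∀ i j f, (θ i j f : SA) = thetaA i j f) ∧ IsNabla θ nabla ∧
      nabla ∘ₗ nabla = 0 ∧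
      ∀ m n, (∀ w ∈ M.sub (VAc m n), nabla w = 0) ↔ n = 0 := by
  refine ⟨thetaVA, nabla isNablaFamily_thetaVA, fun i j f => by rw [thetaA_eq]; rfl,
    isNabla_nabla _, nabla_comp_nabla _, fun m n => ?_⟩
  rw [nabla_sub_eq_zero_iff]
  constructor
  · intro h
    by_contra hn
    have h1 := congrArg Subtype.val
      (h ⟨_, highA_le _ _ (highest_mem_highA m n)⟩ (highest_mem_highA m n) 0 1)
    -- d/dx_{01} lowers the exponent of x_{01} in the highest vector and multiplies by n, so it
    -- detects n ≠ 0.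
    have h2 : (n * delta 0 1 0 1) • (X (VarA.x 0) ^ m * xA 0 1 ^ (n - 1)) = (0 : SA) :=
      (dA_highest m n 0 1).symm.trans h1
    refine (smul_ne_zero ?_ (highest_ne_zeroA m (n - 1))) h2
    simpa [delta] using hn
  · rintro rfl v hv i j
    -- The common kernel of the θ_{ij} is a submodule, and for n = 0 it contains the generator
    -- x_0^m.
    have hle : highA m 0 ≤ isTensorFamily_dA.comap ⊥ := by
      rw [highA, LieSubmodule.lieSpan_le, Set.singleton_subset_iff]
      intro i j
      rw [dA_highest]
      simp
    exact Subtype.ext (hle hv i j)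

end E510

namespace E510

open MvPolynomial

/-! ### Families of operators on a quotient module -/

section Quotient

variable {V : Type*} [AddCommGroup V] [Module ℂ V] [LieRingModule sl5 V] [LieModule ℂ sl5 V]
  {W : LieSubmodule ℂ sl5 V}

/-- The operator on a quotient induced by an operator that preserves a submodule. -/
def quotOp (T : V →ₗ[ℂ] V) (h : ∀ f ∈ W, T f ∈ W) : (V ⧸ W) →ₗ[ℂ] (V ⧸ W) :=
  Submodule.mapQ W.toSubmodule W.toSubmodule T h

lemma quotOp_mk (T : V →ₗ[ℂ] V) (h : ∀ f ∈ W, T f ∈ W) (f : V) :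
    quotOp T h (LieSubmodule.Quotient.mk' W f) = LieSubmodule.Quotient.mk' W (T f) := rfl

lemma mk'_eq_zero {f : V} : LieSubmodule.Quotient.mk' W f = 0 ↔ f ∈ W :=
  Submodule.Quotient.mk_eq_zero W.toSubmodule

/-- Skewness, equivariance and commutation are available on V itself. The singular vector condition
and the Plücker relations are needed only modulo W, and in case B they hold only there. -/
lemma isNablaFamily_quotOp {θ : Fin 5 → Fin 5 → V →ₗ[ℂ] V} (h : ∀ i j, ∀ f ∈ W, θ i j f ∈ W)
    (skew : ∀ i j f, θ i j f = - θ j i f) (lie : IsTensorFamily dualCoeff θ)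
    (singular : ∀ w, NonnegOdd w → ∀ f,
      ∑ i, ∑ j, ⁅degZero (wedge w (dd i j)), θ i j f⁆ ∈ W)
    (comm : ∀ i j k l f, θ i j (θ k l f) = θ k l (θ i j f))
    (pluecker : ∀ i j k l f, pluecker θ i j k l f ∈ W) :
    IsNablaFamily fun i j => quotOp (θ i j) (h i j) where
  skew i j v := by
    obtain ⟨f, rfl⟩ := LieSubmodule.Quotient.surjective_mk' W v
    rw [quotOp_mk, quotOp_mk, skew, map_neg]
  lie A i j v := by
    obtain ⟨f, rfl⟩ := LieSubmodule.Quotient.surjective_mk' W v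
    have h := lie A i j f
    simp only [dualCoeff, neg_smul, ← neg_add, Finset.sum_neg_distrib] at h
    simp only [quotOp_mk, ← LieModuleHom.map_lie, h, map_add, map_neg, map_sum, map_smul]
    abel
  singular w hw v := by
    obtain ⟨f, rfl⟩ := LieSubmodule.Quotient.surjective_mk' W v
    simp only [quotOp_mk, ← LieModuleHom.map_lie, ← map_sum]
    exact mk'_eq_zero.mpr (singular w hw f)
  comm i j k l v := by
    obtain ⟨f, rfl⟩ := LieSubmodule.Quotient.surjective_mk' W v
    simp only [quotOp_mk, comm i j k l]
  pluecker i j k l v := by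
    obtain ⟨f, rfl⟩ := LieSubmodule.Quotient.surjective_mk' W v
    simp only [quotOp_mk, ← map_sub, ← map_add]
    exact mk'_eq_zero.mpr (pluecker i j k l f)

end Quotient

/-! ### The case `B` -/

lemma xxsB_injective : Function.Injective VarB.xxs := fun _ _ h => by cases h; rfl

lemma xsB_injective : Function.Injective VarB.xs := fun _ _ h => by cases h; rfl

lemma mkDerivation_actB (B : Matrix (Fin 5) (Fin 5) ℂ) (f : SB) :
    mkDerivation ℂ (actB B) f = - ∑ a, ∑ b, B.transpose a b • glOp VarB.xs VarB.xxs a b f := by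
  have h : mkDerivation ℂ (actB B) = - ∑ a, ∑ b, B.transpose a b • glOp VarB.xs VarB.xxs a b := by
    refine derivation_ext fun s => ?_
    simp only [Derivation.neg_apply, derivation_sum_apply, Derivation.smul_apply, mkDerivation_X]
    cases s with
    | xs k =>
      simp only [glOp_X (e := VarB.xxs) xsB_injective
        (fun _ _ h => by cases h), smul_ite, smul_zero, Finset.sum_ite_eq', Finset.mem_univ, if_true]
      rfl
    | xxs p =>
      have hp : (X (VarB.xxs p) : SB) = pairX VarB.xxs p.1.1 p.1.2 := by
        simp [pairX, skew, p.2]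
      rw [hp]
      simp only [glOp_pairX (v := VarB.xs) xxsB_injective
        (fun _ _ h => by cases h), smul_add, smul_ite, smul_zero, Finset.sum_add_distrib,
        Finset.sum_ite_eq', Finset.mem_univ, if_true]
      rw [← Finset.sum_add_distrib]
      rfl
  rw [h]
  simp only [Derivation.neg_apply, derivation_sum_apply, Derivation.smul_apply]

lemma lie_SB (A : sl5) (f : SB) : ⁅A, f⁆ = mkDerivation ℂ (actB A.1) f := rfl

/-- The dual action of A is minus the standard one of its transpose, and transposition commutes with
the conjugate transpose. -/
lemma isUnitaryAction_SB : IsUnitaryAction VarB := by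
  intro A f g
  have h (A : sl5) (f : SB) : ⁅A, f⁆ =
      (- ∑ a, ∑ b, A.1.transpose a b • (glOp VarB.xs VarB.xxs a b).toLinearMap) f := by
    rw [lie_SB, mkDerivation_actB]
    simp
  rw [h, h]
  exact (isFischerAdj_sum_glOp A.1.transpose).neg f g

/-- The operators `d/dx*_{ij}` on `S_B`. -/
noncomputable abbrev dB (i j : Fin 5) : SB →ₗ[ℂ] SB := (pairD VarB.xxs i j).toLinearMap

lemma isFischerAdj_thetaB (i j : Fin 5) : IsFischerAdj (thetaB i j) (dB i j) :=
  isFischerAdj_pairX VarB.xxs i j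

lemma isTensorFamily_thetaB : IsTensorFamily dualCoeff thetaB := by
  intro A i j f
  simp only [thetaB, LinearMap.mulLeft_apply, lie_SB, Derivation.leibniz, mkDerivation_actB_xB,
    smul_eq_mul, mul_comm f, Finset.sum_mul, dualCoeff, add_mul, neg_mul, smul_mul_assoc, neg_smul,
    ← neg_add, Finset.sum_neg_distrib]

lemma isTensorFamily_dB : IsTensorFamily stdCoeff dB := by
  rw [← adjCoeff_dualCoeff]
  exact isTensorFamily_thetaB.adj isUnitaryAction_SB isFischerAdj_thetaB

lemma isVectorFamily_pderivB :
    IsVectorFamily stdCoeff fun i => (pderiv (R := ℂ) (VarB.xs i)).toLinearMap := by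
  rw [← adjCoeff_dualCoeff]
  refine IsVectorFamily.adj isUnitaryAction_SB (ξ := fun i => LinearMap.mulLeft ℂ (X (VarB.xs i)))
    ?_ fun i => isFischerAdj_X _
  intro A i f
  have h : actB A.1 (.xs i) = - ∑ b, A.1 i b • X (VarB.xs b) := rfl
  simp only [LinearMap.mulLeft_apply, lie_SB, Derivation.leibniz, mkDerivation_X, h,
    smul_eq_mul, mul_comm f, Finset.sum_mul, dualCoeff, neg_mul, smul_mul_assoc, neg_smul,
    Finset.sum_neg_distrib]

/-- The exponent of the highest monomial of bidegree `(m, n)`. -/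
noncomputable def expB (m n : ℕ) : VarB →₀ ℕ :=
  Finsupp.single (VarB.xxs ⟨(3, 4), by decide⟩) m + Finsupp.single (VarB.xs 4) n

lemma monomial_expB (m n : ℕ) :
    (monomial (expB m n) 1 : SB) = xB 3 4 ^ m * X (VarB.xs 4) ^ n := by
  have : xB 3 4 = X (VarB.xxs ⟨(3, 4), by decide⟩) := by simp [xB, skew]
  rw [this, expB, X_pow_eq_monomial, X_pow_eq_monomial, monomial_mul, one_mul]

/-- The diagonal matrix with given integral entries of sum zero. -/
noncomputable def diagSl (h : Fin 5 → ℤ) (h0 : ∑ i, h i = 0) : sl5 :=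
  ⟨Matrix.diagonal fun i => (h i : ℂ), by
    change Matrix.trace (Matrix.diagonal fun i : Fin 5 => (h i : ℂ)) = 0
    rw [Matrix.trace_diagonal, ← Int.cast_sum, h0, Int.cast_zero]⟩

lemma diagSl_apply (h : Fin 5 → ℤ) (h0 : ∑ i, h i = 0) (i j : Fin 5) :
    (diagSl h h0).1 i j = if i = j then (h i : ℂ) else 0 := Matrix.diagonal_apply ..

/-- The weights of the indeterminates of `S_B` under a diagonal matrix. -/
def weightB (h : Fin 5 → ℤ) : VarB → ℤ
  | .xs k => - h k
  | .xxs p => - (h p.1.1 + h p.1.2)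

lemma actB_diagSl (h : Fin 5 → ℤ) (h0 : ∑ i, h i = 0) (s : VarB) :
    actB (diagSl h h0).1 s = (weightB h s : ℂ) • X s := by
  cases s with
  | xs k =>
    have e (A : Matrix (Fin 5) (Fin 5) ℂ) :
      actB A (.xs k) = - ∑ b, A k b • X (VarB.xs b) := rfl
    rw [e]
    simp [diagSl_apply, ite_smul, weightB]
  | xxs p =>
    have e (A : Matrix (Fin 5) (Fin 5) ℂ) :
      actB A (.xxs p) = - ∑ b, (A p.1.1 b • xB b p.1.2 + A p.1.2 b • xB p.1.1 b) := rfl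
    have hp : (X (VarB.xxs p) : SB) = xB p.1.1 p.1.2 := by simp [xB, skew, p.2]
    rw [e, hp]
    simp only [diagSl_apply, ite_smul, weightB, zero_smul, Finset.sum_add_distrib,
      Finset.sum_ite_eq, Finset.mem_univ, if_true, Int.cast_neg, Int.cast_add]
    module

lemma isWeightedHomogeneous_pairX {σ : Type*} {e : Pair → σ} {wt : σ → ℕ × ℕ} {p : ℕ × ℕ}
    (h : ∀ q, wt (e q) = p) (i j : Fin 5) : IsWeightedHomogeneous wt (pairX e i j) p := by
  unfold pairX skew
  split_ifs
  · rw [← h]; exact isWeightedHomogeneous_X ℂ wt _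
  · rw [← h ⟨(j, i), by assumption⟩]; exact (isWeightedHomogeneous_X ℂ wt _).neg
  · exact isWeightedHomogeneous_zero ..

lemma actB_isWeightedHomogeneous (B : Matrix (Fin 5) (Fin 5) ℂ) (s : VarB) :
    IsWeightedHomogeneous wtB (actB B s) (wtB s) := by
  rw [← mem_weightedHomogeneousSubmodule]
  cases s with
  | xs k =>
    have e : actB B (.xs k) = - ∑ b, B k b • X (VarB.xs b) := rfl
    rw [e]
    exact neg_mem (Submodule.sum_mem _ fun b _ => Submodule.smul_mem _ _
      (isWeightedHomogeneous_X ℂ wtB (.xs b)))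
  | xxs q =>
    have e : actB B (.xxs q) =
      - ∑ b, (B q.1.1 b • pairX VarB.xxs b q.1.2 + B q.1.2 b • pairX VarB.xxs q.1.1 b) := rfl
    have h (i j : Fin 5) : pairX VarB.xxs i j ∈ weightedHomogeneousSubmodule ℂ wtB (1, 0) :=
      (mem_weightedHomogeneousSubmodule ..).mpr
        (isWeightedHomogeneous_pairX (e := VarB.xxs) (wt := wtB) (p := (1, 0)) (fun _ => rfl) i j)
    rw [e, show wtB (.xxs q) = (1, 0) from rfl]
    exact neg_mem (Submodule.sum_mem _ fun b _ => add_mem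
      (Submodule.smul_mem _ _ (h _ _)) (Submodule.smul_mem _ _ (h _ _)))

lemma lie_diagSl_monomialB (h : Fin 5 → ℤ) (h0 : ∑ i, h i = 0) (β : VarB →₀ ℕ) :
    ⁅diagSl h h0, (monomial β 1 : SB)⁆ =
      ((Finsupp.weight (weightB h) β : ℤ) : ℂ) • monomial β 1 := by
  have e := mkDerivation_monomial_of_eigen (actB_diagSl h h0) β
  rw [← lie_SB] at e
  exact e

/-- Under diag(1, 1, 1, −1, −2) the largest weight 3 among the x*_{ij} occurs only at x*_{34}, and
the largest weight 2 among the x*_i only at x*_4. This element therefore separates the highest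
monomials. -/
lemma weightB_le (s : VarB) :
    weightB ![1, 1, 1, -1, -2] s ≤ 3 * ((wtB s).1 : ℤ) + 2 * ((wtB s).2 : ℤ) := by
  rcases s with k | p
  · revert k; decide
  · revert p; decide

lemma eq_of_weightB_eq (s : VarB)
    (h : weightB ![1, 1, 1, -1, -2] s = 3 * ((wtB s).1 : ℤ) + 2 * ((wtB s).2 : ℤ)) :
    s = .xxs ⟨(3, 4), by decide⟩ ∨ s = .xs 4 := by
  rcases s with k | p
  · have : ∀ k : Fin 5, weightB ![1, 1, 1, -1, -2] (.xs k) =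
      3 * ((wtB (.xs k)).1 : ℤ) + 2 * ((wtB (.xs k)).2 : ℤ) → k = 4 := by decide
    rw [this k h]; exact Or.inr rfl
  · have : ∀ p : Pair, weightB ![1, 1, 1, -1, -2] (.xxs p) =
      3 * ((wtB (.xxs p)).1 : ℤ) + 2 * ((wtB (.xxs p)).2 : ℤ) → p = ⟨(3, 4), by decide⟩ := by decide
    rw [this p h]; exact Or.inl rfl

lemma isHighestFamily_B : IsHighestFamily wtB expB where
  unitary := isUnitaryAction_SB
  homogeneous A _ _ hf := mkDerivation_isWeightedHomogeneous (actB_isWeightedHomogeneous A.1) hf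
  weight m n := by
    rw [expB, map_add, Finsupp.weight_single, Finsupp.weight_single]
    simp [wtB]
  separated := by
    refine ⟨diagSl ![1, 1, 1, -1, -2] (by decide),
      fun β => ((Finsupp.weight (weightB ![1, 1, 1, -1, -2]) β : ℤ) : ℂ),
      lie_diagSl_monomialB _ _, fun m n β hβ hw => ?_⟩
    refine eq_of_weight_eq (w := weightB ![1, 1, 1, -1, -2]) (M₁ := 3) (M₂ := 2) rfl rfl
      weightB_le rfl rfl eq_of_weightB_eq hβ ?_
    rw [Int.cast_inj.mp hw, expB, map_add, Finsupp.weight_single, Finsupp.weight_single]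
    simp [weightB]; ring

/-- The sum of the highest components of `S_B`. -/
noncomputable def SBhigh : LieSubmodule ℂ sl5 SB := ⨆ (m : ℕ) (n : ℕ), highB m n

/-- Membership in S_{B,low} becomes orthogonality, so statements about multiplication modulo
S_{B,low} turn into statements about derivatives on `SBhigh`. -/
lemma SBlow_eq : SBlow = orthogonal isUnitaryAction_SB SBhigh :=
  iSup_low_eq_orthogonal isHighestFamily_B highB lowB
    (fun m n => by rw [monomial_expB]; rfl) fun _ _ => rfl

lemma SBhigh_le {W : LieSubmodule ℂ sl5 SB}
    (h : ∀ m n, xB 3 4 ^ m * X (VarB.xs 4) ^ n ∈ W) : SBhigh ≤ W :=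
  iSup₂_le fun m n => by
    rw [highB, LieSubmodule.lieSpan_le, Set.singleton_subset_iff]; exact h m n

lemma highest_mem_highB (m n : ℕ) : xB 3 4 ^ m * X (VarB.xs 4) ^ n ∈ highB m n :=
  LieSubmodule.subset_lieSpan rfl

lemma highest_mem_SBhigh (m n : ℕ) : xB 3 4 ^ m * X (VarB.xs 4) ^ n ∈ SBhigh :=
  le_iSup₂ (f := highB) m n (highest_mem_highB m n)

lemma pairD_X_fourB (i j : Fin 5) : pairD VarB.xxs i j (X (VarB.xs 4)) = 0 :=
  pairD_X_of_notMem fun _ h => by cases h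

lemma dB_highest (m n : ℕ) (i j : Fin 5) : dB i j (xB 3 4 ^ m * X (VarB.xs 4) ^ n) =
    (m * delta 3 4 i j) • (xB 3 4 ^ (m - 1) * X (VarB.xs 4) ^ n) := by
  rw [mul_comm, mul_comm (xB 3 4 ^ (m - 1))]
  exact pairD_highest _ _ _ pairD_X_fourB (pairD_pairX_delta xxsB_injective 3 4) n m i j

lemma dB_mem_SBhigh (i j : Fin 5) {f : SB} (hf : f ∈ SBhigh) : dB i j f ∈ SBhigh := by
  have h : SBhigh ≤ isTensorFamily_dB.comap SBhigh := SBhigh_le fun m n i j => by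
    rw [dB_highest]
    exact SBhigh.smul_mem _ (highest_mem_SBhigh _ _)
  exact h hf i j

lemma pluecker_SBhigh (i j k l : Fin 5) {f : SB} (hf : f ∈ SBhigh) : pluecker dB i j k l f = 0 := by
  have h : SBhigh ≤ isTensorFamily_dB.plueckerKer := SBhigh_le fun m n i j k l => by
    rw [mul_comm]
    exact pluecker_highest _ _ _ pairD_X_fourB (pairD_pairX_delta xxsB_injective 3 4)
      (delta_pluecker 3 4) n m i j k l
  exact h hf i j k l

lemma incidence_SBhigh (i j k : Fin 5) {f : SB} (hf : f ∈ SBhigh) :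
    incidence (fun i => (pderiv (R := ℂ) (VarB.xs i)).toLinearMap) dB i j k f = 0 := by
  have h : SBhigh ≤ isTensorFamily_dB.incidenceKer isVectorFamily_pderivB :=
    SBhigh_le fun m n i j k => by
      rw [mul_comm]
      exact incidence_highest _ _ _ (fun i => if i = 4 then 1 else 0) pairD_X_fourB
        (pairD_pairX_delta xxsB_injective 3 4)
        (fun i => by
          classical
          rw [pderiv_X, Pi.single_apply]; simp [eq_comm, apply_ite C])
        (fun i => pderiv_pairX (fun _ _ h => by cases h) _ _ _)
        (fun i j k => by simp only [delta_eq]; ring) n m i j k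
  exact h hf i j k

lemma thetaB_mem_SBlow (i j : Fin 5) (f : SB) (hf : f ∈ SBlow) : thetaB i j f ∈ SBlow := by
  rw [SBlow_eq] at hf ⊢
  exact mem_orthogonal_of_isFischerAdj (isFischerAdj_thetaB i j) (fun _ => dB_mem_SBhigh i j) hf

/-- The adjoint is the Plücker operator in the d/dx*_{ij}, which kills the highest components.
Adjoints reverse products, hence the rearrangement of commuting multiplications. The incidence
relation below is dual to `incidence_SBhigh` in the same way. -/
lemma pluecker_thetaB_mem (i j k l : Fin 5) (f : SB) : pluecker thetaB i j k l f ∈ SBlow := by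
  rw [SBlow_eq]
  refine apply_mem_orthogonal_of_isFischerAdj ?_ (fun _ => pluecker_SBhigh i j k l) f
  convert (((isFischerAdj_thetaB k l).comp (isFischerAdj_thetaB i j)).sub
    ((isFischerAdj_thetaB j l).comp (isFischerAdj_thetaB i k))).add
    ((isFischerAdj_thetaB j k).comp (isFischerAdj_thetaB i l)) using 1
  · refine LinearMap.ext fun f => ?_
    simp [pluecker, thetaB, mul_left_comm]
  · rfl

lemma incidence_thetaB_mem (i j k : Fin 5) (f : SB) :
    incidence (fun i => LinearMap.mulLeft ℂ (X (VarB.xs i))) thetaB i j k f ∈ SBlow := by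
  rw [SBlow_eq]
  refine apply_mem_orthogonal_of_isFischerAdj ?_ (fun _ => incidence_SBhigh i j k) f
  convert (((isFischerAdj_thetaB j k).comp (isFischerAdj_X (VarB.xs i))).add
    ((isFischerAdj_thetaB k i).comp (isFischerAdj_X (VarB.xs j)))).add
    ((isFischerAdj_thetaB i j).comp (isFischerAdj_X (VarB.xs k))) using 1
  · refine LinearMap.ext fun f => ?_
    simp [incidence, thetaB, mul_left_comm]
  · rfl

lemma mkDerivation_actB_single (k l : Fin 5) (f : SB) :
    mkDerivation ℂ (actB (Matrix.single k l 1)) f = - glOp VarB.xs VarB.xxs l k f := by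
  rw [mkDerivation_actB, Matrix.transpose_single]
  exact congrArg _ (sum_single_smul (fun a b => glOp VarB.xs VarB.xxs a b f) l k)

/-- Expand the gl₅ operators. The terms with d/dx*_k have cyclic coefficients x*_l x*_{ij} + …, an
incidence relation; those with d/dx*_{kc} have x*_{ij} x*_{lc} + …, a Plücker relation. -/
lemma glOp_cyclic_mem (i j l k : Fin 5) (f : SB) :
    xB i j * glOp VarB.xs VarB.xxs l k f + xB j l * glOp VarB.xs VarB.xxs i k f +
      xB l i * glOp VarB.xs VarB.xxs j k f ∈ SBlow := by
  have h1 : X (VarB.xs l) * (xB i j * pderiv (VarB.xs k) f) +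
      X (VarB.xs i) * (xB j l * pderiv (VarB.xs k) f) +
      X (VarB.xs j) * (xB l i * pderiv (VarB.xs k) f) ∈ SBlow :=
    incidence_thetaB_mem l i j (pderiv (VarB.xs k) f)
  have h2 : ∑ c, (xB i j * (xB l c * pairD VarB.xxs k c f) -
      xB i l * (xB j c * pairD VarB.xxs k c f) +
      xB i c * (xB j l * pairD VarB.xxs k c f)) ∈ SBlow :=
    SBlow.sum_mem fun c _ => pluecker_thetaB_mem i j l c (pairD VarB.xxs k c f)
  have hs : xB l i = - xB i l := pairX_swap _ _ _
  have hx : pairX VarB.xxs = xB := rfl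
  convert add_mem h1 h2 using 1
  simp only [glOp_apply, hx, hs, mul_add, Finset.mul_sum, Finset.sum_add_distrib,
    Finset.sum_sub_distrib, neg_mul, Finset.sum_neg_distrib]
  simp only [mul_left_comm (xB j l)]
  ring

lemma singular_thetaB (w : Om2) (hw : NonnegOdd w) (f : SB) :
    ∑ i, ∑ j, ⁅degZero (wedge w (dd i j)), thetaB i j f⁆ ∈ SBlow := by
  rw [← mk'_eq_zero, map_sum]
  simp only [map_sum]
  refine sum_degZero_wedge (fun i j =>
      (LieSubmodule.Quotient.mk' SBlow : SB →ₗ[ℂ] SB ⧸ SBlow) ∘ₗ actOn actB (thetaB i j f)) ?_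
    -- When x_k∂_l differentiates the factor x*_{ij}, each trace term arises from two summands of
    -- the cyclic sum, hence the factor 2. The terms where it differentiates f lie in S_{B,low} by
    -- `glOp_cyclic_mem`.
    (fun i j => LieSubmodule.Quotient.mk' SBlow (2 * (xB i j * f))) ?_ ?_ w hw
  · intro i j B
    have h : thetaB i j f = - thetaB j i f := by
      change xB i j * f = - (xB j i * f)
      rw [← neg_mul]; exact congrArg (· * f) (pairX_swap _ i j)
    rw [h, LinearMap.comp_apply, LinearMap.comp_apply, actOn_apply, actOn_apply, map_neg, map_neg]
  · intro i j
    have h : xB i j = - xB j i := pairX_swap _ _ _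
    rw [h, neg_mul, mul_neg, map_neg]
  · intro i j l k
    have hx : pairX VarB.xxs = xB := rfl
    have hg (a b i j : Fin 5) : glOp VarB.xs VarB.xxs a b (xB i j) =
        (if b = i then xB a j else 0) + (if b = j then xB i a else 0) :=
      glOp_pairX xxsB_injective (fun _ _ h => by cases h) a b i j
    have hm (i j l : Fin 5) : (if k = i then LieSubmodule.Quotient.mk' SBlow (2 * (xB j l * f))
        else 0) = LieSubmodule.Quotient.mk' SBlow (if k = i then 2 * (xB j l * f) else 0) := by
      split_ifs
      · rfl
      · exact (map_zero _).symm
    rw [hm, hm, hm]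
    simp only [LinearMap.comp_apply, actOn_apply, LieModuleHom.coe_toLinearMap]
    rw [← map_add, ← map_add, ← map_add, ← map_add, ← sub_eq_zero, ← map_sub, mk'_eq_zero]
    convert neg_mem (glOp_cyclic_mem i j l k f) using 1
    have hs1 : xB l j = - xB j l := pairX_swap _ _ _
    have hs2 : xB i l = - xB l i := pairX_swap _ _ _
    have hs3 : xB j i = - xB i j := pairX_swap _ _ _
    simp only [mkDerivation_actB_single, thetaB, LinearMap.mulLeft_apply, Derivation.leibniz, hg,
      smul_eq_mul, hs1, hs2, hs3]
    split_ifs <;> ring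

/-- `θ^B_{ij}` on `V_B`. -/
noncomputable def thetaVB (i j : Fin 5) : VB →ₗ[ℂ] VB := quotOp (thetaB i j) (thetaB_mem_SBlow i j)

lemma isNablaFamily_thetaVB : IsNablaFamily thetaVB :=
  isNablaFamily_quotOp thetaB_mem_SBlow
    (fun i j f => by
      change xB i j * f = - (xB j i * f)
      rw [← neg_mul]; exact congrArg (· * f) (pairX_swap _ i j))
    isTensorFamily_thetaB singular_thetaB
    (fun i j k l f => mul_left_comm _ _ _) pluecker_thetaB_mem

/-- A highest monomial in S_{B,low} would be orthogonal to itself. -/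
lemma highest_notMem_SBlow (m n : ℕ) : (xB 3 4 ^ m * X (VarB.xs 4) ^ n : SB) ∉ SBlow := by
  intro h
  rw [SBlow_eq] at h
  have h0 := fischer_self_eq_zero (h _ (highest_mem_SBhigh m n))
  rw [← monomial_expB, monomial_eq_zero] at h0
  exact one_ne_zero h0

theorem exists_nablaB :
    ∃ (θ : Fin 5 → Fin 5 → VB →ₗ[ℂ] VB) (nabla : M VB →ₗ[U] M VB),
      (∀ i j f, θ i j (LieSubmodule.Quotient.mk f) = LieSubmodule.Quotient.mk (thetaB i j f)) ∧
      IsNabla θ nabla ∧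
      nabla ∘ₗ nabla = 0 ∧
      ∀ m n, ¬ ∀ w ∈ M.sub (VBc m n), nabla w = 0 := by
  refine ⟨thetaVB, nabla isNablaFamily_thetaVB, fun i j f => rfl,
    isNabla_nabla _, nabla_comp_nabla _, fun m n => ?_⟩
  rw [nabla_sub_eq_zero_iff]
  intro h
  have h1 := h _ (LieSubmodule.mem_map_of_mem (highest_mem_highB m n)) 3 4
  rw [thetaVB, quotOp_mk, mk'_eq_zero] at h1
  -- Multiplication by x*_{34} sends the highest vector of bidegree (m, n) to that of (m + 1, n), so
  -- it never vanishes in the quotient.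
  refine highest_notMem_SBlow (m + 1) n ?_
  rw [pow_succ', mul_assoc]
  exact h1

end E510

namespace E510

open MvPolynomial

/-! ### The case `C` -/

lemma pderiv_comm_apply {σ : Type*} (i j : σ) (f : MvPolynomial σ ℂ) :
    pderiv i (pderiv j f) = pderiv j (pderiv i f) := by
  have h := ((isFischerAdj_X j).comp (isFischerAdj_X i)).unique (T' :=
    (pderiv j).toLinearMap ∘ₗ (pderiv i).toLinearMap) (by
      convert (isFischerAdj_X i).comp (isFischerAdj_X j) using 1
      ext f; simp [mul_left_comm])
  exact LinearMap.congr_fun h f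

/-- The operator `xₐ∂_b` on the sum of a five-dimensional space and its dual. -/
noncomputable def glC (a b : Fin 5) : Derivation ℂ SC SC :=
  (X (VarC.x a) : SC) • pderiv (VarC.x b) - (X (VarC.xs b) : SC) • pderiv (VarC.xs a)

lemma glC_apply (a b : Fin 5) (f : SC) : glC a b f =
    X (VarC.x a) * pderiv (VarC.x b) f - X (VarC.xs b) * pderiv (VarC.xs a) f := by
  simp [glC]

lemma isFischerAdj_glC (a b : Fin 5) :
    IsFischerAdj (glC a b).toLinearMap (glC b a).toLinearMap := by
  have h := ((isFischerAdj_X (VarC.x a)).comp (isFischerAdj_X (VarC.x b)).symm).sub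
    ((isFischerAdj_X (VarC.xs b)).comp (isFischerAdj_X (VarC.xs a)).symm)
  convert h using 1 <;>
  · refine LinearMap.ext fun f => (glC_apply _ _ _).trans ?_
    simp

lemma pderiv_x_X_x (i k : Fin 5) :
    pderiv (VarC.x i) (X (VarC.x k) : SC) = if i = k then 1 else 0 := by
  classical
  rw [pderiv_X, Pi.single_apply]; simp [eq_comm]

lemma pderiv_xs_X_xs (i k : Fin 5) :
    pderiv (VarC.xs i) (X (VarC.xs k) : SC) = if i = k then 1 else 0 := by
  classical
  rw [pderiv_X, Pi.single_apply]; simp [eq_comm]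

lemma pderiv_x_X_xs (i k : Fin 5) : pderiv (VarC.x i) (X (VarC.xs k) : SC) = 0 :=
  pderiv_X_of_ne fun h => by cases h

lemma pderiv_xs_X_x (i k : Fin 5) : pderiv (VarC.xs i) (X (VarC.x k) : SC) = 0 :=
  pderiv_X_of_ne fun h => by cases h

lemma mkDerivation_actC (B : Matrix (Fin 5) (Fin 5) ℂ) (f : SC) :
    mkDerivation ℂ (actC B) f = ∑ a, ∑ b, B a b • glC a b f := by
  have h : mkDerivation ℂ (actC B) = ∑ a, ∑ b, B a b • glC a b := by
    refine derivation_ext fun s => ?_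
    simp only [derivation_sum_apply, Derivation.smul_apply, mkDerivation_X]
    cases s with
    | x k =>
      have e : actC B (.x k) = ∑ a, B a k • X (VarC.x a) := rfl
      simp [e, glC_apply, pderiv_x_X_x]
    | xs k =>
      have e : actC B (.xs k) = - ∑ b, B k b • X (VarC.xs b) := rfl
      rw [Finset.sum_comm]
      simp [e, glC_apply, pderiv_xs_X_xs]
  rw [h]
  simp only [derivation_sum_apply, Derivation.smul_apply]

lemma lie_SC (A : sl5) (f : SC) : ⁅A, f⁆ = mkDerivation ℂ (actC A.1) f := rfl

lemma isUnitaryAction_SC : IsUnitaryAction VarC := by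
  intro A f g
  have h (A : sl5) (f : SC) : ⁅A, f⁆ = (∑ a, ∑ b, A.1 a b • (glC a b).toLinearMap) f := by
    rw [lie_SC, mkDerivation_actC]
    simp
  rw [h, h, Finset.sum_comm (f := fun a b => (sl5.conj A).1 a b • (glC a b).toLinearMap)]
  exact IsFischerAdj.sum Finset.univ (fun a => IsFischerAdj.sum Finset.univ fun b =>
    (isFischerAdj_glC a b).smul (A.1 a b)) f g

lemma isVectorFamily_mulC :
    IsVectorFamily dualCoeff fun i => LinearMap.mulLeft ℂ (X (VarC.xs i) : SC) := by
  intro A i f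
  have h : actC A.1 (.xs i) = - ∑ b, A.1 i b • X (VarC.xs b) := rfl
  simp only [LinearMap.mulLeft_apply, lie_SC, Derivation.leibniz, mkDerivation_X, h,
    smul_eq_mul, mul_comm f, Finset.sum_mul, dualCoeff, neg_mul, smul_mul_assoc, neg_smul,
    Finset.sum_neg_distrib]

lemma isVectorFamily_pderivC :
    IsVectorFamily dualCoeff fun i => (pderiv (R := ℂ) (VarC.x i)).toLinearMap := by
  rw [← adjCoeff_stdCoeff]
  refine IsVectorFamily.adj isUnitaryAction_SC (ξ := fun i => LinearMap.mulLeft ℂ (X (VarC.x i))) ?_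
    fun i => isFischerAdj_X _
  intro A i f
  have h : actC A.1 (.x i) = ∑ a, A.1 a i • X (VarC.x a) := rfl
  simp only [LinearMap.mulLeft_apply, lie_SC, Derivation.leibniz, mkDerivation_X, h,
    smul_eq_mul, mul_comm f, Finset.sum_mul, stdCoeff, smul_mul_assoc]

lemma thetaC_apply (i j : Fin 5) (f : SC) : thetaC i j f =
    X (VarC.xs i) * pderiv (VarC.x j) f - X (VarC.xs j) * pderiv (VarC.x i) f := rfl

lemma isTensorFamily_thetaC : IsTensorFamily dualCoeff thetaC :=
  isVectorFamily_mulC.wedge isVectorFamily_pderivC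

/-- The adjoints of the operators `θ^C_{ij}`. -/
noncomputable def thetaCAdj (i j : Fin 5) : SC →ₗ[ℂ] SC :=
  LinearMap.mulLeft ℂ (X (VarC.x j)) ∘ₗ (pderiv (R := ℂ) (VarC.xs i)).toLinearMap -
    LinearMap.mulLeft ℂ (X (VarC.x i)) ∘ₗ (pderiv (R := ℂ) (VarC.xs j)).toLinearMap

lemma isFischerAdj_thetaC (i j : Fin 5) : IsFischerAdj (thetaC i j) (thetaCAdj i j) :=
  ((isFischerAdj_X (VarC.xs i)).comp (isFischerAdj_X (VarC.x j)).symm).sub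
    ((isFischerAdj_X (VarC.xs j)).comp (isFischerAdj_X (VarC.x i)).symm)

lemma isTensorFamily_thetaCAdj : IsTensorFamily stdCoeff thetaCAdj := by
  rw [← adjCoeff_dualCoeff]
  exact isTensorFamily_thetaC.adj isUnitaryAction_SC isFischerAdj_thetaC

/-- The exponent of the highest monomial of bidegree `(m, n)`. -/
noncomputable def expC (m n : ℕ) : VarC →₀ ℕ :=
  Finsupp.single (VarC.x 0) m + Finsupp.single (VarC.xs 4) n

lemma monomial_expC (m n : ℕ) :
    (monomial (expC m n) 1 : SC) = X (VarC.x 0) ^ m * X (VarC.xs 4) ^ n := by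
  rw [expC, X_pow_eq_monomial, X_pow_eq_monomial, monomial_mul, one_mul]

/-- The weights of the indeterminates of `S_C` under a diagonal matrix. -/
def weightC (h : Fin 5 → ℤ) : VarC → ℤ
  | .x k => h k
  | .xs k => - h k

lemma actC_diagSl (h : Fin 5 → ℤ) (h0 : ∑ i, h i = 0) (s : VarC) :
    actC (diagSl h h0).1 s = (weightC h s : ℂ) • X s := by
  cases s with
  | x k =>
    have e (A : Matrix (Fin 5) (Fin 5) ℂ) : actC A (.x k) = ∑ a, A a k • X (VarC.x a) := rfl
    rw [e]
    simp [diagSl_apply, ite_smul, weightC]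
  | xs k =>
    have e (A : Matrix (Fin 5) (Fin 5) ℂ) : actC A (.xs k) = - ∑ b, A k b • X (VarC.xs b) := rfl
    rw [e]
    simp [diagSl_apply, ite_smul, weightC]

lemma actC_isWeightedHomogeneous (B : Matrix (Fin 5) (Fin 5) ℂ) (s : VarC) :
    IsWeightedHomogeneous wtC (actC B s) (wtC s) := by
  rw [← mem_weightedHomogeneousSubmodule]
  cases s with
  | x k =>
    have e : actC B (.x k) = ∑ a, B a k • X (VarC.x a) := rfl
    rw [e]
    exact Submodule.sum_mem _ fun b _ => Submodule.smul_mem _ _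
      (isWeightedHomogeneous_X ℂ wtC (.x b))
  | xs k =>
    have e : actC B (.xs k) = - ∑ b, B k b • X (VarC.xs b) := rfl
    rw [e]
    exact neg_mem (Submodule.sum_mem _ fun b _ => Submodule.smul_mem _ _
      (isWeightedHomogeneous_X ℂ wtC (.xs b)))

lemma lie_diagSl_monomialC (h : Fin 5 → ℤ) (h0 : ∑ i, h i = 0) (β : VarC →₀ ℕ) :
    ⁅diagSl h h0, (monomial β 1 : SC)⁆ =
      ((Finsupp.weight (weightC h) β : ℤ) : ℂ) • monomial β 1 := by
  have e := mkDerivation_monomial_of_eigen (actC_diagSl h h0) β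
  rw [← lie_SC] at e
  exact e

/-- Under diag(1, 0, 0, 0, −1) the maximal weight 1 occurs only at x_0 among the x_i and only at
x*_4 among the x*_i. -/
lemma weightC_le (s : VarC) :
    weightC ![1, 0, 0, 0, -1] s ≤ 1 * ((wtC s).1 : ℤ) + 1 * ((wtC s).2 : ℤ) := by
  rcases s with k | k <;> revert k <;> decide

lemma eq_of_weightC_eq (s : VarC)
    (h : weightC ![1, 0, 0, 0, -1] s = 1 * ((wtC s).1 : ℤ) + 1 * ((wtC s).2 : ℤ)) :
    s = .x 0 ∨ s = .xs 4 := by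
  rcases s with k | k
  · have : ∀ k : Fin 5, weightC ![1, 0, 0, 0, -1] (.x k) =
      1 * ((wtC (.x k)).1 : ℤ) + 1 * ((wtC (.x k)).2 : ℤ) → k = 0 := by decide
    rw [this k h]; exact Or.inl rfl
  · have : ∀ k : Fin 5, weightC ![1, 0, 0, 0, -1] (.xs k) =
      1 * ((wtC (.xs k)).1 : ℤ) + 1 * ((wtC (.xs k)).2 : ℤ) → k = 4 := by decide
    rw [this k h]; exact Or.inr rfl

lemma isHighestFamily_C : IsHighestFamily wtC expC where
  unitary := isUnitaryAction_SC
  homogeneous A _ _ hf := mkDerivation_isWeightedHomogeneous (actC_isWeightedHomogeneous A.1) hf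
  weight m n := by
    rw [expC, map_add, Finsupp.weight_single, Finsupp.weight_single]
    simp [wtC]
  separated := by
    refine ⟨diagSl ![1, 0, 0, 0, -1] (by decide),
      fun β => ((Finsupp.weight (weightC ![1, 0, 0, 0, -1]) β : ℤ) : ℂ),
      lie_diagSl_monomialC _ _, fun m n β hβ hw => ?_⟩
    refine eq_of_weight_eq (w := weightC ![1, 0, 0, 0, -1]) (M₁ := 1) (M₂ := 1) rfl rfl
      weightC_le rfl rfl eq_of_weightC_eq hβ ?_
    rw [Int.cast_inj.mp hw, expC, map_add, Finsupp.weight_single, Finsupp.weight_single]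
    simp [weightC]

/-- The sum of the highest components of `S_C`. -/
noncomputable def SChigh : LieSubmodule ℂ sl5 SC := ⨆ (m : ℕ) (n : ℕ), highC m n

lemma SClow_eq : SClow = orthogonal isUnitaryAction_SC SChigh :=
  iSup_low_eq_orthogonal isHighestFamily_C highC lowC
    (fun m n => by rw [monomial_expC]; rfl) fun _ _ => rfl

lemma SChigh_le {W : LieSubmodule ℂ sl5 SC}
    (h : ∀ m n, X (VarC.x 0) ^ m * X (VarC.xs 4) ^ n ∈ W) : SChigh ≤ W :=
  iSup₂_le fun m n => by
    rw [highC, LieSubmodule.lieSpan_le, Set.singleton_subset_iff]; exact h m n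

lemma highest_mem_highC (m n : ℕ) : X (VarC.x 0) ^ m * X (VarC.xs 4) ^ n ∈ highC m n :=
  LieSubmodule.subset_lieSpan rfl

lemma highest_mem_SChigh (m n : ℕ) : X (VarC.x 0) ^ m * X (VarC.xs 4) ^ n ∈ SChigh :=
  le_iSup₂ (f := highC) m n (highest_mem_highC m n)

lemma pderiv_x_highest (m n : ℕ) (i : Fin 5) :
    pderiv (VarC.x i) (X (VarC.x 0) ^ m * X (VarC.xs 4) ^ n : SC) =
      (m * if i = 0 then 1 else 0 : ℂ) • (X (VarC.x 0) ^ (m - 1) * X (VarC.xs 4) ^ n) :=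
  pderiv_highest _ _ (fun i => if i = 0 then 1 else 0)
    (fun i => by rw [pderiv_x_X_x, apply_ite C, map_one, map_zero])
    (fun i => pderiv_x_X_xs i 4) m n i

lemma pderiv_xs_highest (m n : ℕ) (i : Fin 5) :
    pderiv (VarC.xs i) (X (VarC.x 0) ^ m * X (VarC.xs 4) ^ n : SC) =
      (n * if i = 4 then 1 else 0 : ℂ) • (X (VarC.x 0) ^ m * X (VarC.xs 4) ^ (n - 1)) := by
  rw [mul_comm, mul_comm (X (VarC.x 0) ^ m)]
  exact pderiv_highest _ _ (fun i => if i = 4 then 1 else 0)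
    (fun i => by rw [pderiv_xs_X_xs, apply_ite C, map_one, map_zero])
    (fun i => pderiv_xs_X_x i 0) n m i

lemma mkDerivation_actC_single (k l : Fin 5) (f : SC) :
    mkDerivation ℂ (actC (Matrix.single k l 1)) f = glC k l f := by
  rw [mkDerivation_actC]
  exact sum_single_smul (fun a b => glC a b f) k l

/-- An elementary matrix off the diagonal. -/
noncomputable def singleSl {i j : Fin 5} (h : i ≠ j) : sl5 :=
  ⟨Matrix.single i j 1, by
    change Matrix.trace (Matrix.single i j (1 : ℂ)) = 0
    exact Matrix.trace_single_eq_of_ne i j 1 h⟩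

/-- For j ≠ 0 this is x_j∂_0 applied to x_0^{m+1} x*_4^n, divided by m + 1. Since j ≠ 4, that
operator does not touch x*_4. -/
lemma X_mul_highest_mem (m n : ℕ) {j : Fin 5} (hj : j ≠ 4) :
    X (VarC.x j) * (X (VarC.x 0) ^ m * X (VarC.xs 4) ^ n) ∈ SChigh := by
  by_cases h0 : j = 0
  · subst h0
    rw [← mul_assoc, ← pow_succ']
    exact highest_mem_SChigh _ _
  · have h := SChigh.lie_mem (x := singleSl h0) (highest_mem_SChigh (m + 1) n)
    rw [lie_SC] at h
    change mkDerivation ℂ (actC (Matrix.single j 0 1)) _ ∈ SChigh at h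
    rw [mkDerivation_actC_single, glC_apply, pderiv_x_highest, pderiv_xs_highest, if_pos rfl,
      if_neg hj, mul_zero, zero_smul, mul_zero, sub_zero, mul_one, mul_smul_comm] at h
    have h' := SChigh.smul_mem ((m + 1 : ℕ) : ℂ)⁻¹ h
    rwa [smul_smul, inv_mul_cancel₀ (Nat.cast_ne_zero.mpr m.succ_ne_zero), one_smul] at h'

lemma thetaCAdj_mem_SChigh (i j : Fin 5) {f : SC} (hf : f ∈ SChigh) : thetaCAdj i j f ∈ SChigh := by
  have h : SChigh ≤ isTensorFamily_thetaCAdj.comap SChigh := SChigh_le fun m n i j => by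
    change X (VarC.x j) * pderiv (VarC.xs i) _ - X (VarC.x i) * pderiv (VarC.xs j) _ ∈ SChigh
    rw [pderiv_xs_highest, pderiv_xs_highest, mul_smul_comm, mul_smul_comm]
    -- Only d/dx*_4 acts on the highest vector, and i = j = 4 cancels by skewness. So x_4, which
    -- does not preserve the highest components, is never a multiplier.
    by_cases hi : i = 4 <;> by_cases hj : j = 4
    · rw [hi, hj, sub_self]; exact SChigh.zero_mem
    · rw [if_neg hj, mul_zero, zero_smul, sub_zero]
      exact SChigh.smul_mem _ (X_mul_highest_mem _ _ hj)
    · rw [if_neg hi, mul_zero, zero_smul, zero_sub]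
      exact neg_mem (SChigh.smul_mem _ (X_mul_highest_mem _ _ hi))
    · rw [if_neg hi, if_neg hj, mul_zero, zero_smul, zero_smul, sub_self]; exact SChigh.zero_mem
  exact h hf i j

lemma thetaC_mem_SClow (i j : Fin 5) (f : SC) (hf : f ∈ SClow) : thetaC i j f ∈ SClow := by
  rw [SClow_eq] at hf ⊢
  exact mem_orthogonal_of_isFischerAdj (isFischerAdj_thetaC i j) (fun _ => thetaCAdj_mem_SChigh i j)
    hf

lemma thetaC_swap (i j : Fin 5) (f : SC) : thetaC i j f = - thetaC j i f := by
  rw [thetaC_apply, thetaC_apply, neg_sub]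

/-- The trace term is θ_{ij} f itself: the second order terms cancel in the cyclic sum, and the
first order ones come from differentiating the coefficients x*_i. This is an identity on S_C, with
no passage to the quotient. -/
lemma singular_thetaC (w : Om2) (hw : NonnegOdd w) (f : SC) :
    ∑ i, ∑ j, ⁅degZero (wedge w (dd i j)), thetaC i j f⁆ = 0 := by
  refine sum_degZero_wedge (fun i j => actOn actC (thetaC i j f)) ?_ (fun i j => thetaC i j f)
    (fun i j => thetaC_swap i j f) ?_ w hw
  · intro i j B
    rw [thetaC_swap, actOn_apply, actOn_apply, map_neg]
  · intro i j l k
    simp only [actOn_apply, mkDerivation_actC_single, glC_apply, thetaC_apply, map_sub,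
      Derivation.leibniz, smul_eq_mul, pderiv_x_X_xs, pderiv_xs_X_xs]
    rw [pderiv_comm_apply (VarC.x j) (VarC.x i), pderiv_comm_apply (VarC.x l) (VarC.x i),
      pderiv_comm_apply (VarC.x l) (VarC.x j)]
    simp only [mul_ite, mul_one, mul_zero]
    split_ifs <;> ring

lemma thetaC_thetaC (i j k l : Fin 5) (f : SC) : thetaC i j (thetaC k l f) =
    X (VarC.xs i) * X (VarC.xs k) * pderiv (VarC.x j) (pderiv (VarC.x l) f) -
    X (VarC.xs i) * X (VarC.xs l) * pderiv (VarC.x j) (pderiv (VarC.x k) f) -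
    X (VarC.xs j) * X (VarC.xs k) * pderiv (VarC.x i) (pderiv (VarC.x l) f) +
    X (VarC.xs j) * X (VarC.xs l) * pderiv (VarC.x i) (pderiv (VarC.x k) f) := by
  simp only [thetaC_apply, map_sub, Derivation.leibniz, smul_eq_mul, pderiv_x_X_xs]
  ring

/-- θ is the wedge product of the vectors of operators (x*_i) and (d/dx_i), all of whose entries
commute with each other. So it is a decomposable bivector. -/
lemma pluecker_thetaC (i j k l : Fin 5) (f : SC) : pluecker thetaC i j k l f = 0 := by
  change thetaC i j (thetaC k l f) - thetaC i k (thetaC j l f) + thetaC i l (thetaC j k f) = 0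
  rw [thetaC_thetaC, thetaC_thetaC, thetaC_thetaC, pderiv_comm_apply (VarC.x k) (VarC.x j),
    pderiv_comm_apply (VarC.x l) (VarC.x j), pderiv_comm_apply (VarC.x l) (VarC.x k)]
  ring

lemma thetaC_comm (i j k l : Fin 5) (f : SC) :
    thetaC i j (thetaC k l f) = thetaC k l (thetaC i j f) := by
  rw [thetaC_thetaC, thetaC_thetaC, pderiv_comm_apply (VarC.x l) (VarC.x j),
    pderiv_comm_apply (VarC.x l) (VarC.x i), pderiv_comm_apply (VarC.x k) (VarC.x j),
    pderiv_comm_apply (VarC.x k) (VarC.x i)]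
  ring

/-- `θ^C_{ij}` on `V_C`. -/
noncomputable def thetaVC (i j : Fin 5) : VC →ₗ[ℂ] VC := quotOp (thetaC i j) (thetaC_mem_SClow i j)

lemma isNablaFamily_thetaVC : IsNablaFamily thetaVC :=
  isNablaFamily_quotOp thetaC_mem_SClow thetaC_swap isTensorFamily_thetaC
    (fun w hw f => by rw [singular_thetaC w hw f]; exact SClow.zero_mem) thetaC_comm
    fun i j k l f => by rw [pluecker_thetaC]; exact SClow.zero_mem

lemma highest_notMem_SClow (m n : ℕ) : (X (VarC.x 0) ^ m * X (VarC.xs 4) ^ n : SC) ∉ SClow := by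
  intro h
  rw [SClow_eq] at h
  have h0 := fischer_self_eq_zero (h _ (highest_mem_SChigh m n))
  rw [← monomial_expC, monomial_eq_zero] at h0
  exact one_ne_zero h0

theorem exists_nablaC :
    ∃ (θ : Fin 5 → Fin 5 → VC →ₗ[ℂ] VC) (nabla : M VC →ₗ[U] M VC),
      (∀ i j f, θ i j (LieSubmodule.Quotient.mk f) = LieSubmodule.Quotient.mk (thetaC i j f)) ∧
      IsNabla θ nabla ∧
      nabla ∘ₗ nabla = 0 ∧
      ∀ m n, (∀ w ∈ M.sub (VCc m n), nabla w = 0) ↔ m = 0 := by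
  refine ⟨thetaVC, nabla isNablaFamily_thetaVC, fun i j f => rfl,
    isNabla_nabla _, nabla_comp_nabla _, fun m n => ?_⟩
  rw [nabla_sub_eq_zero_iff]
  constructor
  · intro h
    by_contra hm
    -- θ_{40} sends x_0^m x*_4^n to m x_0^{m−1} x*_4^{n+1}, a multiple of the highest vector of
    -- bidegree (m − 1, n + 1).
    have h1 := h _ (LieSubmodule.mem_map_of_mem (highest_mem_highC m n)) 4 0
    rw [thetaVC, quotOp_mk, mk'_eq_zero, thetaC_apply, pderiv_x_highest, pderiv_x_highest,
      if_pos rfl, if_neg (by decide), mul_zero, zero_smul, mul_zero, sub_zero, mul_one,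
      mul_smul_comm, mul_left_comm, ← pow_succ'] at h1
    have h2 := SClow.smul_mem (m : ℂ)⁻¹ h1
    rw [smul_smul, inv_mul_cancel₀ (Nat.cast_ne_zero.mpr hm), one_smul] at h2
    exact highest_notMem_SClow _ _ h2
  · rintro rfl v hv i j
    obtain ⟨f, hf, rfl⟩ := (LieSubmodule.mem_map _).mp hv
    have hle : highC 0 n ≤ isTensorFamily_thetaC.comap ⊥ := by
      rw [highC, LieSubmodule.lieSpan_le, Set.singleton_subset_iff]
      intro i j
      rw [thetaC_apply, pderiv_x_highest, pderiv_x_highest]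
      simp
    have h0 : thetaC i j f = 0 := hle hf i j
    rw [thetaVC, quotOp_mk, h0, map_zero]

end E510

/-- In each of the cases `X = A, B, C` the operators `θ^X_{ij}` act on `V_X`, the formula
`u ⊗ v ↦ ∑ u d_{ij} ⊗ θ^X_{ij} v` defines an `E(5,10)`-morphism `∇_X` of `M(V_X)`, its square is
zero, and its restriction to the component with indices `(m, n)`, that is to `M(m,n,0,0)`,
`M(0,0,m,n)`, `M(m,0,0,n)` respectively, vanishes if and only if `X = A` and `n = 0`, or `X = C`
and `m = 0`. -/
theorem proposition4p3 :
    (∃ (θ : Fin 5 → Fin 5 → VA →ₗ[ℂ] VA) (nabla : M VA →ₗ[U] M VA),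
      (∀ i j f, (θ i j f : SA) = thetaA i j f) ∧ IsNabla θ nabla ∧
      nabla ∘ₗ nabla = 0 ∧
      ∀ m n, (∀ w ∈ M.sub (VAc m n), nabla w = 0) ↔ n = 0) ∧
    (∃ (θ : Fin 5 → Fin 5 → VB →ₗ[ℂ] VB) (nabla : M VB →ₗ[U] M VB),
      (∀ i j f, θ i j (LieSubmodule.Quotient.mk f) = LieSubmodule.Quotient.mk (thetaB i j f)) ∧
      IsNabla θ nabla ∧
      nabla ∘ₗ nabla = 0 ∧
      ∀ m n, ¬ ∀ w ∈ M.sub (VBc m n), nabla w = 0) ∧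
    (∃ (θ : Fin 5 → Fin 5 → VC →ₗ[ℂ] VC) (nabla : M VC →ₗ[U] M VC),
      (∀ i j f, θ i j (LieSubmodule.Quotient.mk f) = LieSubmodule.Quotient.mk (thetaC i j f)) ∧
      IsNabla θ nabla ∧
      nabla ∘ₗ nabla = 0 ∧
      ∀ m n, (∀ w ∈ M.sub (VCc m n), nabla w = 0) ↔ m = 0) :=
  ⟨exists_nablaA, exists_nablaB, exists_nablaC⟩
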